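/- **Setting.** Let $d,k\ge 1$ be integers, $M>0$, $\gamma_1,\gamma_2\ge 0$, and let $T\ge 2$ be an integer (the horizon). Let $\mathcal X\subseteq[0,1]^d$ be convex and compact, $f:\mathcal X\to\mathbb R$, $f\in\Sigma_d(k,M)$, i.e. $f\in\mathcal C^k(\mathcal X)$ and all partial derivatives of $f$ of order at most $k$ are bounded by $M$ in absolute value on $\mathcal X$. Assume that $f$ has a maximizer $x^*$ over $\mathcal X$ with $\{x:\|x-x^*\|_\infty\le\delta_0\}\subseteq\mathcal X$ for some $\delta_0>0$; put $f^*=f(x^*)$. Let $\mathcal Z\subseteq\mathcal X$ be convex and compact with $x^*\in\mathcal Z$, and let $\psi:\mathcal X\to[0,\infty)$ be convex, Lipschitz for $\|\cdot\|_\infty$, and zero on $\mathcal Z$. A query $(n,x,x')$ ($n\ge1$, $x,x'\in\mathcal X$) lasts $n$ time periods and is answered by $y\sim\mathcal O(n,x,x')$, given the past and the query. The oracle $\mathcal O$ is $(\gamma_1,\gamma_2)$-consistent: for all $\delta\in(0,1)$, $n\ge 1$, $x,x'\in\mathcal X$, $\Pr\big[|y-(f(x')-f(x))|>\sqrt{(\gamma_1+\gamma_2\ln(1/\delta))/n}\big]\le\delta$.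 If the queries $(n_\tau,x_\tau,x'_\tau)_{\tau\ge 1}$ are made, and the last one is cut so that $\sum_\tau n_\tau=T$, the cumulative regret is $$\sum_{\tau}n_\tau\big(2f^*-f(x_\tau)-f(x'_\tau)\big)+T\,\psi\Big(\frac1{2T}\sum_\tau n_\tau(x_\tau+x'_\tau)\Big).$$ **Algorithm.** Let $J=\lceil T^{1/(2k+d)}\rceil$, $C_1=\gamma_1+2\gamma_2\ln T$, $C_2=(d+k)^kMJ^{-k}$, $\nu=\binom{k+d-1}{d}$, $C_2'=(12\nu+116M)C_2\nu^2\ln^{1.5}(5\nu T)$, $C_3=(68M+85\sqrt{C_1})^2M^2\nu^4\ln^3(5\nu T)$. For $\boldsymbol j\in[J]^d$ let $\mathcal X_{\boldsymbol j}=\prod_i[\frac{j_i-1}J,\frac{j_i}J]\cap\mathcal X\cap\mathcal Z$. If $\mathcal X_{\boldsymbol j}\neq\emptyset$, fix any $x_{\boldsymbol j}\in\mathcal X_{\boldsymbol j}$ and let $\phi_{\boldsymbol j}(x)=\big[\prod_i(x_i-x_{\boldsymbol ji})^{k_i}\big]_{k_1+\dots+k_d<k}\in\mathbb R^\nu$.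 All choices called arbitrary (and ties) may be made in any way. *BatchLinUCB$(\boldsymbol j,x_{\mathsf s},N)$.* Put $\tau_\infty=\nu\log_2(2N\nu)$, $C_1'=2M\sqrt\nu+2C_2\sqrt{\tau_\infty N}+2\sqrt{C_1\tau_\infty}$, $\Lambda=I$, $\hat\theta=0$. For $\tau=1,2,\dots$ until $N$ periods are used: let $x_\tau$ maximize over $x\in\mathcal X_{\boldsymbol j}$ the value $\min\{M,\langle\hat\theta,\varphi\rangle+C_1'\sqrt{\varphi^\top\Lambda^{-1}\varphi}+C_2\}$, where $\varphi=\phi_{\boldsymbol j}(x)-\phi_{\boldsymbol j}(x_{\mathsf s})$; put $\phi_\tau=\phi_{\boldsymbol j}(x_\tau)-\phi_{\boldsymbol j}(x_{\mathsf s})$; let $n_\tau$ be the smallest integer with $\det(\Lambda+n_\tau\phi_\tau\phi_\tau^\top)>2\det\Lambda$, or the number of remaining periods if this is smaller or no such integer exists; let $y_\tau$ be the answer to the query $(n_\tau,x_{\mathsf s},x_\tau)$ (an estimate of $f(x_\tau)-f(x_{\mathsf s})$); replace $\Lambda$ by $\Lambda+n_\tau\phi_\tau\phi_\tau^\top$ and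 $\hat\theta$ by the minimizer of $\sum_{i\le\tau}n_i(y_i-\langle\theta,\phi_i\rangle)^2+\|\theta\|_2^2$ over $\|\theta\|_2\le M\sqrt\nu$. Return $x_{\tau}$ for a $\tau$ that maximizes $n_\tau$. *IterativeBatchLinUCB$(\boldsymbol j,N)$.* Let $x_0\in\mathcal X_{\boldsymbol j}$ be arbitrary and $\beta_0=\lfloor\log_2(N+1)\rfloor-1$. For $\beta=1,\dots,\beta_0$ let $x_\beta$ be the output of BatchLinUCB$(\boldsymbol j,x_{\beta-1},2^\beta)$. For the rest of the $N$ periods play $(x_{\beta_0},x_{\beta_0})$. Return $x_{\beta_0}$. *Main loop.* Let $\mathcal A_1=\{\boldsymbol j\in[J]^d:\mathcal X_{\boldsymbol j}\ne\emptyset\}$. For $\zeta=1,2,\dots$, until $T$ periods have been used (the procedure is interrupted at that time), put $\varepsilon_\zeta=2^{-\zeta}$, $N_\zeta=\lceil C_3/\varepsilon_\zeta^2\rceil$ and do the following. If fewer than $3(|\mathcal A_\zeta|-1)N_\zeta$ periods remain, pick an arbitrary $\boldsymbol j\in\mathcal A_\zeta$ and play for all remaining periods $(x_{\boldsymbol j,\zeta-1},x_{\boldsymbol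 j,\zeta-1})$, the latest solution found in this cell, or arbitrary $x,x'\in\mathcal X_{\boldsymbol j}$ if $\zeta=1$. Otherwise: (i) for each $\boldsymbol j\in\mathcal A_\zeta$ let $x_{\boldsymbol j,\zeta}$ be the output of IterativeBatchLinUCB$(\boldsymbol j,N_\zeta)$; (ii) run a knock-out tournament among the elements of $\mathcal A_\zeta$: in every round the competitors are paired arbitrarily (if their number is odd, an arbitrary one advances directly), and from a pair $\boldsymbol j,\boldsymbol j'$, with answer $y$ to the query $(N_\zeta,x_{\boldsymbol j,\zeta},x_{\boldsymbol j',\zeta})$, $\boldsymbol j'$ advances if $y\ge0$ and $\boldsymbol j$ if $y<0$, until only one competitor $\hat{\boldsymbol j}$ is left; (iii) let $\mathcal A_{\zeta+1}$ consist of $\hat{\boldsymbol j}$ and of those $\boldsymbol j\in\mathcal A_\zeta\setminus\{\hat{\boldsymbol j}\}$ for which the answer $y$ to the query $(N_\zeta,x_{\boldsymbol j,\zeta},x_{\hat{\boldsymbol j},\zeta})$ satisfies $y\le\varepsilon_\zeta+C_2'$. **Theorem.** There is a polynomial $\overline C_1=\overline C_1(k,d)$ with the following property. With probability $1-\tilde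 O(T^{-2})$ the cumulative regret of this algorithm is at most $$\overline C_1\,\big(M^2\nu^2+\nu^3+M\nu^2\sqrt{\gamma_1+\gamma_2\ln T}\big)\,T^{\frac{k+d}{2k+d}}\ln^4T .$$ Here $\tilde O(T^{-2})$ means at most $A\,T^{-2}\ln^pT$ for all $T\ge2$, with $A,p$ that depend only on $k,d,M,\gamma_1,\gamma_2$. -/

import Mathlib

open MeasureTheory ProbabilityTheory
open scoped Matrix

noncomputable section

namespace PairwiseBandit

/-- Points of `ℝ^d` (the norm of this type is the sup norm). -/
abbrev Pt (d : ℕ) := Fin d → ℝ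

/-- `f ∈ Σ_d(k, M)` over `X`: `f` is `C^k` on `X` and every partial derivative of order `m ≤ k`
is bounded by `M` on `X`. A partial derivative of order `m` is given by the coordinates
`i 0, …, i (m - 1)` in which one differentiates. -/
def Holder {d : ℕ} (X : Set (Pt d)) (k : ℕ) (M : ℝ) (f : Pt d → ℝ) : Prop :=
  ContDiffOn ℝ k f X ∧
    ∀ m ≤ k, ∀ i : Fin m → Fin d, ∀ x ∈ X,
      |iteratedFDerivWithin ℝ m f X x (fun l => Pi.single (i l) (1 : ℝ))| ≤ M

/-- A query `(n, x, x')`: compare `x` and `x'` during `n` time periods. -/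
abbrev Query (d : ℕ) := ℕ × Pt d × Pt d

/-- `(γ₁, γ₂)`-consistency on `X` of an oracle, i.e. of a Markov kernel that maps a query
`(n, x, x')` to the law of the answer, an estimate of `f x' - f x`. -/
def Consistent {d : ℕ} (X : Set (Pt d)) (f : Pt d → ℝ) (γ₁ γ₂ : ℝ)
    (O : Kernel (Query d) ℝ) : Prop :=
  ∀ δ : ℝ, 0 < δ → δ < 1 → ∀ n : ℕ, 1 ≤ n → ∀ x ∈ X, ∀ x' ∈ X,
    O (n, x, x') {y | √((γ₁ + γ₂ * Real.log (1 / δ)) / n) < |y - (f x' - f x)|}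
      ≤ ENNReal.ofReal δ

/-- The history before the answer to query number `τ`: all earlier queries and answers, and the
query number `τ`. -/
def history {d : ℕ} {Ω : Type*} (q : ℕ → Ω → Query d) (y : ℕ → Ω → ℝ) (τ : ℕ) (ω : Ω) :
    (Fin τ → Query d × ℝ) × Query d :=
  (fun i => (q i ω, y i ω), q τ ω)

/-- The random queries `q 0, q 1, …` are answered by the oracle `O`: given the history, the answer
`y τ` has law `O (q τ)`. -/
structure IsInteraction {d : ℕ} {Ω : Type*} [MeasurableSpace Ω] (μ : Measure Ω)
    (O : Kernel (Query d) ℝ) (q : ℕ → Ω → Query d) (y : ℕ → Ω → ℝ) : Prop where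
  measurable_query : ∀ τ, Measurable (q τ)
  measurable_answer : ∀ τ, Measurable (y τ)
  law_answer : ∀ τ,
    HasCondDistrib (𝓧 := (Fin τ → Query d × ℝ) × Query d) (m𝓧 := inferInstance)
      (y τ) (history q y τ) (O.comap (fun h => h.2) measurable_snd) μ

/-- The number of those time periods of query number `τ` that are among the first `T` time periods
(natural subtraction: it is `0` once `T` periods have passed). -/
def periods {d : ℕ} (T : ℕ) (q : ℕ → Query d) (τ : ℕ) : ℕ :=
  min (q τ).1 (T - ∑ i ∈ Finset.range τ, (q i).1)

/-- The cumulative regret over the first `T` time periods of a sequence of queries, with penalty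
`ψ`. If every query lasts at least one period, the queries with number `≥ T` have no period among
the first `T` ones. -/
def regret {d : ℕ} (f : Pt d → ℝ) (fstar : ℝ) (ψ : Pt d → ℝ) (T : ℕ) (q : ℕ → Query d) : ℝ :=
  ∑ τ ∈ Finset.range T, (periods T q τ : ℝ) * (2 * fstar - f (q τ).2.1 - f (q τ).2.2)
    + T * ψ ((1 / (2 * (T : ℝ))) •
        ∑ τ ∈ Finset.range T, (periods T q τ : ℝ) • ((q τ).2.1 + (q τ).2.2))

/-- The number of monomials of degree less than `k` in `d` variables (`k ≥ 1`). -/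
def nu (k d : ℕ) : ℕ := (k + d - 1).choose d

/-- Multi-indices of length `d` and total degree less than `k`. -/
abbrev MIdx (k d : ℕ) := {α : Fin d → Fin k // ∑ i, (α i : ℕ) < k}

/-- One query together with its answer. -/
structure Step (d : ℕ) where
  /-- number of time periods -/
  n : ℕ
  /-- first solution -/
  x : Pt d
  /-- second solution -/
  x' : Pt d
  /-- answer, an estimate of `f x' - f x` -/
  y : ℝ

/-- The total number of time periods of a transcript. -/
def time {d : ℕ} (L : List (Step d)) : ℕ := (L.map Step.n).sum

/-- The transcript of the first `m` queries. -/
def transcript {d : ℕ} (q : ℕ → Query d) (y : ℕ → ℝ) (m : ℕ) : List (Step d) :=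
  (List.range m).map fun i => ⟨(q i).1, (q i).2.1, (q i).2.2, y i⟩

/-- The input of the algorithm: horizon, parameters, the feasible set `X ∩ Z`, and the centers
of the cells. -/
structure Params (d : ℕ) where
  T : ℕ
  k : ℕ
  J : ℕ
  M : ℝ
  C₁ : ℝ
  C₂ : ℝ
  feas : Set (Pt d)
  center : (Fin d → Fin J) → Pt d

namespace Params

variable {d : ℕ} (P : Params d)

/-- The indices of the grid cells. -/
abbrev Cell := Fin d → Fin P.J

/-- The feasible part of a grid cube (cubes are numbered from `0`). -/
def cell (j : P.Cell) : Set (Pt d) :=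
  {x | ∀ i, ((j i : ℕ) : ℝ) / P.J ≤ x i ∧ x i ≤ (((j i : ℕ) : ℝ) + 1) / P.J} ∩ P.feas

/-- `ν` as a real number. -/
def ν : ℝ := (nu P.k d : ℝ)

/-- The local polynomial map of a cell. -/
def feature (j : P.Cell) (x : Pt d) : MIdx P.k d → ℝ :=
  fun α => ∏ i, (x i - P.center j i) ^ (α.1 i : ℕ)

/-- The difference of the features of `x` and of the baseline `xs`. -/
def featDiff (j : P.Cell) (xs x : Pt d) : MIdx P.k d → ℝ :=
  P.feature j x - P.feature j xs

/-! ### Batched LinUCB -/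

/-- The matrix `Λ` after the steps `B`. -/
def gram (j : P.Cell) (xs : Pt d) (B : List (Step d)) : Matrix (MIdx P.k d) (MIdx P.k d) ℝ :=
  1 + (B.map fun s => (s.n : ℝ) •
    Matrix.vecMulVec (P.featDiff j xs s.x') (P.featDiff j xs s.x')).sum

/-- The regularized weighted least squares objective after the steps `B`. -/
def ridgeLoss (j : P.Cell) (xs : Pt d) (B : List (Step d)) (θ : MIdx P.k d → ℝ) : ℝ :=
  (B.map fun s => (s.n : ℝ) * (s.y - θ ⬝ᵥ P.featDiff j xs s.x') ^ 2).sum + θ ⬝ᵥ θ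

/-- `θ` is the estimate after the steps `B`: it minimizes the objective in the Euclidean ball of
radius `M √ν` (so it is `0` if `B` is empty). -/
def IsEstimate (j : P.Cell) (xs : Pt d) (B : List (Step d)) (θ : MIdx P.k d → ℝ) : Prop :=
  √(θ ⬝ᵥ θ) ≤ P.M * √P.ν ∧
    ∀ θ' : MIdx P.k d → ℝ, √(θ' ⬝ᵥ θ') ≤ P.M * √P.ν →
      P.ridgeLoss j xs B θ ≤ P.ridgeLoss j xs B θ'

/-- `τ_∞ = ν log₂ (2 N ν)`. -/
def tauInf (N : ℕ) : ℝ := P.ν * Real.logb 2 (2 * N * P.ν)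

/-- The width `C₁'` of the confidence bounds of a batch of `N` periods. -/
def C₁' (N : ℕ) : ℝ :=
  2 * P.M * √P.ν + 2 * P.C₂ * √(P.tauInf N * N) + 2 * √(P.C₁ * P.tauInf N)

/-- The upper confidence bound at `x` after the steps `B`, with the estimate `θ`. -/
def ucb (j : P.Cell) (xs : Pt d) (N : ℕ) (B : List (Step d)) (θ : MIdx P.k d → ℝ)
    (x : Pt d) : ℝ :=
  min P.M (θ ⬝ᵥ P.featDiff j xs x
    + P.C₁' N * √(P.featDiff j xs x ⬝ᵥ ((P.gram j xs B)⁻¹ *ᵥ P.featDiff j xs x)) + P.C₂)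

/-- `s` is a possible next step of the batched LinUCB routine after the steps `B`: the new solution
`s.x'` maximizes the upper confidence bound over the cell and is compared with the baseline `xs`
for the smallest number of periods that more than doubles the determinant of `Λ`, or for all
remaining periods if these do not suffice. -/
def IsBatchStep (j : P.Cell) (xs : Pt d) (N : ℕ) (B : List (Step d)) (s : Step d) : Prop :=
  s.x = xs ∧ s.x' ∈ P.cell j ∧
  (∃ θ, P.IsEstimate j xs B θ ∧
    ∀ z ∈ P.cell j, P.ucb j xs N B θ z ≤ P.ucb j xs N B θ s.x') ∧
  0 < s.n ∧ time B + s.n ≤ N ∧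
  (∀ m < s.n, (P.gram j xs B + (m : ℝ) •
      Matrix.vecMulVec (P.featDiff j xs s.x') (P.featDiff j xs s.x')).det
        ≤ 2 * (P.gram j xs B).det) ∧
  (2 * (P.gram j xs B).det < (P.gram j xs B + (s.n : ℝ) •
      Matrix.vecMulVec (P.featDiff j xs s.x') (P.featDiff j xs s.x')).det
    ∨ time B + s.n = N)

/-- `L` is a complete transcript of batched LinUCB in cell `j` with baseline `xs` and `N` periods,
and it returns `x`, a solution that was used in one of the longest steps. -/
def BatchRun (j : P.Cell) (xs : Pt d) (N : ℕ) (L : List (Step d)) (x : Pt d) : Prop :=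
  (∀ (B : List (Step d)) (s : Step d) (R : List (Step d)),
    L = B ++ s :: R → P.IsBatchStep j xs N B s) ∧
  time L = N ∧
  ∃ s ∈ L, (∀ s' ∈ L, s'.n ≤ s.n) ∧ x = s.x'

/-! ### Iterated batched LinUCB -/

/-- The first `β` batches, of `2, 4, …, 2 ^ β` periods, have transcript `L` and return `x`. -/
inductive IterLoop (j : P.Cell) : ℕ → List (Step d) → Pt d → Prop
  | zero (x : Pt d) (hx : x ∈ P.cell j) : IterLoop j 0 [] x
  | succ (β : ℕ) (L B : List (Step d)) (x x' : Pt d) (hL : IterLoop j β L x)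
      (hB : P.BatchRun j x (2 ^ (β + 1)) B x') : IterLoop j (β + 1) (L ++ B) x'

/-- `L` is a complete transcript of the iterated routine in cell `j` with `N ≥ 1` periods, and it
returns `x`: after `⌊log₂ (N + 1)⌋ - 1` batches it commits to `(x, x)`. -/
def IterRun (j : P.Cell) (N : ℕ) (L : List (Step d)) (x : Pt d) : Prop :=
  ∃ (L₀ : List (Step d)) (y : ℝ), P.IterLoop j (Nat.log 2 (N + 1) - 1) L₀ x ∧
    L = L₀ ++ [⟨N - time L₀, x, x, y⟩]

/-! ### Tournament successive elimination -/

/-- `C₂'`. -/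
def C₂' : ℝ :=
  (12 * P.ν + 116 * P.M) * P.C₂ * P.ν ^ 2 * Real.log (5 * P.ν * P.T) ^ (3 / 2 : ℝ)

/-- `C₃`. -/
def C₃ : ℝ :=
  (68 * P.M + 85 * √P.C₁) ^ 2 * P.M ^ 2 * P.ν ^ 4 * Real.log (5 * P.ν * P.T) ^ 3

/-- `ε_ζ = 2 ^ (-ζ)`. -/
def eps (ζ : ℕ) : ℝ := (1 / 2 : ℝ) ^ ζ

/-- `N_ζ`. -/
def Nz (ζ : ℕ) : ℕ := ⌈P.C₃ / eps ζ ^ 2⌉₊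

/-- Preprocessing: for every `j ∈ A`, in some order, the iterated routine with `N` periods is run
in cell `j` and returns `sol j`. -/
def Preprocess (N : ℕ) (A : Finset P.Cell) (L : List (Step d)) (sol : P.Cell → Pt d) : Prop :=
  ∃ R : List (P.Cell × List (Step d)),
    (R.map Prod.fst).Nodup ∧ (∀ j, j ∈ R.map Prod.fst ↔ j ∈ A) ∧
    (∀ r ∈ R, P.IterRun r.1 N r.2 (sol r.1)) ∧
    L = R.flatMap Prod.snd

/-- One round of the tournament, from the competitors `A` to the competitors `A'`: the elements of
`A` are split into pairs, up to one element `bye` if their number is odd, which advances directly.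
A match is recorded as `(j, j', y)` with `y` the answer to the comparison of `j` and `j'`. -/
def Round (N : ℕ) (sol : P.Cell → Pt d) (A : Finset P.Cell) (L : List (Step d))
    (A' : Finset P.Cell) : Prop :=
  ∃ (matches' : List (P.Cell × P.Cell × ℝ)) (bye : Option P.Cell),
    ((matches'.flatMap fun m => [m.1, m.2.1]) ++ bye.toList).Nodup ∧
    (∀ j, j ∈ (matches'.flatMap fun m => [m.1, m.2.1]) ++ bye.toList ↔ j ∈ A) ∧
    L = (matches'.map fun m => ⟨N, sol m.1, sol m.2.1, m.2.2⟩) ∧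
    ∀ j, j ∈ A' ↔ j ∈ bye ∨
      ∃ m ∈ matches', (0 ≤ m.2.2 ∧ j = m.2.1) ∨ (m.2.2 < 0 ∧ j = m.1)

/-- The rounds are repeated until a single competitor, the winner, is left. -/
inductive Tournament (N : ℕ) (sol : P.Cell → Pt d) :
    Finset P.Cell → List (Step d) → P.Cell → Prop
  | done (j : P.Cell) : Tournament N sol {j} [] j
  | round (A A' : Finset P.Cell) (L L' : List (Step d)) (w : P.Cell) (hA : 1 < A.card)
      (hround : P.Round N sol A L A') (hrest : Tournament N sol A' L' w) :
      Tournament N sol A (L ++ L') w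

/-- Elimination: every `j ∈ A` other than the winner `w` is compared, in some order, with `w`, and
survives if the answer is at most `thr`; `A'` consists of `w` and the survivors. -/
def Eliminate (N : ℕ) (thr : ℝ) (sol : P.Cell → Pt d) (A : Finset P.Cell) (w : P.Cell)
    (L : List (Step d)) (A' : Finset P.Cell) : Prop :=
  ∃ R : List (P.Cell × ℝ),
    (R.map Prod.fst).Nodup ∧ (∀ j, j ∈ R.map Prod.fst ↔ j ∈ A ∧ j ≠ w) ∧
    L = (R.map fun r => ⟨N, sol r.1, sol w, r.2⟩) ∧
    ∀ j, j ∈ A' ↔ j = w ∨ ∃ r ∈ R, r.2 ≤ thr ∧ j = r.1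

/-- Outer iteration `ζ`, from the active cells `A` to the active cells `A'`. -/
def Phase (ζ : ℕ) (A : Finset P.Cell) (L : List (Step d)) (sol : P.Cell → Pt d)
    (A' : Finset P.Cell) : Prop :=
  ∃ (L₁ L₂ L₃ : List (Step d)) (w : P.Cell),
    P.Preprocess (P.Nz ζ) A L₁ sol ∧
    P.Tournament (P.Nz ζ) sol A L₂ w ∧
    P.Eliminate (P.Nz ζ) (eps ζ + P.C₂') sol A w L₃ A' ∧
    L = L₁ ++ L₂ ++ L₃

/-- `MainRun t ζ A prev L`: `L` is a transcript of the main loop, started with outer iteration `ζ`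
when `t` periods have passed, with active cells `A` and with the solutions `prev` found in the
cells by the previous outer iteration (`none` if there was none). The loop ends as soon as `T`
periods have passed; the last outer iteration is listed completely, also if it is interrupted
after `T` periods. -/
inductive MainRun : ℕ → ℕ → Finset P.Cell → Option (P.Cell → Pt d) → List (Step d) → Prop
  | done (t ζ : ℕ) (A : Finset P.Cell) (prev : Option (P.Cell → Pt d)) (ht : P.T ≤ t) :
      MainRun t ζ A prev []
  | commitFirst (t ζ : ℕ) (A : Finset P.Cell) (j : P.Cell) (x x' : Pt d) (y : ℝ)
      (ht : t < P.T) (hshort : P.T - t < 3 * (A.card - 1) * P.Nz ζ)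
      (hj : j ∈ A) (hx : x ∈ P.cell j) (hx' : x' ∈ P.cell j) :
      MainRun t ζ A none [⟨P.T - t, x, x', y⟩]
  | commit (t ζ : ℕ) (A : Finset P.Cell) (sol : P.Cell → Pt d) (j : P.Cell) (y : ℝ)
      (ht : t < P.T) (hshort : P.T - t < 3 * (A.card - 1) * P.Nz ζ) (hj : j ∈ A) :
      MainRun t ζ A (some sol) [⟨P.T - t, sol j, sol j, y⟩]
  | phase (t ζ : ℕ) (A A' : Finset P.Cell) (prev : Option (P.Cell → Pt d))
      (sol : P.Cell → Pt d) (L L' : List (Step d))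
      (ht : t < P.T) (hlong : 3 * (A.card - 1) * P.Nz ζ ≤ P.T - t)
      (hphase : P.Phase ζ A L sol A')
      (hrest : MainRun (t + time L) (ζ + 1) A' (some sol) L') :
      MainRun t ζ A prev (L ++ L')

/-- `L` is a transcript of the algorithm, which starts with all cells that contain a feasible
point. -/
def IsRun (L : List (Step d)) : Prop :=
  ∃ A : Finset P.Cell, (∀ j, j ∈ A ↔ (P.cell j).Nonempty) ∧ P.MainRun 0 1 A none L

end Params

/-- The grid size `J = ⌈T ^ (1 / (2 k + d))⌉`. -/
def gridSize (T k d : ℕ) : ℕ := ⌈(T : ℝ) ^ (1 / (2 * (k : ℝ) + d))⌉₊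

/-- The input with `J = ⌈T ^ (1 / (2 k + d))⌉`, `C₁ = γ₁ + 2 γ₂ ln T`,
`C₂ = (d + k) ^ k M J ^ (-k)`. -/
def tunedParams {d : ℕ} (T k : ℕ) (M γ₁ γ₂ : ℝ) (feas : Set (Pt d))
    (center : (Fin d → Fin (gridSize T k d)) → Pt d) : Params d where
  T := T
  k := k
  J := gridSize T k d
  M := M
  C₁ := γ₁ + 2 * γ₂ * Real.log T
  C₂ := ((d : ℝ) + k) ^ k * M / (gridSize T k d : ℝ) ^ k
  feas := feas
  center := center

end PairwiseBandit

end

/-! On a cell of side `1 / J` the Taylor polynomial of degree less than `k` replaces `f` up to `C₂`,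
which is of order `J ^ (-k)`. Inside a cell one therefore faces a linear bandit with `ν` features
and misspecification `C₂`. A step of a batch ends when the determinant of the Gram matrix has
doubled, and this determinant is polynomially bounded, so a batch has at most `1 + tauInf` steps
(`length_le_tauInf`). The squared noise of an accurate answer, weighted by its `n` periods, is
bounded independently of `n`; few steps thus mean a small confidence ellipsoid (`estimate_error_le`,
`abs_estimate_sub_le`). Optimism then gives the error `errConst + errSlope / √N` of a batch of `N`
periods. Batches of doubling length, each with the previous output as baseline, keep the loss of
order `√N` up to the bias and a logarithm (`iterRun_bounds`).

A knock-out tournament has logarithmically many rounds, each losing at most the noise of one answer,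
so its winner is nearly as good as the solution of the cell of the maximizer. Elimination against
the winner keeps this cell and leaves only cells whose gap is of order `ε_ζ + C₂'` (`phase_bounds`).
One outer iteration costs at most `phaseBound`, and at most `log₄ (8 T)` of them occur because `N_ζ
≥ 4 ^ ζ` (`loss_mainRun_le`). The bias `T J ^ (-k)` and the exploration cost `√(J ^ d T)` balance at
`T ^ ((k + d) / (2 k + d))`.

All this is deterministic once every answer is accurate. At most `25 T` queries are made, and each
is inaccurate with probability at most `T ^ (-3)` (`measure_inaccurate_le`), whence the failure
probability `25 T ^ (-2)`.

Constants are settled by counting logarithms. With `σ² = ln (5 ν T)`, `phaseBound` is at most a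
constant times the main power of `T` times `σ ^ 5`, and there are at most `3 σ²` iterations. The
total `σ ^ 7` is one factor `σ` below `ln ^ 4 T`, and for `T ≥ T₀` this spare factor absorbs every
constant (`eventually_longHorizon`). Hence `1` serves as the polynomial; shorter horizons are
covered by taking `A ≥ T₀ ^ 2`. -/

namespace PairwiseBandit

/-! ### Quadratic forms and determinants of positive definite matrices. -/

section LinearAlgebra

variable {ι : Type*} [Fintype ι] [DecidableEq ι]

/-- Cauchy–Schwarz for the norms defined by a positive definite matrix and its inverse. -/
lemma sq_dotProduct_le_of_posDef {A : Matrix ι ι ℝ} (hA : A.PosDef) (u v : ι → ℝ) :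
    (u ⬝ᵥ v) ^ 2 ≤ (u ⬝ᵥ (A *ᵥ u)) * (v ⬝ᵥ (A⁻¹ *ᵥ v)) := by
  have hdet : IsUnit A.det := hA.det_pos.ne'.isUnit
  set p := A⁻¹ *ᵥ v with hp
  have hAp : A *ᵥ p = v := by
    rw [hp, Matrix.mulVec_mulVec, Matrix.mul_nonsing_inv _ hdet, Matrix.one_mulVec]
  have hsymm : p ⬝ᵥ (A *ᵥ u) = u ⬝ᵥ (A *ᵥ p) := by
    have hT : Aᵀ = A := by
      have := hA.isHermitian
      rwa [Matrix.IsHermitian, Matrix.conjTranspose_eq_transpose_of_trivial] at this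
    rw [Matrix.dotProduct_mulVec, ← Matrix.mulVec_transpose, hT, dotProduct_comm]
  -- The form of `A` at `u + t • A⁻¹ v` is nonnegative for all `t`; its discriminant gives the
  -- claim.
  have hnn : ∀ t : ℝ, 0 ≤ (v ⬝ᵥ p) * (t * t) + 2 * (u ⬝ᵥ v) * t + u ⬝ᵥ (A *ᵥ u) := by
    intro t
    have h := hA.posSemidef.dotProduct_mulVec_nonneg (u + t • p)
    simp only [star_trivial, Matrix.mulVec_add, Matrix.mulVec_smul, add_dotProduct,
      dotProduct_add, smul_dotProduct, dotProduct_smul, smul_eq_mul, hsymm, hAp] at h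
    rw [dotProduct_comm p v] at h
    linarith
  have := discrim_le_zero hnn
  unfold discrim at this
  linarith

/-- Rank-one update formula. It translates the doubling rule for the determinant into a bound on the
confidence width. -/
lemma det_add_smul_vecMulVec_self {A : Matrix ι ι ℝ} (hA : IsUnit A.det) (c : ℝ) (v : ι → ℝ) :
    (A + c • Matrix.vecMulVec v v).det = A.det * (1 + c * (v ⬝ᵥ (A⁻¹ *ᵥ v))) := by
  have h := Matrix.det_add_replicateCol_mul_replicateRow (ι := Unit) hA (c • v) v
  have h1 : Matrix.replicateCol Unit (c • v) * Matrix.replicateRow Unit v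
      = c • Matrix.vecMulVec v v := by
    ext i j
    simp [Matrix.mul_apply, Matrix.vecMulVec_apply, mul_assoc]
  rw [h1] at h
  rw [h, Matrix.det_unique (n := Unit), Matrix.add_apply, Matrix.one_apply_eq]
  congr 2
  rw [Matrix.mul_assoc, Matrix.mul_apply]
  simp only [Matrix.replicateRow_apply, dotProduct, Finset.mul_sum]
  refine Finset.sum_congr rfl fun i _ => ?_
  simp only [Matrix.mul_apply, Matrix.replicateCol_apply, Matrix.mulVec, dotProduct,
    Pi.smul_apply, smul_eq_mul, Finset.mul_sum]
  refine Finset.sum_congr rfl fun j _ => ?_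
  ring

/-- Each eigenvalue is at most the sum of all. This is cruder than AM-GM, but only the logarithm of
the bound is used. -/
lemma det_le_trace_pow_card {A : Matrix ι ι ℝ} (hA : A.PosSemidef) :
    A.det ≤ A.trace ^ Fintype.card ι := by
  rw [hA.isHermitian.det_eq_prod_eigenvalues, hA.isHermitian.trace_eq_sum_eigenvalues]
  simp only [RCLike.ofReal_real_eq_id, id_eq]
  calc ∏ i, hA.isHermitian.eigenvalues i
      ≤ ∏ _i : ι, ∑ j, hA.isHermitian.eigenvalues j :=
        Finset.prod_le_prod (fun i _ => hA.eigenvalues_nonneg i) fun i _ =>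
          Finset.single_le_sum (fun j _ => hA.eigenvalues_nonneg j) (Finset.mem_univ i)
    _ = _ := by rw [Finset.prod_const, Finset.card_univ]

/-- If `A ≥ 1` then `A⁻¹ ≤ 1`: with `p = A⁻¹ v`, combine `p·p ≤ p·v` with `|v - p|² ≥ 0`. -/
lemma dotProduct_inv_mulVec_le {A : Matrix ι ι ℝ} (hA : A.PosDef)
    (h1 : ∀ u : ι → ℝ, u ⬝ᵥ u ≤ u ⬝ᵥ (A *ᵥ u)) (v : ι → ℝ) :
    v ⬝ᵥ (A⁻¹ *ᵥ v) ≤ v ⬝ᵥ v := by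
  have hdet : IsUnit A.det := hA.det_pos.ne'.isUnit
  set p := A⁻¹ *ᵥ v with hp
  have hAp : A *ᵥ p = v := by
    rw [hp, Matrix.mulVec_mulVec, Matrix.mul_nonsing_inv _ hdet, Matrix.one_mulVec]
  have h2 := h1 p
  rw [hAp] at h2
  have h3 : 0 ≤ (v - p) ⬝ᵥ (v - p) := Finset.sum_nonneg fun i _ => mul_self_nonneg _
  simp only [sub_dotProduct, dotProduct_sub] at h3
  rw [dotProduct_comm p v] at h2 h3
  linarith

end LinearAlgebra


/-! ### Multi-indices -/

/-- A slack coordinate turns degree less than `k` in `d` variables into degree exactly `k - 1` in `d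
+ 1` variables, which stars and bars counts. -/
lemma card_mIdx_le_nu (k d : ℕ) (hk : 1 ≤ k) : Fintype.card (MIdx k d) ≤ nu k d := by
  classical
  have hcard := Finset.card_finsuppAntidiag_nat_eq_choose
    (s := (Finset.univ : Finset (Option (Fin d)))) (n := k - 1)
  have hnu : nu k d = (Finset.finsuppAntidiag (Finset.univ : Finset (Option (Fin d)))
      (k - 1)).card := by
    rw [hcard, nu, Finset.card_univ, Fintype.card_option, Fintype.card_fin,
      ← Nat.choose_symm (by omega)]
    congr 1 <;> omega
  rw [hnu, ← Finset.card_univ]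
  refine Finset.card_le_card_of_injOn
    (fun α : MIdx k d => Finsupp.equivFunOnFinite.symm
      (fun o : Option (Fin d) => o.elim (k - 1 - ∑ i, (α.1 i : ℕ)) fun i => (α.1 i : ℕ))) ?_ ?_
  · intro α _
    have := α.2
    simp only [Finset.mem_coe,
      Finset.mem_finsuppAntidiag, Finset.subset_univ, and_true]
    simp only [Finsupp.equivFunOnFinite_symm_apply_apply, Fintype.sum_option, Option.elim]
    omega
  · intro α _ β _ h
    have h' := Finsupp.equivFunOnFinite.symm.injective h
    ext i
    simpa using congrFun h' (some i)

/-- The number of occurrences of every value of `i`. -/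
def occurrences {d m : ℕ} (i : Fin m → Fin d) (a : Fin d) : ℕ :=
  (Finset.univ.filter fun l => i l = a).card

lemma sum_occurrences {d m : ℕ} (i : Fin m → Fin d) : ∑ a, occurrences i a = m := by
  have := Finset.card_eq_sum_card_fiberwise (f := i) (s := Finset.univ) (t := Finset.univ)
    (fun _ _ => by simp)
  simpa [occurrences] using this.symm

lemma prod_comp_eq_prod_pow_occurrences {d m : ℕ} (i : Fin m → Fin d) (h : Fin d → ℝ) :
    ∏ l, h (i l) = ∏ a, h a ^ occurrences i a := by
  rw [← Finset.prod_fiberwise_of_maps_to (g := i) (t := Finset.univ) (fun _ _ => by simp)]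
  refine Finset.prod_congr rfl fun a _ => ?_
  rw [occurrences, ← Finset.prod_const]
  refine Finset.prod_congr rfl fun l hl => ?_
  rw [(Finset.mem_filter.1 hl).2]

lemma exists_perm_of_occurrences_eq {d m : ℕ} (i j : Fin m → Fin d)
    (h : occurrences i = occurrences j) : ∃ σ : Equiv.Perm (Fin m), j ∘ σ = i := by
  have hc : ∀ a, Fintype.card {l // i l = a} = Fintype.card {l // j l = a} := fun a => by
    rw [Fintype.card_subtype, Fintype.card_subtype]
    exact congrFun h a
  let e : ∀ a, {l // i l = a} ≃ {l // j l = a} := fun a => Fintype.equivOfCardEq (hc a)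
  refine ⟨(Equiv.sigmaFiberEquiv i).symm.trans
    ((Equiv.sigmaCongrRight e).trans (Equiv.sigmaFiberEquiv j)), ?_⟩
  funext l
  exact (e (i l) ⟨l, rfl⟩).2

/-- Words with the same letter counts form one orbit of the permutations of positions. This bound
cancels the factorial in the Taylor coefficients. -/
lemma card_occurrences_eq_le_factorial {d m : ℕ} (α : Fin d → ℕ) :
    (Finset.univ.filter fun i : Fin m → Fin d => occurrences i = α).card ≤ m.factorial := by
  classical
  rcases Finset.eq_empty_or_nonempty
    (Finset.univ.filter fun i : Fin m → Fin d => occurrences i = α) with h | ⟨j, hj⟩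
  · simp [h]
  · have hj' := (Finset.mem_filter.1 hj).2
    calc _ ≤ (Finset.univ.image fun σ : Equiv.Perm (Fin m) => j ∘ σ).card := by
          refine Finset.card_le_card fun i hi => ?_
          obtain ⟨σ, hσ⟩ := exists_perm_of_occurrences_eq i j
            ((Finset.mem_filter.1 hi).2.trans hj'.symm)
          exact Finset.mem_image.2 ⟨σ, Finset.mem_univ _, hσ⟩
      _ ≤ _ := Finset.card_image_le.trans (by simp [Fintype.card_perm])

/-! ### Taylor expansion -/

section Taylor

variable {d : ℕ} {X : Set (Pt d)} {k : ℕ} {M : ℝ} {f : Pt d → ℝ}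

/-- The iterated derivative within `X` in direction `h`. -/
noncomputable def dirDeriv (f : Pt d → ℝ) (X : Set (Pt d)) (m : ℕ) (x h : Pt d) : ℝ :=
  iteratedFDerivWithin ℝ m f X x fun _ => h

lemma dirDeriv_eq_sum (m : ℕ) (x h : Pt d) :
    dirDeriv f X m x h = ∑ i : Fin m → Fin d, (∏ l, h (i l)) *
      iteratedFDerivWithin ℝ m f X x fun l => Pi.single (i l) (1 : ℝ) := by
  have hh : h = ∑ a, h a • (Pi.single a (1 : ℝ) : Pt d) := by
    simpa using pi_eq_sum_univ' h
  have := (iteratedFDerivWithin ℝ m f X x).toMultilinearMap.map_sum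
    (fun (_ : Fin m) (a : Fin d) => h a • (Pi.single a (1 : ℝ) : Pt d))
  simp only [ContinuousMultilinearMap.coe_coe, ← hh] at this
  rw [dirDeriv, this]
  refine Finset.sum_congr rfl fun i _ => ?_
  rw [ContinuousMultilinearMap.map_smul_univ, smul_eq_mul]

lemma abs_dirDeriv_le (hf : Holder X k M f) {m : ℕ} (hm : m ≤ k) {x : Pt d} (hx : x ∈ X)
    {h : Pt d} {r : ℝ} (hr : ∀ a, |h a| ≤ r) : |dirDeriv f X m x h| ≤ (d : ℝ) ^ m * (r ^ m * M) := by
  rw [dirDeriv_eq_sum]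
  refine (Finset.abs_sum_le_sum_abs _ _).trans ?_
  calc _ ≤ ∑ _i : Fin m → Fin d, r ^ m * M := by
        refine Finset.sum_le_sum fun i _ => ?_
        rw [abs_mul, Finset.abs_prod]
        have h1 : ∏ l, |h (i l)| ≤ r ^ m := by
          calc ∏ l, |h (i l)| ≤ ∏ _l : Fin m, r :=
                Finset.prod_le_prod (fun _ _ => abs_nonneg _) fun _ _ => hr _
            _ = r ^ m := by simp
        exact mul_le_mul h1 (hf.2 m hm i x hx) (abs_nonneg _)
          ((Finset.prod_nonneg fun _ _ => abs_nonneg _).trans h1)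
    _ = _ := by simp

/-- The chain rule, iterated along a segment, reduces the expansion in several variables to Taylor's
theorem on `[0, 1]`. -/
lemma iteratedDerivWithin_comp_line (hX : Convex ℝ X) (hU : UniqueDiffOn ℝ X)
    (hf : ContDiffOn ℝ k f X) {c x : Pt d} (hc : c ∈ X) (hx : x ∈ X) :
    ∀ m ≤ k, ∀ t ∈ Set.Icc (0 : ℝ) 1,
      iteratedDerivWithin m (fun t : ℝ => f (c + t • (x - c))) (Set.Icc 0 1) t
        = dirDeriv f X m (c + t • (x - c)) (x - c) := by
  have hline : Set.MapsTo (fun t : ℝ => c + t • (x - c)) (Set.Icc 0 1) X :=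
    fun t ht => hX.add_smul_sub_mem hc hx ht
  intro m
  induction m with
  | zero => intro _ t _; simp [dirDeriv]
  | succ m ih =>
    intro hm t ht
    have hud : UniqueDiffWithinAt ℝ (Set.Icc (0 : ℝ) 1) t := uniqueDiffOn_Icc zero_lt_one t ht
    rw [iteratedDerivWithin_succ]
    rw [derivWithin_congr (ih (by omega)) (ih (by omega) t ht)]
    refine HasDerivWithinAt.derivWithin ?_ hud
    have hd : DifferentiableWithinAt ℝ (iteratedFDerivWithin ℝ m f X) X (c + t • (x - c)) :=
      hf.differentiableOn_iteratedFDerivWithin (by exact_mod_cast hm) hU _ (hline ht)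
    have hl : HasDerivWithinAt (fun t : ℝ => c + t • (x - c)) (x - c) (Set.Icc 0 1) t := by
      simpa using (((hasDerivAt_id t).smul_const (x - c)).const_add c).hasDerivWithinAt
    have h1 := hd.hasFDerivWithinAt.comp_hasDerivWithinAt t hl hline
    have h2 := (ContinuousMultilinearMap.apply ℝ (fun _ : Fin m => Pt d) ℝ
      (fun _ => x - c)).hasFDerivAt.comp_hasDerivWithinAt t h1
    rw [dirDeriv, iteratedFDerivWithin_succ_apply_left]
    exact h2

lemma contDiffOn_comp_line (hX : Convex ℝ X) (hf : ContDiffOn ℝ k f X) {c x : Pt d}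
    (hc : c ∈ X) (hx : x ∈ X) :
    ContDiffOn ℝ k (fun t : ℝ => f (c + t • (x - c))) (Set.Icc 0 1) :=
  hf.comp (by fun_prop) fun t ht => hX.add_smul_sub_mem hc hx ht

/-- The Taylor polynomial in the monomial basis: its coefficients are bounded by `M`. -/
lemma exists_taylor_coeff (hk : 1 ≤ k) (hX : Convex ℝ X) (hU : UniqueDiffOn ℝ X)
    (hM : 0 ≤ M) (hf : Holder X k M f) {c : Pt d} (hc : c ∈ X) :
    ∃ θ : MIdx k d → ℝ, (∀ α, |θ α| ≤ M) ∧ ∀ x ∈ X, ∀ r : ℝ, 0 ≤ r → (∀ a, |x a - c a| ≤ r) →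
      |f x - ∑ α, θ α * ∏ a, (x a - c a) ^ (α.1 a : ℕ)| ≤ (d : ℝ) ^ k * (r ^ k * M) := by
  classical
  let D : ∀ m, (Fin m → Fin d) → ℝ := fun m i =>
    iteratedFDerivWithin ℝ m f X c fun l => Pi.single (i l) (1 : ℝ)
  let deg : MIdx k d → ℕ := fun α => ∑ a, (α.1 a : ℕ)
  -- The coefficient of a monomial collects all orders of differentiation with the same multi-index.
  -- There are at most `(deg α)!` of them, each partial derivative being at most `M` in absolute
  -- value.
  refine ⟨fun α => ((deg α).factorial : ℝ)⁻¹ *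
    ∑ i ∈ Finset.univ.filter fun i : Fin (deg α) → Fin d =>
      occurrences i = fun a => (α.1 a : ℕ), D (deg α) i, ?_, ?_⟩
  · intro α
    rw [abs_mul, abs_of_nonneg (by positivity)]
    rw [inv_mul_le_iff₀ (by positivity)]
    refine (Finset.abs_sum_le_sum_abs _ _).trans ?_
    refine (Finset.sum_le_card_nsmul _ _ M fun i _ => hf.2 _ α.2.le i c hc).trans ?_
    rw [nsmul_eq_mul]
    gcongr
    exact card_occurrences_eq_le_factorial _
  · intro x hx r hr0 hr
    obtain ⟨n, rfl⟩ : ∃ n, k = n + 1 := ⟨k - 1, by omega⟩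
    have hline := iteratedDerivWithin_comp_line hX hU hf.1 hc hx
    -- The remainder of order `k = n + 1` at `t = 1`; the factor `1 / n!` it carries is dropped at
    -- the end.
    have hT := taylor_mean_remainder_bound (f := fun t : ℝ => f (c + t • (x - c))) (n := n)
      (C := (d : ℝ) ^ (n + 1) * (r ^ (n + 1) * M)) (zero_le_one)
      (by exact_mod_cast contDiffOn_comp_line hX hf.1 hc hx) (x := 1) (by simp)
      (fun t ht => by
        rw [hline _ le_rfl t ht, Real.norm_eq_abs]
        exact abs_dirDeriv_le hf le_rfl (hX.add_smul_sub_mem hc hx ht) hr)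
    rw [taylor_within_apply] at hT
    simp only [one_smul, add_sub_cancel, sub_zero, one_pow, mul_one, Real.norm_eq_abs,
      smul_eq_mul] at hT
    have hsum : ∑ m ∈ Finset.range (n + 1), ((m.factorial : ℝ)⁻¹) *
        iteratedDerivWithin m (fun t : ℝ => f (c + t • (x - c))) (Set.Icc 0 1) 0
        = ∑ α : MIdx (n + 1) d, (((deg α).factorial : ℝ)⁻¹ *
          ∑ i ∈ Finset.univ.filter fun i : Fin (deg α) → Fin d =>
            occurrences i = fun a => (α.1 a : ℕ), D (deg α) i)
              * ∏ a, (x a - c a) ^ (α.1 a : ℕ) := by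
      rw [← Finset.sum_fiberwise_of_maps_to (s := Finset.univ) (t := Finset.range (n + 1))
        (g := deg) (fun α _ => Finset.mem_range.2 α.2)]
      refine Finset.sum_congr rfl fun m hm => ?_
      have hm' : m < n + 1 := Finset.mem_range.1 hm
      rw [hline m hm'.le 0 (by simp), zero_smul, add_zero, dirDeriv_eq_sum]
      have hg : ∀ α ∈ Finset.univ.filter (fun α : MIdx (n + 1) d => deg α = m),
          (((deg α).factorial : ℝ)⁻¹ *
          ∑ i ∈ Finset.univ.filter fun i : Fin (deg α) → Fin d =>
            occurrences i = fun a => (α.1 a : ℕ), D (deg α) i)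
              * ∏ a, (x a - c a) ^ (α.1 a : ℕ)
          = (m.factorial : ℝ)⁻¹ * ∑ i ∈ Finset.univ.filter fun i : Fin m → Fin d =>
            occurrences i = fun a => (α.1 a : ℕ), (∏ l, (x - c) (i l)) * D m i := by
        intro α hα
        have hα' := (Finset.mem_filter.1 hα).2
        subst hα'
        rw [mul_assoc, Finset.sum_mul]
        congr 1
        refine Finset.sum_congr rfl fun i hi => ?_
        rw [prod_comp_eq_prod_pow_occurrences, (Finset.mem_filter.1 hi).2, mul_comm]
        rfl
      rw [Finset.sum_congr rfl hg, ← Finset.mul_sum]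
      congr 1
      have hocc : ∀ (i : Fin m → Fin d) a, occurrences i a < n + 1 := fun i a =>
        ((Finset.single_le_sum (fun _ _ => Nat.zero_le _) (Finset.mem_univ a)).trans
          (sum_occurrences i).le).trans_lt hm'
      let idx : (Fin m → Fin d) → MIdx (n + 1) d := fun i =>
        ⟨fun a => ⟨occurrences i a, hocc i a⟩, by
          show ∑ a, occurrences i a < n + 1
          rw [sum_occurrences]; exact hm'⟩
      rw [← Finset.sum_fiberwise_of_maps_to (s := Finset.univ)
        (t := Finset.univ.filter (fun α : MIdx (n + 1) d => deg α = m)) (g := idx)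
        (fun i _ => Finset.mem_filter.2 ⟨Finset.mem_univ _, sum_occurrences i⟩)]
      refine Finset.sum_congr rfl fun α _ => ?_
      refine Finset.sum_congr ?_ fun i _ => rfl
      ext i
      simp only [Finset.mem_filter, Finset.mem_univ, true_and]
      constructor
      · rintro rfl; rfl
      · intro h
        ext a
        exact congrFun h a
    rw [hsum] at hT
    refine hT.trans (div_le_self ?_ ?_)
    · positivity
    · exact_mod_cast Nat.one_le_iff_ne_zero.2 (Nat.factorial_ne_zero n)

end Taylor

/-! ### The linear model on a cell and its Gram matrix. -/

namespace Params

variable {d : ℕ} (P : Params d)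

/-- On the cell `j` the function `f` is, up to `C₂`, a polynomial with coefficients bounded by `M`,
its oscillation is at most `M`, and the differences of the features are at most `1`. -/
structure IsLinearizable (f : Pt d → ℝ) (j : P.Cell) : Prop where
  exists_coeff : ∃ θ : MIdx P.k d → ℝ, (∀ α, |θ α| ≤ P.M) ∧
    ∀ x ∈ P.cell j, |f x - θ ⬝ᵥ P.feature j x| ≤ P.C₂
  sub_le : ∀ x ∈ P.cell j, ∀ z ∈ P.cell j, f z - f x ≤ P.M
  abs_featDiff_le : ∀ x ∈ P.cell j, ∀ z ∈ P.cell j, ∀ α, |P.featDiff j x z α| ≤ 1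

/-- The answer of the step `s` is accurate. -/
def Accurate (f : Pt d → ℝ) (s : Step d) : Prop :=
  |s.y - (f s.x' - f s.x)| ≤ √(2 * P.C₁ / s.n)

section Gram

variable (j : P.Cell) (xs : Pt d)

lemma gram_nil : P.gram j xs [] = 1 := by simp [gram]

lemma gram_append_singleton (B : List (Step d)) (s : Step d) :
    P.gram j xs (B ++ [s]) = P.gram j xs B + (s.n : ℝ) •
      Matrix.vecMulVec (P.featDiff j xs s.x') (P.featDiff j xs s.x') := by
  simp [gram, add_assoc]

lemma time_append (L L' : List (Step d)) : time (L ++ L') = time L + time L' := by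
  simp [time]

lemma time_cons (s : Step d) (L : List (Step d)) : time (s :: L) = s.n + time L := by
  simp [time]

lemma dotProduct_gram_mulVec (B : List (Step d)) (u : MIdx P.k d → ℝ) :
    u ⬝ᵥ (P.gram j xs B *ᵥ u)
      = (B.map fun s => (s.n : ℝ) * (u ⬝ᵥ P.featDiff j xs s.x') ^ 2).sum + u ⬝ᵥ u := by
  induction B using List.reverseRecOn with
  | nil => simp [gram_nil]
  | append_singleton B s ih =>
    rw [gram_append_singleton, Matrix.add_mulVec, dotProduct_add, ih, Matrix.smul_mulVec,
      Matrix.vecMulVec_mulVec, dotProduct_smul, dotProduct_smul]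
    simp only [List.map_append, List.sum_append, List.map_cons, List.map_nil, List.sum_cons,
      List.sum_nil, smul_eq_mul, MulOpposite.smul_eq_mul_unop, MulOpposite.unop_op]
    rw [dotProduct_comm (P.featDiff j xs s.x') u]
    ring

lemma dotProduct_self_le_gram (B : List (Step d)) (u : MIdx P.k d → ℝ) :
    u ⬝ᵥ u ≤ u ⬝ᵥ (P.gram j xs B *ᵥ u) := by
  rw [dotProduct_gram_mulVec]
  have : 0 ≤ (B.map fun s => (s.n : ℝ) * (u ⬝ᵥ P.featDiff j xs s.x') ^ 2).sum :=
    List.sum_nonneg (by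
      intro a ha
      obtain ⟨s, -, rfl⟩ := List.mem_map.1 ha
      positivity)
  linarith

lemma posDef_gram (B : List (Step d)) : (P.gram j xs B).PosDef := by
  induction B using List.reverseRecOn with
  | nil => rw [gram_nil]; exact Matrix.PosDef.one
  | append_singleton B s ih =>
    rw [gram_append_singleton]
    refine ih.add_posSemidef (Matrix.PosSemidef.smul ?_ (Nat.cast_nonneg _))
    simpa using Matrix.posSemidef_vecMulVec_self_star (P.featDiff j xs s.x')

end Gram

/-! ### Number of steps of a batch, and the least squares estimate. -/

section Batch

variable {P} {f : Pt d → ℝ} {j : P.Cell} {xs : Pt d}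

lemma featDiff_dotProduct_self_le (hk : 1 ≤ P.k) (hj : P.IsLinearizable f j)
    (hxs : xs ∈ P.cell j) {z : Pt d} (hz : z ∈ P.cell j) :
    P.featDiff j xs z ⬝ᵥ P.featDiff j xs z ≤ P.ν := by
  calc P.featDiff j xs z ⬝ᵥ P.featDiff j xs z
      ≤ ∑ _α : MIdx P.k d, (1 : ℝ) := Finset.sum_le_sum fun α _ => by
        have := (sq_le_one_iff_abs_le_one _).2 (hj.abs_featDiff_le xs hxs z hz α)
        rwa [sq] at this
    _ ≤ P.ν := by
        simpa [ν] using (Nat.cast_le (α := ℝ)).2 (card_mIdx_le_nu P.k d hk)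

lemma trace_gram_le (hk : 1 ≤ P.k) (hj : P.IsLinearizable f j) (hxs : xs ∈ P.cell j)
    (B : List (Step d)) (hB : ∀ s ∈ B, s.x' ∈ P.cell j) :
    (P.gram j xs B).trace ≤ P.ν * (1 + time B) := by
  induction B using List.reverseRecOn with
  | nil =>
    simpa [gram_nil, ν, time] using (Nat.cast_le (α := ℝ)).2 (card_mIdx_le_nu P.k d hk)
  | append_singleton B s ih =>
    rw [gram_append_singleton, Matrix.trace_add, Matrix.trace_smul, Matrix.trace_vecMulVec,
      time_append]
    have h1 := ih fun s' hs' => hB s' (by simp [hs'])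
    have h2 := mul_le_mul_of_nonneg_left
      (featDiff_dotProduct_self_le hk hj hxs (hB s (by simp))) (Nat.cast_nonneg (α := ℝ) s.n)
    simp only [time, List.map_cons, List.map_nil, List.sum_cons, List.sum_nil, smul_eq_mul] at *
    push_cast at *
    linarith

lemma one_le_nu_real (hk : 1 ≤ P.k) : 1 ≤ P.ν := by
  have : 0 < nu P.k d := Nat.choose_pos (by omega)
  unfold ν
  exact_mod_cast this

lemma four_le_two_mul_mul_nu (hk : 1 ≤ P.k) {N : ℕ} (hN : 2 ≤ N) : (4 : ℝ) ≤ 2 * N * P.ν := by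
  have h1 := one_le_nu_real hk
  have h2 : (2 : ℝ) ≤ N := by exact_mod_cast hN
  nlinarith

lemma two_le_tauInf (hk : 1 ≤ P.k) {N : ℕ} (hN : 2 ≤ N) : 2 ≤ P.tauInf N := by
  have h1 := one_le_nu_real hk
  have h4 := four_le_two_mul_mul_nu hk hN
  have h2 : (2 : ℝ) ≤ Real.logb 2 (2 * N * P.ν) := by
    rw [Real.le_logb_iff_rpow_le (by norm_num) (by linarith)]
    norm_num
    linarith
  unfold tauInf
  nlinarith

/-- Every step that does not end the batch doubles the determinant. -/
lemma two_pow_length_le_det (N : ℕ) (B : List (Step d))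
    (hB : ∀ B₁ s R, B = B₁ ++ s :: R → P.IsBatchStep j xs N B₁ s) (ht : time B < N) :
    (2 : ℝ) ^ B.length ≤ (P.gram j xs B).det := by
  induction B using List.reverseRecOn with
  | nil => simp [gram_nil]
  | append_singleton B s ih =>
    have hs := hB B s [] rfl
    have h1 := ih (fun B₁ s' R h => hB B₁ s' (R ++ [s]) (by simp [h]))
      (by simp only [time_append] at ht; omega)
    rcases hs.2.2.2.2.2.2 with h | h
    · rw [gram_append_singleton, List.length_append, List.length_singleton, pow_succ]
      linarith
    · simp [time] at ht h
      omega

/-- The determinant doubles at each step but is at most `trace ^ ν ≤ (2 N ν) ^ ν`, the features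
being bounded; take `log₂`. -/
lemma length_le_tauInf (hk : 1 ≤ P.k) (hj : P.IsLinearizable f j) (hxs : xs ∈ P.cell j)
    {N : ℕ} (hN : 2 ≤ N) (B : List (Step d))
    (hB : ∀ B₁ s R, B = B₁ ++ s :: R → P.IsBatchStep j xs N B₁ s) (ht : time B < N) :
    (B.length : ℝ) ≤ P.tauInf N := by
  have hν := one_le_nu_real hk
  have hN' : (2 : ℝ) ≤ N := by exact_mod_cast hN
  have h4 := four_le_two_mul_mul_nu hk hN
  have hmem : ∀ s ∈ B, s.x' ∈ P.cell j := by
    intro s hs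
    obtain ⟨B₁, R, h⟩ := List.append_of_mem hs
    exact (hB B₁ s R h).2.1
  have h1 := two_pow_length_le_det N B hB ht
  have h2 := det_le_trace_pow_card (P.posDef_gram j xs B).posSemidef
  have h3 := trace_gram_le hk hj hxs B hmem
  have htB : (time B : ℝ) + 1 ≤ N := by exact_mod_cast ht
  have h5 : (P.gram j xs B).trace ≤ 2 * N * P.ν := by nlinarith
  have h0 : 0 ≤ (P.gram j xs B).trace := (P.posDef_gram j xs B).posSemidef.trace_nonneg
  have h6 : (2 : ℝ) ^ B.length ≤ (2 * N * P.ν) ^ (nu P.k d) :=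
    calc (2 : ℝ) ^ B.length ≤ (P.gram j xs B).trace ^ Fintype.card (MIdx P.k d) := h1.trans h2
      _ ≤ (2 * N * P.ν) ^ Fintype.card (MIdx P.k d) := pow_le_pow_left₀ h0 h5 _
      _ ≤ _ := pow_le_pow_right₀ (by linarith) (card_mIdx_le_nu P.k d hk)
  have h7 := Real.logb_le_logb_of_le (b := 2) (by norm_num) (by positivity) h6
  rw [Real.logb_pow, Real.logb_pow, Real.logb_self_eq_one (by norm_num), mul_one] at h7
  exact h7

/-- Along a line the objective is quadratic, with the Gram matrix as second-order part. -/
lemma ridgeLoss_add_smul (B : List (Step d)) (θ Δ : MIdx P.k d → ℝ) (c : ℝ) :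
    P.ridgeLoss j xs B (θ + c • Δ)
      = P.ridgeLoss j xs B θ + c * 2 * ((θ ⬝ᵥ Δ) - (B.map fun s => (s.n : ℝ) *
        (s.y - θ ⬝ᵥ P.featDiff j xs s.x') * (Δ ⬝ᵥ P.featDiff j xs s.x')).sum)
        + c ^ 2 * (Δ ⬝ᵥ (P.gram j xs B *ᵥ Δ)) := by
  rw [dotProduct_gram_mulVec]
  unfold ridgeLoss
  simp only [add_dotProduct, dotProduct_add, smul_dotProduct, dotProduct_smul, smul_eq_mul]
  rw [dotProduct_comm Δ θ]
  induction B with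
  | nil => simp; ring
  | cons s B ih =>
    simp only [List.map_cons, List.sum_cons]
    linear_combination ih

lemma sqrt_dotProduct_add_smul_le {ι : Type*} [Fintype ι] {θ θh : ι → ℝ} {R : ℝ}
    (hθ : √(θ ⬝ᵥ θ) ≤ R) (hh : √(θh ⬝ᵥ θh) ≤ R) {c : ℝ} (hc : 0 ≤ c) (hc1 : c ≤ 1) :
    √((θ + c • (θh - θ)) ⬝ᵥ (θ + c • (θh - θ))) ≤ R := by
  have hR : 0 ≤ R := (Real.sqrt_nonneg _).trans hθ
  rw [Real.sqrt_le_left hR] at *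
  have h : 0 ≤ (θh - θ) ⬝ᵥ (θh - θ) := Finset.sum_nonneg fun i _ => mul_self_nonneg _
  simp only [add_dotProduct, dotProduct_add, smul_dotProduct, dotProduct_smul, smul_eq_mul,
    sub_dotProduct, dotProduct_sub] at *
  rw [dotProduct_comm θh θ] at *
  nlinarith [mul_nonneg (mul_nonneg hc (sub_nonneg.2 hc1)) h,
    mul_le_mul_of_nonneg_left hh hc, mul_le_mul_of_nonneg_left hθ (sub_nonneg.2 hc1)]

/-- The estimate is close to `θ` in the norm defined by `Λ`. -/
lemma estimate_error_le {B : List (Step d)} {θ θh : MIdx P.k d → ℝ}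
    (hθ : √(θ ⬝ᵥ θ) ≤ P.M * √P.ν) (hh : P.IsEstimate j xs B θh) :
    (θh - θ) ⬝ᵥ (P.gram j xs B *ᵥ (θh - θ))
      ≤ (B.map fun s => (s.n : ℝ) * (s.y - θ ⬝ᵥ P.featDiff j xs s.x') ^ 2).sum + θ ⬝ᵥ θ := by
  -- The constraint set is convex, so the minimizer `θh` can be compared with the whole segment from
  -- `θ`. This yields a first-order inequality at its end `c = 1`, although `θh` may lie on the
  -- boundary of the ball.
  have hmin : ∀ c : ℝ, 0 ≤ c → c ≤ 1 →
      P.ridgeLoss j xs B (θ + (1 : ℝ) • (θh - θ)) ≤ P.ridgeLoss j xs B (θ + c • (θh - θ)) := by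
    intro c hc hc1
    rw [one_smul, add_sub_cancel]
    exact hh.2 _ (sqrt_dotProduct_add_smul_le hθ hh.1 hc hc1)
  simp only [ridgeLoss_add_smul] at hmin
  set Δ := θh - θ with hΔ
  set G := (θ ⬝ᵥ Δ) - (B.map fun s => (s.n : ℝ) *
    (s.y - θ ⬝ᵥ P.featDiff j xs s.x') * (Δ ⬝ᵥ P.featDiff j xs s.x')).sum with hG
  -- `-G` pairs residuals with predictions and `-θ` with `Δ`; AM-GM leaves half of the Gram form of
  -- `Δ`, which is moved to the left at the end.
  have hAMGM : -G ≤ ((B.map fun s => (s.n : ℝ) * (s.y - θ ⬝ᵥ P.featDiff j xs s.x') ^ 2).sum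
      + θ ⬝ᵥ θ + Δ ⬝ᵥ (P.gram j xs B *ᵥ Δ)) / 2 := by
    have h1 : 0 ≤ (θ + Δ) ⬝ᵥ (θ + Δ) := Finset.sum_nonneg fun i _ => mul_self_nonneg _
    simp only [add_dotProduct, dotProduct_add] at h1
    rw [dotProduct_comm Δ θ] at h1
    rw [hG, dotProduct_gram_mulVec]
    have h2 : (B.map fun s => (s.n : ℝ) *
        (s.y - θ ⬝ᵥ P.featDiff j xs s.x') * (Δ ⬝ᵥ P.featDiff j xs s.x')).sum
        ≤ ((B.map fun s => (s.n : ℝ) * (s.y - θ ⬝ᵥ P.featDiff j xs s.x') ^ 2).sum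
          + (B.map fun s => (s.n : ℝ) * (Δ ⬝ᵥ P.featDiff j xs s.x') ^ 2).sum) / 2 := by
      generalize B = B
      induction B with
      | nil => simp
      | cons s B ih =>
        simp only [List.map_cons, List.sum_cons]
        nlinarith [mul_nonneg (Nat.cast_nonneg (α := ℝ) s.n)
          (sq_nonneg ((s.y - θ ⬝ᵥ P.featDiff j xs s.x') - (Δ ⬝ᵥ P.featDiff j xs s.x')))]
    linarith
  set Q := Δ ⬝ᵥ (P.gram j xs B *ᵥ Δ) with hQ
  have hQ0 : 0 ≤ Q := (Finset.sum_nonneg fun i _ => mul_self_nonneg _ : 0 ≤ Δ ⬝ᵥ Δ).trans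
    (P.dotProduct_self_le_gram j xs B Δ)
  -- Up to a constant the objective is `2 c G + c² Q`, so its derivative at `c = 1` must be
  -- nonpositive. Otherwise a small step back to `1 - t` improves it; the cap `(Q + G) / (Q + 1)`
  -- makes the quadratic correction harmless.
  have hvar : Q ≤ -G := by
    by_contra hlt
    push Not at hlt
    have hpos : 0 < Q + G := by linarith
    set t := min 1 ((Q + G) / (Q + 1)) with ht
    have ht0 : 0 < t := lt_min one_pos (by positivity)
    have ht1 : t ≤ 1 := min_le_left _ _
    have ht2 : t * (Q + 1) ≤ Q + G := by
      rw [← le_div_iff₀ (by positivity)]; exact min_le_right _ _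
    have h := hmin (1 - t) (by linarith) (by linarith)
    have h3 : t * ((2 - t) * Q + 2 * G) ≤ 0 := by nlinarith
    have h4 : (2 - t) * Q + 2 * G ≤ 0 := nonpos_of_mul_nonpos_right h3 ht0
    nlinarith
  linarith

end Batch

end Params
-- Confidence widths and the error of a batch.
namespace Params

variable {d : ℕ} {P : Params d} {f : Pt d → ℝ} {j : P.Cell} {xs : Pt d}

lemma abs_sub_dotProduct_featDiff_le {θ : MIdx P.k d → ℝ}
    (hθ : ∀ x ∈ P.cell j, |f x - θ ⬝ᵥ P.feature j x| ≤ P.C₂) (hxs : xs ∈ P.cell j) {z : Pt d}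
    (hz : z ∈ P.cell j) : |f z - f xs - θ ⬝ᵥ P.featDiff j xs z| ≤ 2 * P.C₂ := by
  have h1 := abs_le.1 (hθ z hz)
  have h2 := abs_le.1 (hθ xs hxs)
  rw [featDiff, dotProduct_sub, abs_le]
  constructor <;> linarith

/-- Noise of variance proxy `2 C₁ / n` with weight `n` costs `4 C₁` per step, however long; the bias
`2 C₂` costs `8 C₂²` per period. -/
lemma sum_sq_residual_le (hC₁ : 0 ≤ P.C₁) {θ : MIdx P.k d → ℝ}
    (hθ : ∀ x ∈ P.cell j, |f x - θ ⬝ᵥ P.feature j x| ≤ P.C₂) (hxs : xs ∈ P.cell j)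
    (B : List (Step d)) (hB : ∀ s ∈ B, P.Accurate f s ∧ s.x = xs ∧ s.x' ∈ P.cell j ∧ 0 < s.n) :
    (B.map fun s => (s.n : ℝ) * (s.y - θ ⬝ᵥ P.featDiff j xs s.x') ^ 2).sum
      ≤ 4 * P.C₁ * B.length + 8 * P.C₂ ^ 2 * time B := by
  induction B with
  | nil => simp [time]
  | cons s B ih =>
    have h1 := ih fun s' hs' => hB s' (by simp [hs'])
    obtain ⟨hacc, hx, hx', hn⟩ := hB s (by simp)
    have hn' : (0 : ℝ) < s.n := by exact_mod_cast hn
    have h2 := abs_sub_dotProduct_featDiff_le hθ hxs hx'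
    rw [Accurate, hx] at hacc
    have hr : √(2 * P.C₁ / s.n) ^ 2 = 2 * P.C₁ / s.n := Real.sq_sqrt (by positivity)
    have h3 : |s.y - θ ⬝ᵥ P.featDiff j xs s.x'| ≤ √(2 * P.C₁ / s.n) + 2 * P.C₂ := by
      have : s.y - θ ⬝ᵥ P.featDiff j xs s.x' = (s.y - (f s.x' - f xs))
        + (f s.x' - f xs - θ ⬝ᵥ P.featDiff j xs s.x') := by ring
      rw [this]
      exact (abs_add_le _ _).trans (add_le_add hacc h2)
    have h4 : (s.y - θ ⬝ᵥ P.featDiff j xs s.x') ^ 2 ≤ 2 * (2 * P.C₁ / s.n) + 8 * P.C₂ ^ 2 := by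
      rw [← sq_abs, ← hr]
      refine (pow_le_pow_left₀ (abs_nonneg _) h3 2).trans ?_
      nlinarith [sq_nonneg (√(2 * P.C₁ / s.n) - 2 * P.C₂)]
    have h5 : (s.n : ℝ) * (s.y - θ ⬝ᵥ P.featDiff j xs s.x') ^ 2
        ≤ 4 * P.C₁ + 8 * P.C₂ ^ 2 * s.n := by
      refine (mul_le_mul_of_nonneg_left h4 hn'.le).trans (le_of_eq ?_)
      field_simp
      ring
    simp only [List.map_cons, List.sum_cons, List.length_cons, time_cons]
    push_cast
    linarith

/-- The square of a sum of nonnegative terms dominates the sum of their squares; `tauInf ≥ 2` turns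
`4 C₂² tauInf N` into the needed `8 C₂² N`. -/
lemma sq_le_C₁'_sq (hM : 0 ≤ P.M) (hC₁ : 0 ≤ P.C₁) (hC₂ : 0 ≤ P.C₂) (hk : 1 ≤ P.k) {N : ℕ}
    (hN : 2 ≤ N) :
    P.M ^ 2 * P.ν + 4 * P.C₁ * P.tauInf N + 8 * P.C₂ ^ 2 * N ≤ P.C₁' N ^ 2 := by
  have hν := one_le_nu_real hk
  have hτ := two_le_tauInf hk hN
  set a := P.M * √P.ν with ha
  set b := P.C₂ * √(P.tauInf N * N) with hb
  set c := √(P.C₁ * P.tauInf N) with hc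
  have ha0 : 0 ≤ a := by positivity
  have hb0 : 0 ≤ b := by positivity
  have hc0 : 0 ≤ c := by positivity
  have ha2 : a ^ 2 = P.M ^ 2 * P.ν := by rw [ha, mul_pow, Real.sq_sqrt (by linarith)]
  have hb2 : b ^ 2 = P.C₂ ^ 2 * (P.tauInf N * N) := by
    rw [hb, mul_pow, Real.sq_sqrt (by positivity)]
  have hc2 : c ^ 2 = P.C₁ * P.tauInf N := Real.sq_sqrt (by positivity)
  have hE : P.C₁' N = 2 * a + 2 * b + 2 * c := by rw [C₁']; ring
  have h2 : 2 * (P.C₂ ^ 2 * N) ≤ b ^ 2 := by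
    rw [hb2]
    nlinarith [mul_nonneg (sq_nonneg P.C₂) (Nat.cast_nonneg (α := ℝ) N)]
  rw [hE]
  nlinarith [mul_nonneg ha0 hb0, mul_nonneg ha0 hc0, mul_nonneg hb0 hc0, sq_nonneg a]

lemma C₁'_nonneg (hM : 0 ≤ P.M) (hC₂ : 0 ≤ P.C₂) (N : ℕ) : 0 ≤ P.C₁' N := by
  unfold C₁'; positivity

/-- The estimation error in direction `v` is at most the width of the confidence bound. -/
lemma abs_estimate_sub_le (hM : 0 ≤ P.M) (hC₁ : 0 ≤ P.C₁) (hC₂ : 0 ≤ P.C₂) (hk : 1 ≤ P.k)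
    {N : ℕ} (hN : 2 ≤ N) (hj : P.IsLinearizable f j) (hxs : xs ∈ P.cell j)
    {θ : MIdx P.k d → ℝ} (hθM : ∀ α, |θ α| ≤ P.M)
    (hθ : ∀ x ∈ P.cell j, |f x - θ ⬝ᵥ P.feature j x| ≤ P.C₂)
    {B : List (Step d)} (hB : ∀ B₁ s R, B = B₁ ++ s :: R → P.IsBatchStep j xs N B₁ s)
    (ht : time B < N) (hacc : ∀ s ∈ B, P.Accurate f s)
    {θh : MIdx P.k d → ℝ} (hh : P.IsEstimate j xs B θh) (v : MIdx P.k d → ℝ) :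
    |(θh - θ) ⬝ᵥ v| ≤ P.C₁' N * √(v ⬝ᵥ ((P.gram j xs B)⁻¹ *ᵥ v)) := by
  have hν := one_le_nu_real hk
  have hθθ : θ ⬝ᵥ θ ≤ P.M ^ 2 * P.ν := by
    calc θ ⬝ᵥ θ ≤ ∑ _α : MIdx P.k d, P.M ^ 2 := Finset.sum_le_sum fun α _ => by
          rw [← sq, ← sq_abs]
          exact pow_le_pow_left₀ (abs_nonneg _) (hθM α) 2
      _ = P.M ^ 2 * (Fintype.card (MIdx P.k d) : ℝ) := by simp [mul_comm]
      _ ≤ P.M ^ 2 * P.ν := by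
          gcongr
          unfold ν
          exact_mod_cast card_mIdx_le_nu P.k d hk
  have hball : √(θ ⬝ᵥ θ) ≤ P.M * √P.ν := by
    rw [Real.sqrt_le_left (by positivity), mul_pow, Real.sq_sqrt (by linarith)]
    exact hθθ
  have h1 := estimate_error_le hball hh
  have hmem : ∀ s ∈ B, P.Accurate f s ∧ s.x = xs ∧ s.x' ∈ P.cell j ∧ 0 < s.n := by
    intro s hs
    obtain ⟨B₁, R, h⟩ := List.append_of_mem hs
    have := hB B₁ s R h
    exact ⟨hacc s hs, this.1, this.2.1, this.2.2.2.1⟩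
  have h2 := sum_sq_residual_le hC₁ hθ hxs B hmem
  have h3 := length_le_tauInf hk hj hxs hN B hB ht
  have h4 := sq_le_C₁'_sq hM hC₁ hC₂ hk hN
  have h5 : (time B : ℝ) ≤ N := by exact_mod_cast ht.le
  have h6 : (θh - θ) ⬝ᵥ (P.gram j xs B *ᵥ (θh - θ)) ≤ P.C₁' N ^ 2 := by
    have h7 := mul_le_mul_of_nonneg_left h3 (show 0 ≤ 4 * P.C₁ by positivity)
    have h8 := mul_le_mul_of_nonneg_left h5 (show 0 ≤ 8 * P.C₂ ^ 2 by positivity)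
    linarith
  have h0 : 0 ≤ v ⬝ᵥ ((P.gram j xs B)⁻¹ *ᵥ v) := by
    simpa using (P.posDef_gram j xs B).inv.posSemidef.dotProduct_mulVec_nonneg v
  refine abs_le_of_sq_le_sq ?_ (mul_nonneg (C₁'_nonneg hM hC₂ N) (Real.sqrt_nonneg _))
  rw [mul_pow, Real.sq_sqrt h0]
  exact (sq_dotProduct_le_of_posDef (P.posDef_gram j xs B) _ v).trans
    (mul_le_mul_of_nonneg_right h6 h0)

/-- One period fewer would not have doubled the determinant, so `(n - 1) w ≤ 1`; the missing `w` is
at most `ν` because the Gram matrix dominates the identity. -/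
lemma width_sq_le (hk : 1 ≤ P.k) (hj : P.IsLinearizable f j) (hxs : xs ∈ P.cell j) {N : ℕ}
    {B : List (Step d)} {s : Step d} (hs : P.IsBatchStep j xs N B s) :
    P.featDiff j xs s.x' ⬝ᵥ ((P.gram j xs B)⁻¹ *ᵥ P.featDiff j xs s.x')
      ≤ (1 + P.ν) / s.n := by
  have hpd := P.posDef_gram j xs B
  obtain ⟨-, hx', -, hn, -, hdet, -⟩ := hs
  have hn' : (0 : ℝ) < s.n := by exact_mod_cast hn
  have h1 := hdet (s.n - 1) (by omega)
  rw [det_add_smul_vecMulVec_self hpd.det_pos.ne'.isUnit, Nat.cast_sub hn, Nat.cast_one] at h1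
  have h2 := (dotProduct_inv_mulVec_le hpd (P.dotProduct_self_le_gram j xs B)
    (P.featDiff j xs s.x')).trans (featDiff_dotProduct_self_le hk hj hxs hx')
  set w := P.featDiff j xs s.x' ⬝ᵥ ((P.gram j xs B)⁻¹ *ᵥ P.featDiff j xs s.x')
  have h3 : 1 + ((s.n : ℝ) - 1) * w ≤ 2 := by
    rw [mul_comm 2] at h1
    exact le_of_mul_le_mul_left h1 hpd.det_pos
  rw [le_div_iff₀ hn']
  linarith

/-- The suboptimality of the solution of one step of a batch within its cell. -/
lemma sub_le_of_isBatchStep (hM : 0 ≤ P.M) (hC₁ : 0 ≤ P.C₁) (hC₂ : 0 ≤ P.C₂) (hk : 1 ≤ P.k)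
    {N : ℕ} (hN : 2 ≤ N) (hj : P.IsLinearizable f j) (hxs : xs ∈ P.cell j)
    {B : List (Step d)} (hB : ∀ B₁ s R, B = B₁ ++ s :: R → P.IsBatchStep j xs N B₁ s)
    (hacc : ∀ s ∈ B, P.Accurate f s) {s : Step d} (hs : P.IsBatchStep j xs N B s)
    {z : Pt d} (hz : z ∈ P.cell j) :
    f z - f s.x' ≤ 4 * P.C₂ + 2 * P.C₁' N * √((1 + P.ν) / s.n) := by
  obtain ⟨θ, hθM, hθ⟩ := hj.exists_coeff
  have hw := Real.sqrt_le_sqrt (width_sq_le hk hj hxs hs)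
  have hC := C₁'_nonneg hM hC₂ N
  obtain ⟨-, hx', ⟨θh, hh, hmax⟩, hn, htime, -, -⟩ := hs
  have ht : time B < N := by omega
  have hconf := abs_estimate_sub_le hM hC₁ hC₂ hk hN hj hxs hθM hθ hB ht hacc hh
  have h1 := abs_le.1 (hconf (P.featDiff j xs z))
  have h2 := abs_le.1 (hconf (P.featDiff j xs s.x'))
  have h3 := abs_le.1 (abs_sub_dotProduct_featDiff_le hθ hxs hz)
  have h4 := abs_le.1 (abs_sub_dotProduct_featDiff_le hθ hxs hx')
  have h5 := hj.sub_le xs hxs z hz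
  have h6 := hmax z hz
  unfold ucb at h6
  rw [sub_dotProduct] at h1 h2
  -- Optimism: the index underestimates the true difference by at most `C₂`, since the linear model
  -- errs by `2 C₂` and the index adds back `C₂`. The cap `M` does no harm because `f` oscillates by
  -- at most `M` on the cell.
  have h7 : f z - f xs - P.C₂ ≤ min P.M (θh ⬝ᵥ P.featDiff j xs z
      + P.C₁' N * √(P.featDiff j xs z ⬝ᵥ ((P.gram j xs B)⁻¹ *ᵥ P.featDiff j xs z)) + P.C₂) :=
    le_min (by linarith) (by linarith)
  have h8 := (h7.trans h6).trans (min_le_right _ _)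
  have h9 := mul_le_mul_of_nonneg_left hw hC
  linarith

/-- The constants of the error bound `errConst + errSlope / √N` of a batch of `N` periods. -/
noncomputable def errConst (P : Params d) : ℝ :=
  36 * P.ν ^ 2 * Real.log (5 * P.ν * P.T) * P.C₂

/-- See `errConst`. -/
noncomputable def errSlope (P : Params d) : ℝ :=
  32 * P.ν ^ 2 * Real.log (5 * P.ν * P.T) * (P.M + √P.C₁)

lemma one_le_log (hk : 1 ≤ P.k) (hT : 2 ≤ P.T) : 1 ≤ Real.log (5 * P.ν * P.T) := by
  have hν := one_le_nu_real hk
  have hT' : (2 : ℝ) ≤ P.T := by exact_mod_cast hT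
  have h10 : (10 : ℝ) ≤ 5 * P.ν * P.T := by nlinarith
  rw [Real.le_log_iff_exp_le (by linarith)]
  linarith [Real.exp_one_lt_three]

/-- `2 N ν ≤ 16 ν T ≤ (5 ν T)²`, and `2 / ln 2 < 3`. The range `N ≤ 8 T` is needed because an
iteration that gets interrupted may be longer than the horizon. -/
lemma tauInf_le (hk : 1 ≤ P.k) (hT : 2 ≤ P.T) {N : ℕ} (hN : 2 ≤ N) (hNT : N ≤ 8 * P.T) :
    P.tauInf N ≤ 3 * P.ν * Real.log (5 * P.ν * P.T) := by
  have hν := one_le_nu_real hk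
  have hT' : (2 : ℝ) ≤ P.T := by exact_mod_cast hT
  have hN' : (2 : ℝ) ≤ N := by exact_mod_cast hN
  have hNT' : (N : ℝ) ≤ 8 * P.T := by exact_mod_cast hNT
  have h10 : (10 : ℝ) ≤ 5 * P.ν * P.T := by nlinarith
  have h1 : 2 * N * P.ν ≤ (5 * P.ν * P.T) ^ 2 := by nlinarith
  have h2 : Real.logb 2 (2 * N * P.ν) ≤ 3 * Real.log (5 * P.ν * P.T) := by
    rw [Real.logb, div_le_iff₀ (Real.log_pos (by norm_num))]
    have h3 := Real.log_le_log (by positivity) h1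
    rw [Real.log_pow] at h3
    have h4 := Real.log_two_gt_d9
    have h5 := one_le_log hk hT
    push_cast at h3
    nlinarith
  calc P.tauInf N = P.ν * Real.logb 2 (2 * N * P.ν) := rfl
    _ ≤ P.ν * (3 * Real.log (5 * P.ν * P.T)) := by gcongr
    _ = _ := by ring

/-- The left side is the error of a step of length `N / (1 + tauInf)`, the guaranteed length of the
longest one. The misspecification part of `C₁'` grows like `√N` and so leaves a constant bias after
division by `√N`. -/
lemma batch_error_le (hM : 0 ≤ P.M) (hC₁ : 0 ≤ P.C₁) (hC₂ : 0 ≤ P.C₂) (hk : 1 ≤ P.k)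
    (hT : 2 ≤ P.T) {N : ℕ} (hN : 2 ≤ N) (hNT : N ≤ 8 * P.T) :
    4 * P.C₂ + 2 * P.C₁' N * √((1 + P.ν) * (1 + P.tauInf N) / N)
      ≤ P.errConst + P.errSlope / √N := by
  have hν := one_le_nu_real hk
  have hN' : (2 : ℝ) ≤ N := by exact_mod_cast hN
  have hτ2 := two_le_tauInf hk hN
  have hτ := tauInf_le hk hT hN hNT
  have hℓ := one_le_log hk hT
  set l := Real.log (5 * P.ν * P.T) with hl
  have hsl : 1 ≤ √l := Real.one_le_sqrt.2 hℓ
  have hsl2 : √l * √l = l := Real.mul_self_sqrt (by linarith)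
  have hsN : 0 < √(N : ℝ) := by positivity
  have hsN2 : √(N : ℝ) * √N = N := Real.mul_self_sqrt (by positivity)
  have hsν : √P.ν ≤ P.ν := Real.sqrt_le_self_iff.2 (Or.inr hν)
  have hτ' : P.tauInf N ≤ (2 * P.ν * √l) ^ 2 := by
    have e : (2 * P.ν * √l) ^ 2 = 4 * P.ν * l * P.ν := by linear_combination 4 * P.ν ^ 2 * hsl2
    rw [e]
    nlinarith [mul_nonneg (show 0 ≤ P.ν by linarith) (show 0 ≤ l by linarith)]
  have hw : √((1 + P.ν) * (1 + P.tauInf N) / N) ≤ 4 * P.ν * √l / √N := by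
    rw [Real.sqrt_le_left (by positivity), div_pow, Real.sq_sqrt (by positivity)]
    gcongr
    have : (1 + P.ν) * (1 + P.tauInf N) ≤ (2 * P.ν) * (2 * (3 * P.ν * l)) := by
      gcongr
      · linarith
      · linarith
    nlinarith
  have hC : P.C₁' N ≤ 2 * P.M * P.ν + 4 * P.ν * √l * P.C₂ * √N + 4 * P.ν * √l * √P.C₁ := by
    have e1 : √(P.tauInf N * N) ≤ 2 * P.ν * √l * √N := by
      rw [Real.sqrt_mul (by linarith)]
      gcongr
      rw [Real.sqrt_le_left (by positivity)]
      exact hτ'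
    have e2 : √(P.C₁ * P.tauInf N) ≤ √P.C₁ * (2 * P.ν * √l) := by
      rw [Real.sqrt_mul hC₁]
      gcongr
      rw [Real.sqrt_le_left (by positivity)]
      exact hτ'
    unfold C₁'
    have e3 := mul_le_mul_of_nonneg_left e1 (show 0 ≤ 2 * P.C₂ by positivity)
    have e4 := mul_le_mul_of_nonneg_left hsν (show 0 ≤ 2 * P.M by positivity)
    linarith
  have hprod : 2 * P.C₁' N * √((1 + P.ν) * (1 + P.tauInf N) / N)
      ≤ 2 * (2 * P.M * P.ν + 4 * P.ν * √l * P.C₂ * √N + 4 * P.ν * √l * √P.C₁)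
        * (4 * P.ν * √l / √N) := by
    have := C₁'_nonneg hM hC₂ N
    gcongr
  have hexp : 2 * (2 * P.M * P.ν + 4 * P.ν * √l * P.C₂ * √N + 4 * P.ν * √l * √P.C₁)
        * (4 * P.ν * √l / √N)
      = 32 * P.ν ^ 2 * l * P.C₂ + (16 * P.M * P.ν ^ 2 * √l + 32 * P.ν ^ 2 * l * √P.C₁) / √N := by
    field_simp
    linear_combination 32 * (P.C₂ * √N + √P.C₁) * hsl2
  have hslope : 16 * P.M * P.ν ^ 2 * √l + 32 * P.ν ^ 2 * l * √P.C₁ ≤ P.errSlope := by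
    have : √l ≤ l := Real.sqrt_le_self_iff.2 (Or.inr hℓ)
    have h1 : 16 * P.M * P.ν ^ 2 * √l ≤ 16 * P.M * P.ν ^ 2 * l := by gcongr
    have h2 : 0 ≤ 16 * P.M * P.ν ^ 2 * l := by positivity
    unfold errSlope
    rw [← hl]
    linarith
  have hconst : 4 * P.C₂ + 32 * P.ν ^ 2 * l * P.C₂ ≤ P.errConst := by
    have h1 : 1 ≤ P.ν ^ 2 * l := by nlinarith
    unfold errConst
    rw [← hl]
    nlinarith
  have := div_le_div_of_nonneg_right hslope hsN.le
  linarith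

end Params

/-- The loss of a transcript with respect to the value `v`. -/
noncomputable def loss {d : ℕ} (f : Pt d → ℝ) (v : ℝ) (L : List (Step d)) : ℝ :=
  (L.map fun s => (s.n : ℝ) * (2 * v - f s.x - f s.x')).sum

/-! ### Loss and duration of transcripts. -/

section Loss

variable {d : ℕ} (f : Pt d → ℝ) (v : ℝ)

lemma loss_nil : loss f v [] = 0 := by simp [loss]

lemma loss_cons (s : Step d) (L : List (Step d)) :
    loss f v (s :: L) = s.n * (2 * v - f s.x - f s.x') + loss f v L := by simp [loss]

lemma loss_append (L L' : List (Step d)) : loss f v (L ++ L') = loss f v L + loss f v L' := by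
  simp [loss]

lemma loss_eq_loss_add (v' : ℝ) (L : List (Step d)) :
    loss f v L = loss f v' L + 2 * (v - v') * time L := by
  induction L with
  | nil => simp [loss, time]
  | cons s L ih =>
    rw [loss_cons, loss_cons, ih, Params.time_cons]
    push_cast
    ring

lemma loss_le_of_forall {c : ℝ} (L : List (Step d))
    (h : ∀ s ∈ L, 2 * v - f s.x - f s.x' ≤ c) : loss f v L ≤ c * time L := by
  induction L with
  | nil => simp [loss, time]
  | cons s L ih =>
    rw [loss_cons, Params.time_cons]
    have h1 := ih fun s' hs' => h s' (by simp [hs'])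
    have h2 := mul_le_mul_of_nonneg_left (h s (by simp)) (Nat.cast_nonneg (α := ℝ) s.n)
    push_cast
    linarith

end Loss

lemma time_nil {d : ℕ} : time ([] : List (Step d)) = 0 := rfl

lemma length_le_time {d : ℕ} (L : List (Step d)) (h : ∀ s ∈ L, 0 < s.n) : L.length ≤ time L := by
  induction L with
  | nil => simp
  | cons s L ih =>
    rw [Params.time_cons, List.length_cons]
    have h1 := ih fun s' hs' => h s' (by simp [hs'])
    have h2 := h s (by simp)
    omega

lemma time_le_length_mul {d : ℕ} (L : List (Step d)) (n : ℕ) (h : ∀ s ∈ L, s.n ≤ n) :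
    time L ≤ L.length * n := by
  induction L with
  | nil => simp [time_nil]
  | cons s L ih =>
    rw [Params.time_cons, List.length_cons, add_mul, one_mul]
    have h1 := ih fun s' hs' => h s' (by simp [hs'])
    have h2 := h s (by simp)
    omega

/-! ### Error and loss of the batched and the iterated routine. -/

namespace Params

variable {d : ℕ} {P : Params d} {f : Pt d → ℝ} {j : P.Cell} {xs : Pt d}

/-- Both solutions of the step `s`, which lasts at least one period, are in cell `j`. -/
def InCell (j : P.Cell) (s : Step d) : Prop := 0 < s.n ∧ s.x ∈ P.cell j ∧ s.x' ∈ P.cell j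

lemma BatchRun.inCell {N : ℕ} {L : List (Step d)} {x : Pt d} (h : P.BatchRun j xs N L x)
    (hxs : xs ∈ P.cell j) : x ∈ P.cell j ∧ ∀ s ∈ L, P.InCell j s := by
  have hL : ∀ s ∈ L, P.InCell j s := by
    intro s hs
    obtain ⟨B, R, hBR⟩ := List.append_of_mem hs
    have := h.1 B s R hBR
    exact ⟨this.2.2.2.1, this.1 ▸ hxs, this.2.1⟩
  obtain ⟨-, -, s, hs, -, rfl⟩ := h
  exact ⟨(hL s hs).2.2, hL⟩

lemma IterLoop.inCell {β : ℕ} {L : List (Step d)} {x : Pt d} (h : P.IterLoop j β L x) :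
    x ∈ P.cell j ∧ (∀ s ∈ L, P.InCell j s) ∧ time L + 2 = 2 ^ (β + 1) := by
  induction h with
  | zero x hx => exact ⟨hx, by simp, rfl⟩
  | succ β L B x x' hL hB ih =>
    obtain ⟨h1, h2, h3⟩ := ih
    obtain ⟨h4, h5⟩ := hB.inCell h1
    refine ⟨h4, ?_, ?_⟩
    · intro s hs
      rcases List.mem_append.1 hs with hs | hs
      · exact h2 s hs
      · exact h5 s hs
    · rw [time_append, hB.2.1, pow_succ 2 (β + 1)]
      omega

/-- All batches fit into `N` periods with at least one left for the final commitment, yet the last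
batch is longer than `(N + 1) / 4`. -/
lemma two_pow_log_sub_one_le {N : ℕ} (hN : 1 ≤ N) :
    2 ^ (Nat.log 2 (N + 1) - 1 + 1) ≤ N + 1 ∧ N + 1 < 4 * 2 ^ (Nat.log 2 (N + 1) - 1) := by
  have h1 : 1 ≤ Nat.log 2 (N + 1) := Nat.log_pos (by norm_num) (by omega)
  have h2 : Nat.log 2 (N + 1) - 1 + 1 = Nat.log 2 (N + 1) := by omega
  have h3 := Nat.lt_pow_succ_log_self (b := 2) (by norm_num) (N + 1)
  rw [h2]
  refine ⟨Nat.pow_log_le_self 2 (by omega), ?_⟩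
  calc N + 1 < 2 ^ (Nat.log 2 (N + 1)).succ := h3
    _ = 2 ^ (Nat.log 2 (N + 1) - 1 + 1 + 1) := by rw [h2]
    _ = _ := by ring

lemma IterRun.inCell {N : ℕ} (hN : 1 ≤ N) {L : List (Step d)} {x : Pt d}
    (h : P.IterRun j N L x) : x ∈ P.cell j ∧ (∀ s ∈ L, P.InCell j s) ∧ time L = N := by
  obtain ⟨L₀, y, h0, rfl⟩ := h
  obtain ⟨h1, h2, h3⟩ := h0.inCell
  have h4 := (two_pow_log_sub_one_le hN).1
  refine ⟨h1, ?_, ?_⟩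
  · intro s hs
    rcases List.mem_append.1 hs with hs | hs
    · exact h2 s hs
    · rw [List.mem_singleton] at hs
      subst hs
      exact ⟨by show 0 < N - time L₀; omega, h1, h1⟩
  · rw [time_append, time_cons, time_nil]
    dsimp only
    omega

/-- Replacing `2 √(A / n)` by its AM-GM bound `R + A / (n R)` makes the sum depend only on the total
time and the number of steps. -/
lemma sum_gap_le {A C R E : ℝ} (hA : 0 ≤ A) (hC : 0 ≤ C) (hR : 0 < R) (z : Pt d)
    (L : List (Step d)) (hL : ∀ s ∈ L, 0 < s.n ∧ f z - f s.x' ≤ E + 2 * C * √(A / s.n)) :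
    (L.map fun s => (s.n : ℝ) * (f z - f s.x')).sum
      ≤ E * time L + C * (R * time L + A / R * L.length) := by
  induction L with
  | nil => simp [time_nil]
  | cons s L ih =>
    have h1 := ih fun s' hs' => hL s' (by simp [hs'])
    obtain ⟨hn, h2⟩ := hL s (by simp)
    have hn' : (0 : ℝ) < s.n := by exact_mod_cast hn
    have h3 : 2 * √(A / s.n) ≤ R + A / s.n / R := by
      have h4 : √(A / s.n) ^ 2 = A / s.n := Real.sq_sqrt (by positivity)
      rw [← sub_nonneg]
      have : R + A / s.n / R - 2 * √(A / s.n) = (R - √(A / s.n)) ^ 2 / R := by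
        have e : A / s.n / R = √(A / s.n) ^ 2 / R := by rw [h4]
        rw [e]
        field_simp
        ring
      rw [this]
      positivity
    have h5 : (s.n : ℝ) * (f z - f s.x') ≤ s.n * (E + C * (R + A / s.n / R)) := by
      gcongr
      refine h2.trans ?_
      have := mul_le_mul_of_nonneg_left h3 hC
      linarith
    have h6 : (s.n : ℝ) * (E + C * (R + A / s.n / R)) = E * s.n + C * (R * s.n + A / R) := by
      field_simp
    simp only [List.map_cons, List.sum_cons, List.length_cons, time_cons]
    push_cast
    linarith

/-- The conditions on the parameters and on `f` under which the routines are analyzed. -/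
structure Regular (P : Params d) (f : Pt d → ℝ) : Prop where
  M_nonneg : 0 ≤ P.M
  C₁_nonneg : 0 ≤ P.C₁
  C₂_nonneg : 0 ≤ P.C₂
  one_le_k : 1 ≤ P.k
  two_le_T : 2 ≤ P.T
  isLinearizable : ∀ j, P.IsLinearizable f j

namespace Regular

variable (hP : P.Regular f)
include hP

lemma errConst_nonneg : 0 ≤ P.errConst := by
  have h1 := one_le_nu_real hP.one_le_k
  have h2 := one_le_log hP.one_le_k hP.two_le_T
  have h3 := hP.C₂_nonneg
  unfold errConst
  positivity

/-- Lets the arbitrary initial solution, with error at most `M`, start the induction over batches.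
-/
lemma M_le_errSlope : P.M ≤ P.errSlope := by
  have h1 := one_le_nu_real hP.one_le_k
  have h2 := one_le_log hP.one_le_k hP.two_le_T
  have h3 := hP.M_nonneg
  have h4 := Real.sqrt_nonneg P.C₁
  unfold errSlope
  have h5 : 1 ≤ 32 * P.ν ^ 2 * Real.log (5 * P.ν * P.T) := by nlinarith
  nlinarith

lemma errSlope_nonneg : 0 ≤ P.errSlope := hP.M_nonneg.trans hP.M_le_errSlope

/-- The last step may run out of time before the determinant doubles; it is counted separately. -/
lemma batchRun_length_le {N : ℕ} (hN : 2 ≤ N) {L : List (Step d)} {x : Pt d}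
    (h : P.BatchRun j xs N L x) (hxs : xs ∈ P.cell j) : (L.length : ℝ) ≤ 1 + P.tauInf N := by
  rcases List.eq_nil_or_concat' L with rfl | ⟨B, s, rfl⟩
  · have := two_le_tauInf hP.one_le_k hN
    simp
    linarith
  · have hs := h.1 B s [] rfl
    have h1 := length_le_tauInf hP.one_le_k (hP.isLinearizable j) hxs hN B
      (fun B₁ s' R hB => h.1 B₁ s' (R ++ [s]) (by simp [hB])) (by
        have := hs.2.2.2.1
        have := hs.2.2.2.2.1
        omega)
    simp
    linarith

lemma batchRun_step {N : ℕ} (hN : 2 ≤ N) {L : List (Step d)} {x : Pt d}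
    (h : P.BatchRun j xs N L x) (hxs : xs ∈ P.cell j) (hacc : ∀ s ∈ L, P.Accurate f s)
    {z : Pt d} (hz : z ∈ P.cell j) {s : Step d} (hs : s ∈ L) :
    f z - f s.x' ≤ 4 * P.C₂ + 2 * P.C₁' N * √((1 + P.ν) / s.n) := by
  obtain ⟨B, R, rfl⟩ := List.append_of_mem hs
  exact sub_le_of_isBatchStep hP.M_nonneg hP.C₁_nonneg hP.C₂_nonneg hP.one_le_k hN
    (hP.isLinearizable j) hxs
    (fun B₁ s' R' hB => h.1 B₁ s' (R' ++ s :: R) (by simp [hB]))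
    (fun s' hs' => hacc s' (by simp [hs'])) (h.1 B s R rfl) hz

/-- The solution returned by a batch is nearly optimal in its cell. -/
lemma batchRun_error_le {N : ℕ} (hN : 2 ≤ N) (hNT : N ≤ 8 * P.T) {L : List (Step d)} {x : Pt d}
    (h : P.BatchRun j xs N L x) (hxs : xs ∈ P.cell j) (hacc : ∀ s ∈ L, P.Accurate f s)
    {z : Pt d} (hz : z ∈ P.cell j) : f z - f x ≤ P.errConst + P.errSlope / √N := by
  refine le_trans ?_ (batch_error_le hP.M_nonneg hP.C₁_nonneg hP.C₂_nonneg hP.one_le_k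
    hP.two_le_T hN hNT)
  have hlen := hP.batchRun_length_le hN h hxs
  have hcell := (h.inCell hxs).2
  have hstep := fun s hs => hP.batchRun_step hN h hxs hacc hz (s := s) hs
  obtain ⟨-, htime, s, hs, hmax, rfl⟩ := h
  have hn : (0 : ℝ) < s.n := by exact_mod_cast (hcell s hs).1
  have hN' : (0 : ℝ) < N := by exact_mod_cast (by omega : 0 < N)
  have hν := one_le_nu_real hP.one_le_k
  -- Pigeonhole: the longest step lasts at least the average length.
  have h1 : (N : ℝ) ≤ L.length * s.n := by
    rw [← htime]
    exact_mod_cast time_le_length_mul L s.n hmax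
  have hC := C₁'_nonneg hP.M_nonneg hP.C₂_nonneg N
  refine (hstep s hs).trans ?_
  gcongr 4 * P.C₂ + 2 * P.C₁' N * √?_
  rw [div_le_div_iff₀ hn hN', mul_assoc]
  gcongr
  exact h1.trans (by gcongr)

/-- The loss of a batch. -/
lemma batchRun_loss_le {N : ℕ} (hN : 2 ≤ N) (hNT : N ≤ 8 * P.T) {L : List (Step d)} {x : Pt d}
    (h : P.BatchRun j xs N L x) (hxs : xs ∈ P.cell j) (hacc : ∀ s ∈ L, P.Accurate f s)
    {z : Pt d} (hz : z ∈ P.cell j) :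
    loss f (f z) L ≤ N * ((f z - f xs) + (P.errConst + P.errSlope / √N)) := by
  have hlen := hP.batchRun_length_le hN h hxs
  have hcell := (h.inCell hxs).2
  have hν := one_le_nu_real hP.one_le_k
  have hτ := two_le_tauInf hP.one_le_k hN
  have hN' : (0 : ℝ) < N := by exact_mod_cast (by omega : 0 < N)
  have hC := C₁'_nonneg hP.M_nonneg hP.C₂_nonneg N
  -- This `R` balances the two terms of `sum_gap_le`, using the bound `1 + tauInf` on the number of
  -- steps.
  set R := √((1 + P.ν) * (1 + P.tauInf N) / N) with hR
  have hR0 : 0 < R := Real.sqrt_pos.2 (by positivity)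
  have hR2 : R * R = (1 + P.ν) * (1 + P.tauInf N) / N := Real.mul_self_sqrt (by positivity)
  have h1 := sum_gap_le (A := 1 + P.ν) (E := 4 * P.C₂) (f := f) (by positivity) hC hR0 z L
    fun s hs => ⟨(hcell s hs).1, hP.batchRun_step hN h hxs hacc hz hs⟩
  have h2 := batch_error_le hP.M_nonneg hP.C₁_nonneg hP.C₂_nonneg hP.one_le_k
    hP.two_le_T hN hNT
  have hx : ∀ s ∈ L, s.x = xs := by
    intro s hs
    obtain ⟨B, R, hBR⟩ := List.append_of_mem hs
    exact (h.1 B s R hBR).1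
  have h3 : loss f (f z) L = (f z - f xs) * time L
      + (L.map fun s => (s.n : ℝ) * (f z - f s.x')).sum := by
    clear h1 hlen hcell h hacc
    induction L with
    | nil => simp [loss, time]
    | cons s L ih =>
      rw [loss_cons, ih fun s' hs' => hx s' (by simp [hs']), time_cons, hx s (by simp)]
      simp only [List.map_cons, List.sum_cons]
      push_cast
      ring
  rw [h3]
  rw [h.2.1] at h1 ⊢
  have h4 : (1 + P.ν) / R * L.length ≤ R * N := by
    rw [div_mul_eq_mul_div, div_le_iff₀ hR0]
    have : R * N * R = (1 + P.ν) * (1 + P.tauInf N) := by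
      rw [mul_right_comm, hR2]
      field_simp
    rw [this]
    gcongr
  have h5 := mul_le_mul_of_nonneg_left h4 hC
  have h6 := mul_le_mul_of_nonneg_right h2 hN'.le
  linarith

/-- The iterated batches: the error of the current solution and the accumulated loss. -/
lemma iterLoop_bounds {β : ℕ} {L : List (Step d)} {x : Pt d} (h : P.IterLoop j β L x)
    (hβ : 2 ^ β ≤ 8 * P.T) (hacc : ∀ s ∈ L, P.Accurate f s) {z : Pt d} (hz : z ∈ P.cell j) :
    f z - f x ≤ P.errConst + P.errSlope / √(2 ^ β) ∧
      loss f (f z) L ≤ 2 * P.errConst * time L + 3 * P.errSlope * β * √(2 ^ β) := by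
  have hE := hP.errConst_nonneg
  have hS := hP.errSlope_nonneg
  induction h with
  | zero x hx =>
    have := (hP.isLinearizable j).sub_le x hx z hz
    have := hP.M_le_errSlope
    constructor
    · simp; linarith
    · simp [loss_nil, time_nil]
  | succ β L B x x' hL hB ih =>
    have hpow : 2 ^ β ≤ 2 ^ (β + 1) := Nat.pow_le_pow_right (by norm_num) (by omega)
    obtain ⟨h1, h2⟩ := ih (hpow.trans hβ) fun s hs => hacc s (by simp [hs])
    have hx := hL.inCell.1
    have hN : 2 ≤ 2 ^ (β + 1) := by
      simpa using Nat.pow_le_pow_right (n := 2) (by norm_num) (by omega : 1 ≤ β + 1)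
    have haccB : ∀ s ∈ B, P.Accurate f s := fun s hs => hacc s (by simp [hs])
    have h3 := hP.batchRun_error_le hN hβ hB hx haccB hz
    have h4 := hP.batchRun_loss_le hN hβ hB hx haccB hz
    push_cast at h3 h4
    refine ⟨h3, ?_⟩
    rw [loss_append, time_append, hB.2.1]
    set a := √((2 : ℝ) ^ β) with ha
    set b := √((2 : ℝ) ^ (β + 1)) with hb
    have ha0 : 0 < a := by positivity
    have hb0 : 0 < b := by positivity
    have ha2 : a * a = 2 ^ β := Real.mul_self_sqrt (by positivity)
    have hb2 : b * b = 2 ^ (β + 1) := Real.mul_self_sqrt (by positivity)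
    have hab : a ≤ b := Real.sqrt_le_sqrt (by gcongr <;> norm_num)
    -- The baseline comes from a batch half as long, so playing it during this batch costs only a
    -- constant times `√` of the length.
    have h5 : (2 : ℝ) ^ (β + 1) * (P.errSlope / a) ≤ 2 * P.errSlope * b := by
      have : (2 : ℝ) ^ (β + 1) * (P.errSlope / a) = 2 * P.errSlope * a := by
        rw [pow_succ, ← ha2]
        field_simp
      rw [this]
      gcongr
    have h6 : (2 : ℝ) ^ (β + 1) * (P.errSlope / b) = P.errSlope * b := by
      rw [← hb2]
      field_simp
    have h7 : (2 : ℝ) ^ (β + 1) * (f z - f x)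
        ≤ 2 ^ (β + 1) * (P.errConst + P.errSlope / a) := by gcongr
    have h8 : 3 * P.errSlope * β * a ≤ 3 * P.errSlope * β * b := by gcongr
    push_cast
    linarith

/-- The iterated routine: the error of the returned solution and the accumulated loss. -/
lemma iterRun_bounds {N : ℕ} (hN : 1 ≤ N) (hNT : N ≤ 8 * P.T) {L : List (Step d)} {x : Pt d}
    (h : P.IterRun j N L x) (hacc : ∀ s ∈ L, P.Accurate f s) {z : Pt d} (hz : z ∈ P.cell j) :
    f z - f x ≤ P.errConst + 2 * P.errSlope / √N ∧
      loss f (f z) L ≤ 2 * P.errConst * N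
        + 4 * P.errSlope * (1 + Nat.log 2 (N + 1)) * √N := by
  have hE := hP.errConst_nonneg
  have hS := hP.errSlope_nonneg
  obtain ⟨L₀, y, h0, rfl⟩ := h
  obtain ⟨h1, h2⟩ := two_pow_log_sub_one_le hN
  obtain ⟨-, -, ht⟩ := h0.inCell
  have hle : 2 ^ (Nat.log 2 (N + 1) - 1) ≤ N := by
    have : 1 ≤ 2 ^ (Nat.log 2 (N + 1) - 1) := Nat.one_le_two_pow
    rw [pow_succ] at h1
    omega
  obtain ⟨h3, h4⟩ := hP.iterLoop_bounds h0 (hle.trans hNT) (fun s hs => hacc s (by simp [hs])) hz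
  set β := Nat.log 2 (N + 1) - 1 with hβ
  have hβ' : (β : ℝ) ≤ Nat.log 2 (N + 1) := by exact_mod_cast Nat.sub_le _ _
  set a := √((2 : ℝ) ^ β) with ha
  set b := √(N : ℝ) with hb
  have ha0 : 0 < a := by positivity
  have hNpos : (0 : ℝ) < N := by exact_mod_cast hN
  have hb0 : 0 < b := by positivity
  have hbb : b * b = N := Real.mul_self_sqrt (by positivity)
  have hab : a ≤ b := Real.sqrt_le_sqrt (by exact_mod_cast hle)
  -- The last batch has at least a quarter of the periods, so its error is within a factor `2` of
  -- that of a full batch.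
  have hba : b ≤ 2 * a := by
    rw [hb, Real.sqrt_le_left (by positivity), mul_pow, ha, Real.sq_sqrt (by positivity)]
    have : (N : ℝ) + 1 < 4 * 2 ^ β := by exact_mod_cast h2
    linarith
  have h5 : f z - f x ≤ P.errConst + 2 * P.errSlope / b := by
    have : P.errSlope / a ≤ 2 * P.errSlope / b := by
      rw [div_le_div_iff₀ ha0 hb0]
      nlinarith
    linarith
  refine ⟨h5, ?_⟩
  have htN : time L₀ ≤ N := by omega
  rw [loss_append, loss_cons, loss_nil]
  dsimp only
  rw [Nat.cast_sub htN]
  have htN' : (time L₀ : ℝ) ≤ N := by exact_mod_cast htN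
  have h6 : ((N : ℝ) - time L₀) * (2 * f z - f x - f x)
      ≤ (N - time L₀) * (2 * P.errConst) + N * (4 * P.errSlope / b) := by
    have e1 : ((N : ℝ) - time L₀) * (2 * f z - f x - f x)
        ≤ (N - time L₀) * (2 * (P.errConst + 2 * P.errSlope / b)) := by
      refine mul_le_mul_of_nonneg_left (by linarith) (by linarith)
    have e2 : ((N : ℝ) - time L₀) * (4 * P.errSlope / b) ≤ N * (4 * P.errSlope / b) := by
      refine mul_le_mul_of_nonneg_right (by linarith [Nat.cast_nonneg (α := ℝ) (time L₀)])
        (by positivity)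
    have e3 : (2 : ℝ) * (2 * P.errSlope / b) = 4 * P.errSlope / b := by ring
    rw [mul_add, e3] at e1
    linarith
  have h7 : (N : ℝ) * (4 * P.errSlope / b) = 4 * P.errSlope * b := by
    rw [← hbb]
    field_simp
  have h8 : 3 * P.errSlope * β * a ≤ 4 * P.errSlope * (Nat.log 2 (N + 1)) * b := by
    gcongr
    norm_num
  linarith

end Regular

end Params

lemma time_eq_length_mul {d : ℕ} (L : List (Step d)) (n : ℕ) (h : ∀ s ∈ L, s.n = n) :
    time L = L.length * n := by
  induction L with
  | nil => simp [time_nil]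
  | cons s L ih =>
    rw [Params.time_cons, List.length_cons, add_mul, one_mul, h s (by simp),
      ih fun s' hs' => h s' (by simp [hs']), add_comm]

lemma length_eq_card_of_nodup {α : Type*} {l : List α} {A : Finset α} (hl : l.Nodup)
    (h : ∀ a, a ∈ l ↔ a ∈ A) : l.length = A.card := by
  classical
  rw [← List.toFinset_card_of_nodup hl]
  congr 1
  ext a
  simp [h]

lemma card_le_length_of_forall_mem {α : Type*} {l : List α} {A : Finset α}
    (h : ∀ a ∈ A, a ∈ l) : A.card ≤ l.length := by
  classical
  exact (Finset.card_le_card fun a ha => List.mem_toFinset.2 (h a ha)).trans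
    l.toFinset_card_le

namespace Params

variable {d : ℕ} {P : Params d} {f : Pt d → ℝ}

/-! ### The tournament -/

section Tournament

variable {N : ℕ} {sol : P.Cell → Pt d} {A A' : Finset P.Cell} {L : List (Step d)} {w : P.Cell}

/-- Every step of `L` lasts `N` periods and compares the solutions of two cells of `A`. -/
def Compares (N : ℕ) (sol : P.Cell → Pt d) (A : Finset P.Cell) (L : List (Step d)) : Prop :=
  ∀ s ∈ L, s.n = N ∧ ∃ j ∈ A, ∃ j' ∈ A, s.x = sol j ∧ s.x' = sol j'

/-- Every match removes a competitor, so matches are paid for by eliminations; at most half, rounded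
up, remain. -/
lemma Round.card (h : P.Round N sol A L A') :
    A' ⊆ A ∧ L.length + A'.card ≤ A.card ∧ A'.card ≤ (A.card + 1) / 2 ∧ P.Compares N sol A L := by
  obtain ⟨m, bye, hnd, hA, rfl, hA'⟩ := h
  have hlen := length_eq_card_of_nodup hnd hA
  have hfl : (m.flatMap fun m => [m.1, m.2.1]).length = 2 * m.length := by
    simp [List.length_flatMap, mul_comm]
  rw [List.length_append, hfl] at hlen
  have hbye : bye.toList.length ≤ 1 := by cases bye <;> simp
  have hmem : ∀ r ∈ m, r.1 ∈ A ∧ r.2.1 ∈ A := fun r hr =>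
    ⟨(hA _).1 (List.mem_append_left _ (List.mem_flatMap.2 ⟨r, hr, by simp⟩)),
      (hA _).1 (List.mem_append_left _ (List.mem_flatMap.2 ⟨r, hr, by simp⟩))⟩
  have hsub : A' ⊆ A := by
    intro a ha
    rcases (hA' a).1 ha with hb | ⟨r, hr, ⟨-, rfl⟩ | ⟨-, rfl⟩⟩
    · exact (hA a).1 (List.mem_append_right _ (Option.mem_toList.2 hb))
    · exact (hmem r hr).2
    · exact (hmem r hr).1
  have hcard : A'.card ≤ (m.map (fun r => if 0 ≤ r.2.2 then r.2.1 else r.1)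
      ++ bye.toList).length := by
    refine card_le_length_of_forall_mem fun a ha => ?_
    rcases (hA' a).1 ha with hb | ⟨r, hr, ⟨h0, rfl⟩ | ⟨h0, rfl⟩⟩
    · exact List.mem_append_right _ (Option.mem_toList.2 hb)
    · exact List.mem_append_left _ (List.mem_map.2 ⟨r, hr, if_pos h0⟩)
    · exact List.mem_append_left _ (List.mem_map.2 ⟨r, hr, if_neg (not_le.2 h0)⟩)
  rw [List.length_append, List.length_map] at hcard
  refine ⟨hsub, by rw [List.length_map]; omega, by omega, ?_⟩
  intro s hs
  obtain ⟨r, hr, rfl⟩ := List.mem_map.1 hs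
  exact ⟨rfl, r.1, (hmem r hr).1, r.2.1, (hmem r hr).2, rfl, rfl⟩

/-- A competitor that loses by the sign of an accurate answer is beaten by one that is worse by at
most the noise. -/
lemma Round.exists_ge (h : P.Round N sol A L A') (hacc : ∀ s ∈ L, P.Accurate f s)
    {a : P.Cell} (ha : a ∈ A) :
    ∃ a' ∈ A', f (sol a) ≤ f (sol a') + √(2 * P.C₁ / N) := by
  obtain ⟨m, bye, hnd, hA, rfl, hA'⟩ := h
  have h0 : 0 ≤ √(2 * P.C₁ / N) := Real.sqrt_nonneg _
  rcases List.mem_append.1 ((hA a).2 ha) with hm | hb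
  · obtain ⟨r, hr, har⟩ := List.mem_flatMap.1 hm
    have hs := abs_le.1 (hacc _ (List.mem_map.2 ⟨r, hr, rfl⟩))
    dsimp only at hs
    rcases le_or_gt 0 r.2.2 with hy | hy
    · refine ⟨r.2.1, (hA' _).2 (Or.inr ⟨r, hr, Or.inl ⟨hy, rfl⟩⟩), ?_⟩
      simp only [List.mem_cons, List.not_mem_nil, or_false] at har
      rcases har with rfl | rfl <;> linarith
    · refine ⟨r.1, (hA' _).2 (Or.inr ⟨r, hr, Or.inr ⟨hy, rfl⟩⟩), ?_⟩
      simp only [List.mem_cons, List.not_mem_nil, or_false] at har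
      rcases har with rfl | rfl <;> linarith
  · exact ⟨a, (hA' a).2 (Or.inl (Option.mem_toList.1 hb)), by linarith⟩

lemma Tournament.card (h : P.Tournament N sol A L w) :
    w ∈ A ∧ L.length + 1 ≤ A.card ∧ P.Compares N sol A L := by
  induction h with
  | done j => exact ⟨by simp, by simp, by simp [Compares]⟩
  | round A A' L L' w hA hr _ ih =>
    obtain ⟨h1, h2, h3⟩ := ih
    obtain ⟨h4, h5, -, h6⟩ := hr.card
    refine ⟨h4 h1, by rw [List.length_append]; omega, ?_⟩
    intro s hs
    rcases List.mem_append.1 hs with hs | hs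
    · exact h6 s hs
    · obtain ⟨hn, a, ha, b, hb, hab⟩ := h3 s hs
      exact ⟨hn, a, h4 ha, b, h4 hb, hab⟩

/-- The winner is nearly as good as every competitor. -/
lemma Tournament.le_winner (h : P.Tournament N sol A L w) (hacc : ∀ s ∈ L, P.Accurate f s)
    {a : P.Cell} (ha : a ∈ A) :
    f (sol a) ≤ f (sol w) + Nat.clog 2 A.card * √(2 * P.C₁ / N) := by
  induction h generalizing a with
  | done j => rw [Finset.mem_singleton.1 ha]; simp
  | round A A' L L' w hA hr _ ih =>
    obtain ⟨a', ha', h1⟩ := hr.exists_ge (fun s hs => hacc s (by simp [hs])) ha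
    have h2 := ih (fun s hs => hacc s (by simp [hs])) ha'
    -- Halving with rounding up lowers the binary ceiling logarithm by one, so each round pays for
    -- its noise.
    have h3 : Nat.clog 2 A'.card + 1 ≤ Nat.clog 2 A.card := by
      rw [Nat.clog_of_two_le (b := 2) (n := A.card) one_lt_two hA]
      have := Nat.clog_mono_right 2 hr.card.2.2.1
      simpa using this
    have h4 : ((Nat.clog 2 A'.card : ℝ) + 1) ≤ Nat.clog 2 A.card := by exact_mod_cast h3
    have h5 := mul_le_mul_of_nonneg_right h4 (Real.sqrt_nonneg (2 * P.C₁ / N))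
    linarith

lemma Eliminate.card {thr : ℝ} (h : P.Eliminate N thr sol A w L A') (hw : w ∈ A) :
    A' ⊆ A ∧ w ∈ A' ∧ L.length + 1 = A.card ∧ P.Compares N sol A L := by
  classical
  obtain ⟨R, hnd, hR, rfl, hA'⟩ := h
  have hlen := length_eq_card_of_nodup (A := A.erase w) hnd fun a => by
    rw [hR, Finset.mem_erase, and_comm]
  rw [Finset.card_erase_of_mem hw, List.length_map] at hlen
  have hpos : 0 < A.card := Finset.card_pos.2 ⟨w, hw⟩
  have hmem : ∀ r ∈ R, r.1 ∈ A := fun r hr => ((hR _).1 (List.mem_map.2 ⟨r, hr, rfl⟩)).1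
  refine ⟨?_, (hA' w).2 (Or.inl rfl), by rw [List.length_map]; omega, ?_⟩
  · intro a ha
    rcases (hA' a).1 ha with rfl | ⟨r, hr, -, rfl⟩
    · exact hw
    · exact hmem r hr
  · intro s hs
    obtain ⟨r, hr, rfl⟩ := List.mem_map.1 hs
    exact ⟨rfl, r.1, hmem r hr, w, hw, rfl, rfl⟩

/-- What an accurate elimination keeps. -/
lemma Eliminate.mem {thr : ℝ} (h : P.Eliminate N thr sol A w L A')
    (hacc : ∀ s ∈ L, P.Accurate f s) :
    (∀ a ∈ A, f (sol w) - f (sol a) + √(2 * P.C₁ / N) ≤ thr → a ∈ A') ∧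
      ∀ a ∈ A', f (sol w) - f (sol a) ≤ max 0 (thr + √(2 * P.C₁ / N)) := by
  obtain ⟨R, hnd, hR, rfl, hA'⟩ := h
  have hs : ∀ r ∈ R, |r.2 - (f (sol w) - f (sol r.1))| ≤ √(2 * P.C₁ / N) := fun r hr =>
    hacc _ (List.mem_map.2 ⟨r, hr, rfl⟩)
  constructor
  · intro a ha hle
    rcases eq_or_ne a w with rfl | hne
    · exact (hA' a).2 (Or.inl rfl)
    · obtain ⟨r, hr, rfl⟩ := List.mem_map.1 ((hR a).2 ⟨ha, hne⟩)
      have := abs_le.1 (hs r hr)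
      exact (hA' _).2 (Or.inr ⟨r, hr, by linarith, rfl⟩)
  · intro a ha
    rcases (hA' a).1 ha with rfl | ⟨r, hr, hthr, rfl⟩
    · simp
    · have := abs_le.1 (hs r hr)
      exact le_max_of_le_right (by linarith)

end Tournament

/-! ### One outer iteration -/

section Preprocess

variable {N : ℕ} {sol : P.Cell → Pt d} {A : Finset P.Cell} {L : List (Step d)}

lemma Preprocess.inCell (hN : 1 ≤ N) (h : P.Preprocess N A L sol) :
    (∀ j ∈ A, sol j ∈ P.cell j) ∧ (∀ s ∈ L, ∃ j, P.InCell j s) ∧ time L = A.card * N := by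
  obtain ⟨R, hnd, hR, hrun, rfl⟩ := h
  have hlen := length_eq_card_of_nodup hnd hR
  rw [List.length_map] at hlen
  refine ⟨?_, ?_, ?_⟩
  · intro j hj
    obtain ⟨r, hr, rfl⟩ := List.mem_map.1 ((hR j).2 hj)
    exact ((hrun r hr).inCell hN).1
  · intro s hs
    obtain ⟨r, hr, hsr⟩ := List.mem_flatMap.1 hs
    exact ⟨r.1, ((hrun r hr).inCell hN).2.1 s hsr⟩
  · rw [← hlen]
    clear hnd hR hlen
    induction R with
    | nil => simp [time_nil]
    | cons r R ih =>
      rw [List.flatMap_cons, time_append, ih fun r' hr' => hrun r' (by simp [hr']),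
        ((hrun r (by simp)).inCell hN).2.2, List.length_cons]
      ring

/-- The bound `E` may vary with the cell, so that the cell of the maximizer can receive a sharper
one than the others. -/
lemma Preprocess.bounds (h : P.Preprocess N A L sol) {E : P.Cell → ℝ} {c v : ℝ}
    (hE : ∀ j ∈ A, ∀ L', P.IterRun j N L' (sol j) → (∀ s ∈ L', P.Accurate f s) →
      v - f (sol j) ≤ E j ∧ loss f v L' ≤ c)
    (hacc : ∀ s ∈ L, P.Accurate f s) :
    (∀ j ∈ A, v - f (sol j) ≤ E j) ∧ loss f v L ≤ A.card * c := by
  obtain ⟨R, hnd, hR, hrun, rfl⟩ := h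
  have hlen := length_eq_card_of_nodup hnd hR
  rw [List.length_map] at hlen
  have hr : ∀ r ∈ R, v - f (sol r.1) ≤ E r.1 ∧ loss f v r.2 ≤ c := fun r hr =>
    hE r.1 ((hR _).1 (List.mem_map.2 ⟨r, hr, rfl⟩)) r.2 (hrun r hr)
      fun s hs => hacc s (List.mem_flatMap.2 ⟨r, hr, hs⟩)
  refine ⟨?_, ?_⟩
  · intro j hj
    obtain ⟨r, hrR, rfl⟩ := List.mem_map.1 ((hR j).2 hj)
    exact (hr r hrR).1
  · rw [← hlen]
    clear hnd hR hlen hrun hacc hE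
    induction R with
    | nil => simp [loss_nil]
    | cons r R ih =>
      rw [List.flatMap_cons, loss_append, List.length_cons]
      have h1 := ih fun r' hr' => hr r' (by simp [hr'])
      have h2 := (hr r (by simp)).2
      push_cast
      linarith

end Preprocess

section Phase

lemma eps_pos (ζ : ℕ) : 0 < eps ζ := by unfold eps; positivity

lemma eps_le_one (ζ : ℕ) : eps ζ ≤ 1 := pow_le_one₀ (by norm_num) (by norm_num)

lemma eps_succ (ζ : ℕ) : eps (ζ + 1) = eps ζ / 2 := by
  unfold eps
  rw [pow_succ]
  ring

lemma C₃_le_Nz_mul (ζ : ℕ) : P.C₃ ≤ P.Nz ζ * eps ζ ^ 2 := by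
  have h := eps_pos ζ
  rw [← div_le_iff₀ (by positivity)]
  exact Nat.le_ceil _

lemma Nz_mul_le (hC₃ : 1 ≤ P.C₃) (ζ : ℕ) : P.Nz ζ * eps ζ ^ 2 ≤ 2 * P.C₃ := by
  have h := eps_pos ζ
  have h1 := eps_le_one ζ
  have h2 : (P.Nz ζ : ℝ) < P.C₃ / eps ζ ^ 2 + 1 :=
    Nat.ceil_lt_add_one (div_nonneg (by linarith) (by positivity))
  have h3 : (P.C₃ / eps ζ ^ 2 + 1) * eps ζ ^ 2 = P.C₃ + eps ζ ^ 2 := by field_simp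
  have h4 : eps ζ ^ 2 ≤ 1 := pow_le_one₀ h.le h1
  have h5 := mul_le_mul_of_nonneg_right h2.le (sq_nonneg (eps ζ))
  linarith

lemma one_le_Nz (hC₃ : 1 ≤ P.C₃) (ζ : ℕ) : 1 ≤ P.Nz ζ := by
  have h := eps_pos ζ
  exact Nat.ceil_pos.2 (div_pos (by linarith) (by positivity))

/-- Geometric growth of `N_ζ` limits the number of outer iterations. -/
lemma four_pow_le_Nz (hC₃ : 1 ≤ P.C₃) (ζ : ℕ) : 4 ^ ζ ≤ P.Nz ζ := by
  have h1 := C₃_le_Nz_mul (P := P) ζ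
  have h2 : eps ζ ^ 2 * 4 ^ ζ = 1 := by
    unfold eps
    rw [← pow_mul, mul_comm ζ 2, pow_mul, ← mul_pow]
    norm_num
  have h3 : (0 : ℝ) < 4 ^ ζ := by positivity
  have : (4 : ℝ) ^ ζ ≤ P.Nz ζ := by
    have h4 := mul_le_mul_of_nonneg_right (hC₃.trans h1) h3.le
    rw [mul_assoc, h2] at h4
    linarith
  exact_mod_cast this

/-- Keeps `N_ζ ≤ 8 T` from one iteration to the next: if time remains after iteration `ζ`, then `N_ζ
≤ T`. -/
lemma Nz_succ_le (hC₃ : 1 ≤ P.C₃) (ζ : ℕ) : P.Nz (ζ + 1) ≤ 8 * P.Nz ζ := by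
  have h1 := Nz_mul_le hC₃ (ζ + 1)
  have h2 := C₃_le_Nz_mul (P := P) ζ
  rw [eps_succ] at h1
  have h3 : (0 : ℝ) < eps ζ ^ 2 := by have := eps_pos ζ; positivity
  have h4 : (P.Nz (ζ + 1) : ℝ) * eps ζ ^ 2 ≤ (8 * P.Nz ζ) * eps ζ ^ 2 := by
    nlinarith
  exact_mod_cast le_of_mul_le_mul_right h4 h3

variable {ζ : ℕ} {A A' : Finset P.Cell} {L : List (Step d)} {sol : P.Cell → Pt d}

lemma Compares.inCell {N : ℕ} (hN : 1 ≤ N) (h : P.Compares N sol A L)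
    (hsol : ∀ j ∈ A, sol j ∈ P.cell j) : ∀ s ∈ L, 0 < s.n ∧ s.x ∈ P.feas ∧ s.x' ∈ P.feas := by
  intro s hs
  obtain ⟨hn, j, hj, j', hj', hx, hx'⟩ := h s hs
  exact ⟨by omega, hx ▸ (hsol j hj).2, hx' ▸ (hsol j' hj').2⟩

lemma Phase.inCell (hC₃ : 1 ≤ P.C₃) (h : P.Phase ζ A L sol A') :
    A.Nonempty ∧ A' ⊆ A ∧ (∀ j ∈ A, sol j ∈ P.cell j) ∧
      (∀ s ∈ L, 0 < s.n ∧ s.x ∈ P.feas ∧ s.x' ∈ P.feas) ∧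
      A.card * P.Nz ζ ≤ time L ∧ time L ≤ 3 * (A.card * P.Nz ζ) := by
  obtain ⟨L₁, L₂, L₃, w, h1, h2, h3, rfl⟩ := h
  have hN := one_le_Nz hC₃ ζ
  obtain ⟨hsol, hs1, ht1⟩ := h1.inCell hN
  obtain ⟨hw, hl2, hc2⟩ := h2.card
  obtain ⟨hsub, -, hl3, hc3⟩ := h3.card hw
  have ht2 := time_eq_length_mul L₂ _ fun s hs => (hc2 s hs).1
  have ht3 := time_eq_length_mul L₃ _ fun s hs => (hc3 s hs).1
  have ht2' : time L₂ ≤ A.card * P.Nz ζ := by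
    rw [ht2]; exact Nat.mul_le_mul_right _ (by omega)
  have ht3' : time L₃ ≤ A.card * P.Nz ζ := by
    rw [ht3]; exact Nat.mul_le_mul_right _ (by omega)
  refine ⟨⟨w, hw⟩, hsub, hsol, ?_, ?_, ?_⟩
  · intro s hs
    rw [List.mem_append, List.mem_append] at hs
    rcases hs with (hs | hs) | hs
    · obtain ⟨j, hn, hx, hx'⟩ := hs1 s hs
      exact ⟨hn, hx.2, hx'.2⟩
    · exact hc2.inCell hN hsol s hs
    · exact hc3.inCell hN hsol s hs
  · rw [time_append, time_append]; omega
  · rw [time_append, time_append]; omega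

end Phase

end Params
namespace Params

variable {d : ℕ} {P : Params d} {f : Pt d → ℝ}

/-- The horizon is so large that the errors within an outer iteration are small compared with the
threshold of the elimination. -/
structure LongHorizon (P : Params d) (f : Pt d → ℝ) : Prop extends P.Regular f where
  one_le_C₃ : 1 ≤ P.C₃
  C₂'_nonneg : 0 ≤ P.C₂'
  error_le : ∀ ζ, P.errConst + 2 * P.errSlope / √(P.Nz ζ) ≤ (eps ζ + P.C₂') / 4
  noise_le : ∀ ζ, ∀ n ≤ P.J ^ d,
    ((Nat.clog 2 n : ℝ) + 1) * √(2 * P.C₁ / P.Nz ζ) ≤ eps ζ / 4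

/-- The suboptimality of the cells that are active in the outer iteration `ζ`. -/
noncomputable def gapBound (P : Params d) (ζ : ℕ) : ℝ := (4 + 4 * P.M) * (eps ζ + P.C₂')

/-- A bound of the loss of an outer iteration. -/
noncomputable def phaseBound (P : Params d) : ℝ :=
  48 * P.T * ((4 + 4 * P.M) * P.C₂' + P.errConst)
    + √(8 * (P.J : ℝ) ^ d * P.T) * (6 * (4 + 4 * P.M) * √(2 * P.C₃)
      + 12 * P.errSlope * (1 + Nat.log 2 (8 * P.T + 1)))

lemma card_le (A : Finset P.Cell) : A.card ≤ P.J ^ d := by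
  simpa using A.card_le_univ

/-- With at least two cells, `card ≤ 3 (card - 1)` and the test on the remaining time applies. With
one cell that test is void and the bound on `N_ζ` is used. -/
lemma card_mul_Nz_le {t ζ : ℕ} {A : Finset P.Cell}
    (hlong : 3 * (A.card - 1) * P.Nz ζ ≤ P.T - t) (hNT : P.Nz ζ ≤ 8 * P.T) :
    A.card * P.Nz ζ ≤ 8 * P.T := by
  rcases Nat.lt_or_ge A.card 2 with h | h
  · calc A.card * P.Nz ζ ≤ 1 * P.Nz ζ := Nat.mul_le_mul_right _ (by omega)
      _ ≤ _ := by omega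
  · calc A.card * P.Nz ζ ≤ 3 * (A.card - 1) * P.Nz ζ := Nat.mul_le_mul_right _ (by omega)
      _ ≤ _ := by omega

namespace LongHorizon

variable (hP : P.LongHorizon f)
include hP

lemma eps_le {ζ : ℕ} : eps ζ ≤ √(2 * P.C₃) / √(P.Nz ζ) := by
  have h1 := Nz_mul_le hP.one_le_C₃ ζ
  have hN : (0 : ℝ) < P.Nz ζ := by exact_mod_cast one_le_Nz hP.one_le_C₃ ζ
  rw [le_div_iff₀ (by positivity)]
  refine Real.le_sqrt_of_sq_le ?_
  rw [mul_pow, Real.sq_sqrt hN.le]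
  linarith

lemma phaseBound_nonneg : 0 ≤ P.phaseBound := by
  have h1 := hP.M_nonneg
  have h2 := hP.C₂'_nonneg
  have h3 := hP.toRegular.errConst_nonneg
  have h4 := hP.toRegular.errSlope_nonneg
  unfold phaseBound
  positivity

/-- `ε N` is of order `√C₃ √N`, and `c √N = √(c · c N) ≤ √(8 J ^ d T)`. Terms without `ε` or `√N`
are charged to the total time `c N ≤ 8 T`. -/
lemma loss_phase_le_phaseBound {ζ c : ℕ} (hc : c ≤ P.J ^ d) (hcN : c * P.Nz ζ ≤ 8 * P.T)
    (hNT : P.Nz ζ ≤ 8 * P.T) :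
    c * (6 * (P.gapBound ζ + P.errConst) * P.Nz ζ
      + 12 * P.errSlope * (1 + Nat.log 2 (P.Nz ζ + 1)) * √(P.Nz ζ)) ≤ P.phaseBound := by
  have hM := hP.M_nonneg
  have hC₂' := hP.C₂'_nonneg
  have hE := hP.toRegular.errConst_nonneg
  have hS := hP.toRegular.errSlope_nonneg
  have hN : (0 : ℝ) < P.Nz ζ := by exact_mod_cast one_le_Nz hP.one_le_C₃ ζ
  set N : ℝ := (P.Nz ζ : ℝ) with hNdef
  have hNN : √N * √N = N := Real.mul_self_sqrt hN.le
  have hlog : (Nat.log 2 (P.Nz ζ + 1) : ℝ) ≤ Nat.log 2 (8 * P.T + 1) := by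
    exact_mod_cast Nat.log_mono_right (by omega)
  have hcN' : (c : ℝ) * N ≤ 8 * P.T := by rw [hNdef]; exact_mod_cast hcN
  have hc' : (c : ℝ) ≤ (P.J : ℝ) ^ d := by exact_mod_cast hc
  have hcs : (c : ℝ) * √N ≤ √(8 * (P.J : ℝ) ^ d * P.T) := by
    refine Real.le_sqrt_of_sq_le ?_
    have : ((c : ℝ) * √N) ^ 2 = c * (c * N) := by
      linear_combination (c : ℝ) ^ 2 * hNN
    rw [this]
    calc (c : ℝ) * (c * N) ≤ (P.J : ℝ) ^ d * (8 * P.T) := by gcongr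
      _ = _ := by ring
  have heps : eps ζ * N ≤ √(2 * P.C₃) * √N := by
    have h1 := mul_le_mul_of_nonneg_right (hP.eps_le (ζ := ζ)) hN.le
    have h2 : √(2 * P.C₃) / √N * N = √(2 * P.C₃) * √N := by
      rw [div_mul_eq_mul_div, div_eq_iff (by positivity), mul_assoc, hNN]
    linarith
  calc c * (6 * (P.gapBound ζ + P.errConst) * N
      + 12 * P.errSlope * (1 + Nat.log 2 (P.Nz ζ + 1)) * √N)
      = c * (6 * (4 + 4 * P.M) * (eps ζ * N))
        + (c * N) * (6 * ((4 + 4 * P.M) * P.C₂' + P.errConst))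
        + (c * √N) * (12 * P.errSlope * (1 + Nat.log 2 (P.Nz ζ + 1))) := by
        unfold gapBound; ring
    _ ≤ c * (6 * (4 + 4 * P.M) * (√(2 * P.C₃) * √N))
        + (8 * P.T) * (6 * ((4 + 4 * P.M) * P.C₂' + P.errConst))
        + √(8 * (P.J : ℝ) ^ d * P.T) * (12 * P.errSlope * (1 + Nat.log 2 (8 * P.T + 1))) := by
        gcongr
    _ = (c * √N) * (6 * (4 + 4 * P.M) * √(2 * P.C₃))
        + (8 * P.T) * (6 * ((4 + 4 * P.M) * P.C₂' + P.errConst))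
        + √(8 * (P.J : ℝ) ^ d * P.T) * (12 * P.errSlope * (1 + Nat.log 2 (8 * P.T + 1))) := by
        ring
    _ ≤ √(8 * (P.J : ℝ) ^ d * P.T) * (6 * (4 + 4 * P.M) * √(2 * P.C₃))
        + (8 * P.T) * (6 * ((4 + 4 * P.M) * P.C₂' + P.errConst))
        + √(8 * (P.J : ℝ) ^ d * P.T) * (12 * P.errSlope * (1 + Nat.log 2 (8 * P.T + 1))) := by
        gcongr
    _ = P.phaseBound := by unfold phaseBound; ring

/-- The number `m` of remaining periods is bounded both by `T` and by `3 c N_ζ`; the geometric mean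
of the two bounds controls `m ε_ζ`. -/
lemma loss_commit_le_phaseBound {ζ c m : ℕ} (hc : c ≤ P.J ^ d) (hm : m ≤ P.T)
    (hmc : m ≤ 3 * c * P.Nz ζ) : m * (2 * P.gapBound ζ) ≤ P.phaseBound := by
  have hM := hP.M_nonneg
  have hC₂' := hP.C₂'_nonneg
  have hE := hP.toRegular.errConst_nonneg
  have hS := hP.toRegular.errSlope_nonneg
  have hm' : (m : ℝ) ≤ P.T := by exact_mod_cast hm
  have hmc' : (m : ℝ) ≤ 3 * c * P.Nz ζ := by exact_mod_cast hmc
  have hc' : (c : ℝ) ≤ (P.J : ℝ) ^ d := by exact_mod_cast hc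
  have h1 := Nz_mul_le hP.one_le_C₃ ζ
  have heps := eps_pos ζ
  have hC₃ := hP.one_le_C₃
  have h2 : (m : ℝ) * eps ζ ≤ √(8 * (P.J : ℝ) ^ d * P.T) * √(2 * P.C₃) := by
    rw [← Real.sqrt_mul (by positivity)]
    refine Real.le_sqrt_of_sq_le ?_
    calc ((m : ℝ) * eps ζ) ^ 2 = m * (m * eps ζ ^ 2) := by ring
      _ ≤ P.T * (3 * c * P.Nz ζ * eps ζ ^ 2) := by gcongr
      _ = P.T * (3 * c * (P.Nz ζ * eps ζ ^ 2)) := by ring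
      _ ≤ P.T * (8 * (P.J : ℝ) ^ d * (2 * P.C₃)) := by gcongr; norm_num
      _ = _ := by ring
  have h3 : 0 ≤ √(8 * (P.J : ℝ) ^ d * P.T) * (12 * P.errSlope *
      (1 + Nat.log 2 (8 * P.T + 1))) := by positivity
  have h4 : 0 ≤ 48 * P.T * P.errConst := by positivity
  have h5 : (m : ℝ) * (2 * (4 + 4 * P.M) * P.C₂') ≤ P.T * (48 * (4 + 4 * P.M) * P.C₂') := by
    gcongr; norm_num
  have h6 : (2 * (4 + 4 * P.M)) * (m * eps ζ)
      ≤ (6 * (4 + 4 * P.M)) * (√(8 * (P.J : ℝ) ^ d * P.T) * √(2 * P.C₃)) := by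
    gcongr; norm_num
  unfold gapBound phaseBound
  linarith

/-- The analysis of one outer iteration with accurate answers. -/
lemma phase_bounds {ζ : ℕ} {A A' : Finset P.Cell} {L : List (Step d)} {sol : P.Cell → Pt d}
    (h : P.Phase ζ A L sol A') (hacc : ∀ s ∈ L, P.Accurate f s) (hNT : P.Nz ζ ≤ 8 * P.T)
    {xstar : Pt d} (hmax : ∀ x ∈ P.feas, f x ≤ f xstar) {jstar : P.Cell}
    (hxstar : xstar ∈ P.cell jstar) (hjstar : jstar ∈ A)
    (hgap : ∀ j ∈ A, ∃ z ∈ P.cell j, f xstar - f z ≤ P.gapBound ζ) :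
    jstar ∈ A' ∧ (∀ j ∈ A', f xstar - f (sol j) ≤ P.gapBound (ζ + 1)) ∧
      loss f (f xstar) L ≤ A.card * (6 * (P.gapBound ζ + P.errConst) * P.Nz ζ
        + 12 * P.errSlope * (1 + Nat.log 2 (P.Nz ζ + 1)) * √(P.Nz ζ)) := by
  have hM := hP.M_nonneg
  have hC₂' := hP.C₂'_nonneg
  have hEC := hP.toRegular.errConst_nonneg
  have hS := hP.toRegular.errSlope_nonneg
  have hN1 := one_le_Nz hP.one_le_C₃ ζ
  have hε := eps_pos ζ
  obtain ⟨-, hsub, hsol, -, -, -⟩ := h.inCell hP.one_le_C₃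
  obtain ⟨L₁, L₂, L₃, w, hpre, htour, helim, rfl⟩ := h
  have hacc1 : ∀ s ∈ L₁, P.Accurate f s := fun s hs => hacc s (by simp [hs])
  have hacc2 : ∀ s ∈ L₂, P.Accurate f s := fun s hs => hacc s (by simp [hs])
  have hacc3 : ∀ s ∈ L₃, P.Accurate f s := fun s hs => hacc s (by simp [hs])
  set e := P.errConst + 2 * P.errSlope / √(P.Nz ζ) with he
  have he4 : e ≤ (eps ζ + P.C₂') / 4 := hP.error_le ζ
  set lg : ℝ := (Nat.log 2 (P.Nz ζ + 1) : ℝ) with hlg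
  have hlg0 : 0 ≤ lg := Nat.cast_nonneg _
  set N : ℝ := (P.Nz ζ : ℝ) with hN
  have hN0 : 0 < N := by rw [hN]; exact_mod_cast hN1
  have hNN : √N * √N = N := Real.mul_self_sqrt hN0.le
  obtain ⟨herr, hloss1⟩ := hpre.bounds (f := f) (v := f xstar)
    (E := fun _ => P.gapBound ζ + e)
    (c := 2 * P.errConst * N + 4 * P.errSlope * (1 + lg) * √N + 2 * P.gapBound ζ * N)
    (fun j hj L' hL' hacc' => by
      obtain ⟨z, hz, hzg⟩ := hgap j hj
      obtain ⟨b1, b2⟩ := hP.toRegular.iterRun_bounds hN1 hNT hL' hacc' hz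
      refine ⟨by linarith, ?_⟩
      rw [loss_eq_loss_add f (f xstar) (f z), (hL'.inCell hN1).2.2]
      have := mul_le_mul_of_nonneg_right hzg hN0.le
      linarith) hacc1
  -- In the cell of the maximizer the comparison point is `xstar` itself, so the inherited gap
  -- disappears from the error.
  have hstar : f xstar - f (sol jstar) ≤ e := by
    refine (hpre.bounds (f := f) (v := f xstar)
      (E := fun j => if j = jstar then e else P.gapBound ζ + e)
      (c := 2 * P.errConst * N + 4 * P.errSlope * (1 + lg) * √N + 2 * P.gapBound ζ * N)
      (fun j hj L' hL' hacc' => ?_) hacc1).1 jstar hjstar |>.trans (by simp)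
    obtain ⟨z, hz, hzg⟩ := hgap j hj
    obtain ⟨b1, b2⟩ := hP.toRegular.iterRun_bounds hN1 hNT hL' hacc' hz
    refine ⟨?_, ?_⟩
    · split_ifs with hjj
      · subst hjj
        exact (hP.toRegular.iterRun_bounds hN1 hNT hL' hacc' hxstar).1
      · linarith
    · rw [loss_eq_loss_add f (f xstar) (f z), (hL'.inCell hN1).2.2]
      have := mul_le_mul_of_nonneg_right hzg hN0.le
      linarith
  set r := √(2 * P.C₁ / N) with hr
  have hr0 : 0 ≤ r := Real.sqrt_nonneg _
  have hnoise := hP.noise_le ζ A.card (card_le A)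
  rw [add_mul, one_mul] at hnoise
  have hwin := htour.le_winner hacc2 hjstar
  obtain ⟨hw, hl2, hc2⟩ := htour.card
  obtain ⟨-, -, hl3, hc3⟩ := helim.card hw
  obtain ⟨hkeep, hleft⟩ := helim.mem (f := f) hacc3
  have hclog : 0 ≤ (Nat.clog 2 A.card : ℝ) * r := by positivity
  refine ⟨?_, ?_, ?_⟩
  -- No winner exceeds `f xstar`, so the measured deficit of this cell is at most `e` plus noise,
  -- well below the threshold.
  · refine hkeep jstar hjstar ?_
    have := hmax _ (hsol w hw).2
    linarith
  · intro j hj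
    have h1 := hleft j hj
    rw [max_eq_right (by positivity)] at h1
    -- The gap is the sum of the error in the cell of the maximizer, the loss over the tournament
    -- rounds, the threshold, and one more noise term.
    have h2 : f xstar - f (sol j) ≤ 2 * (eps ζ + P.C₂') := by linarith
    refine h2.trans ?_
    unfold gapBound
    rw [eps_succ]
    nlinarith [mul_nonneg hM (add_nonneg (half_pos hε).le hC₂')]
  · have hcmp : ∀ L', P.Compares (P.Nz ζ) sol A L' → L'.length ≤ A.card →
        loss f (f xstar) L' ≤ A.card * (2 * (P.gapBound ζ + e) * N) := by
      intro L' hL' hlen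
      have h1 := loss_le_of_forall f (f xstar) (c := 2 * (P.gapBound ζ + e)) L' fun s hs => by
        obtain ⟨-, j, hj, j', hj', hx, hx'⟩ := hL' s hs
        have h1 := herr j hj
        have h2 := herr j' hj'
        rw [hx, hx']
        linarith
      rw [time_eq_length_mul L' _ fun s hs => (hL' s hs).1] at h1
      have h2 : 0 ≤ P.gapBound ζ + e := by unfold gapBound; positivity
      have h3 : (L'.length : ℝ) ≤ A.card := by exact_mod_cast hlen
      push_cast at h1
      have h4 := mul_le_mul_of_nonneg_right h3 (show 0 ≤ 2 * (P.gapBound ζ + e) * N by positivity)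
      linarith
    have h2 := hcmp L₂ hc2 (by omega)
    have h3 := hcmp L₃ hc3 (by omega)
    have heN : e * N = P.errConst * N + 2 * P.errSlope * √N := by
      rw [he, add_mul]
      congr 1
      rw [div_mul_eq_mul_div, div_eq_iff (by positivity), mul_assoc _ √N, hNN]
    rw [loss_append, loss_append]
    have h4 : 2 * P.errConst * N + 4 * P.errSlope * (1 + lg) * √N + 2 * P.gapBound ζ * N
        + 2 * (2 * (P.gapBound ζ + e) * N)
        ≤ 6 * (P.gapBound ζ + P.errConst) * N + 12 * P.errSlope * (1 + lg) * √N := by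
      have h5 : 0 ≤ P.errSlope * lg * √N := by positivity
      have h6 : 2 * (2 * (P.gapBound ζ + e) * N)
        = 4 * P.gapBound ζ * N + 4 * (e * N) := by ring
      rw [h6, heN]
      linarith
    have h7 := mul_le_mul_of_nonneg_left h4 (Nat.cast_nonneg (α := ℝ) A.card)
    linarith

end LongHorizon

/-! ### The main loop -/

/-- The last iteration starts before time `T` and lasts at most `3 · 8 T` periods even when listed
in full, hence `25 T`. This also bounds the number of queries. -/
lemma MainRun.feasible (hC₃ : 1 ≤ P.C₃) {t ζ : ℕ} {A : Finset P.Cell}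
    {prev : Option (P.Cell → Pt d)} {L : List (Step d)} (h : P.MainRun t ζ A prev L)
    (hprev : ∀ sol, prev = some sol → ∀ j ∈ A, sol j ∈ P.cell j)
    (hNT : t < P.T → P.Nz ζ ≤ 8 * P.T) :
    (∀ s ∈ L, 0 < s.n ∧ s.x ∈ P.feas ∧ s.x' ∈ P.feas) ∧ P.T ≤ t + time L ∧
      t + time L ≤ max t (25 * P.T) := by
  induction h with
  | done t ζ A prev ht => exact ⟨by simp, by simpa [time_nil] using ht, by simp [time_nil]⟩
  | commitFirst t ζ A j x x' y ht hshort hj hx hx' =>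
    refine ⟨?_, ?_, ?_⟩
    · intro s hs
      rw [List.mem_singleton] at hs
      subst hs
      exact ⟨by show 0 < P.T - t; omega, hx.2, hx'.2⟩
    · rw [time_cons, time_nil]; dsimp only; omega
    · rw [time_cons, time_nil]; dsimp only; omega
  | commit t ζ A sol j y ht hshort hj =>
    have hsol := hprev sol rfl j hj
    refine ⟨?_, ?_, ?_⟩
    · intro s hs
      rw [List.mem_singleton] at hs
      subst hs
      exact ⟨by show 0 < P.T - t; omega, hsol.2, hsol.2⟩
    · rw [time_cons, time_nil]; dsimp only; omega
    · rw [time_cons, time_nil]; dsimp only; omega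
  | phase t ζ A A' prev sol L L' ht hlong hphase hrest ih =>
    obtain ⟨hne, hsub, hsol, hfeas, hlo, hhi⟩ := hphase.inCell hC₃
    have hcN := card_mul_Nz_le hlong (hNT ht)
    have hpos : 0 < A.card := hne.card_pos
    have hN : P.Nz ζ ≤ time L := (Nat.le_mul_of_pos_left _ hpos).trans hlo
    have h8 := Nz_succ_le hC₃ ζ
    obtain ⟨h1, h2, h3⟩ := ih (fun sol' hs j hj => by
      cases hs
      exact hsol j (hsub hj)) (fun ht' => by omega)
    refine ⟨?_, by rw [time_append]; omega, by rw [time_append]; omega⟩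
    intro s hs
    rcases List.mem_append.1 hs with hs | hs
    · exact hfeas s hs
    · exact h1 s hs

namespace LongHorizon

variable (hP : P.LongHorizon f)
include hP

/-- Each iteration and the final commitment is charged one `phaseBound`; `4 ^ ζ ≤ N_ζ ≤ 8 T` bounds
how many can follow. Before the first iteration every point of an active cell has a controlled gap,
afterwards only the solution found there. -/
lemma loss_mainRun_le {t ζ : ℕ} {A : Finset P.Cell}
    {prev : Option (P.Cell → Pt d)} {L : List (Step d)} (h : P.MainRun t ζ A prev L)
    (hacc : ∀ s ∈ L, P.Accurate f s) (hNT : t < P.T → P.Nz ζ ≤ 8 * P.T)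
    {xstar : Pt d} (hmax : ∀ x ∈ P.feas, f x ≤ f xstar) {jstar : P.Cell}
    (hxstar : xstar ∈ P.cell jstar) (hjstar : jstar ∈ A)
    (hnone : prev = none → ∀ j ∈ A, (P.cell j).Nonempty ∧
      ∀ x ∈ P.cell j, f xstar - f x ≤ P.gapBound ζ)
    (hsome : ∀ sol, prev = some sol → ∀ j ∈ A, sol j ∈ P.cell j ∧
      f xstar - f (sol j) ≤ P.gapBound ζ) :
    loss f (f xstar) L ≤ ((Nat.log 4 (8 * P.T) + 1 - ζ : ℕ) : ℝ) * P.phaseBound := by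
  have hB := hP.phaseBound_nonneg
  have hζ : ∀ {ζ}, P.Nz ζ ≤ 8 * P.T → ζ ≤ Nat.log 4 (8 * P.T) := fun {ζ} h =>
    Nat.le_log_of_pow_le (by norm_num) ((four_pow_le_Nz hP.one_le_C₃ ζ).trans h)
  have hone : ∀ {ζ}, P.Nz ζ ≤ 8 * P.T → P.phaseBound
      ≤ ((Nat.log 4 (8 * P.T) + 1 - ζ : ℕ) : ℝ) * P.phaseBound := fun {ζ} h => by
    have h1 : 1 ≤ Nat.log 4 (8 * P.T) + 1 - ζ := by have := hζ h; omega
    have h2 : (1 : ℝ) ≤ ((Nat.log 4 (8 * P.T) + 1 - ζ : ℕ) : ℝ) := by exact_mod_cast h1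
    nlinarith
  induction h with
  | done t ζ A prev ht => rw [loss_nil]; positivity
  | commitFirst t ζ A j x x' y ht hshort hj hx hx' =>
    refine le_trans ?_ (hone (hNT ht))
    rw [loss_cons, loss_nil, add_zero]
    refine le_trans ?_ (hP.loss_commit_le_phaseBound (ζ := ζ) (c := A.card) (m := P.T - t)
      (card_le A) (by omega) (hshort.le.trans (Nat.mul_le_mul_right _ (by omega))))
    refine mul_le_mul_of_nonneg_left ?_ (Nat.cast_nonneg _)
    have h1 := (hnone rfl j hj).2 x hx
    have h2 := (hnone rfl j hj).2 x' hx'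
    dsimp only
    linarith
  | commit t ζ A sol j y ht hshort hj =>
    refine le_trans ?_ (hone (hNT ht))
    rw [loss_cons, loss_nil, add_zero]
    refine le_trans ?_ (hP.loss_commit_le_phaseBound (ζ := ζ) (c := A.card) (m := P.T - t)
      (card_le A) (by omega) (hshort.le.trans (Nat.mul_le_mul_right _ (by omega))))
    refine mul_le_mul_of_nonneg_left ?_ (Nat.cast_nonneg _)
    have h1 := (hsome sol rfl j hj).2
    dsimp only
    linarith
  | phase t ζ A A' prev sol L L' ht hlong hphase hrest ih =>
    obtain ⟨hne, hsub, hsol, -, hlo, -⟩ := hphase.inCell hP.one_le_C₃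
    have hN := hNT ht
    have hcN := card_mul_Nz_le hlong hN
    have hNL : P.Nz ζ ≤ time L := (Nat.le_mul_of_pos_left _ hne.card_pos).trans hlo
    have h8 := Nz_succ_le hP.one_le_C₃ ζ
    have hgap : ∀ j ∈ A, ∃ z ∈ P.cell j, f xstar - f z ≤ P.gapBound ζ := by
      intro j hj
      cases prev with
      | none =>
        obtain ⟨⟨z, hz⟩, h⟩ := hnone rfl j hj
        exact ⟨z, hz, h z hz⟩
      | some sol' => exact ⟨sol' j, (hsome sol' rfl j hj).1, (hsome sol' rfl j hj).2⟩
    obtain ⟨h1, h2, h3⟩ := hP.phase_bounds hphase (fun s hs => hacc s (by simp [hs])) hN hmax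
      hxstar hjstar hgap
    have h4 := h3.trans (hP.loss_phase_le_phaseBound (card_le A) hcN hN)
    have h5 := ih (fun s hs => hacc s (by simp [hs])) (fun ht' => by omega) h1 (by simp)
      (fun sol' hs j hj => by
        cases hs
        exact ⟨hsol j (hsub hj), h2 j hj⟩)
    have h6 : Nat.log 4 (8 * P.T) + 1 - ζ = (Nat.log 4 (8 * P.T) + 1 - (ζ + 1)) + 1 := by
      have := hζ hN
      omega
    rw [loss_append, h6, Nat.cast_add, Nat.cast_one, add_mul, one_mul]
    linarith

/-- The loss of a run of the algorithm with accurate answers. -/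
lemma loss_isRun_le {L : List (Step d)} (h : P.IsRun L) (hacc : ∀ s ∈ L, P.Accurate f s)
    (hNT : P.Nz 1 ≤ 8 * P.T) {xstar : Pt d} (hmax : ∀ x ∈ P.feas, f x ≤ f xstar)
    (hlow : ∀ x ∈ P.feas, f xstar - f x ≤ 2 * P.M) {jstar : P.Cell}
    (hxstar : xstar ∈ P.cell jstar) :
    loss f (f xstar) L ≤ (Nat.log 4 (8 * P.T) : ℝ) * P.phaseBound := by
  obtain ⟨A, hA, hrun⟩ := h
  have hM := hP.M_nonneg
  have hC := hP.C₂'_nonneg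
  -- The term `4 M` in the factor of `gapBound` serves this start: at `ε₁ = 1 / 2` it covers the
  -- trivial gap `2 M`.
  have hgap : 2 * P.M ≤ P.gapBound 1 := by
    unfold gapBound eps
    nlinarith [mul_nonneg hM hC]
  simpa using hP.loss_mainRun_le hrun hacc (fun _ => hNT) hmax hxstar
    ((hA jstar).2 ⟨xstar, hxstar⟩)
    (fun _ j hj => ⟨(hA j).1 hj, fun x hx => (hlow x hx.2).trans hgap⟩) (by simp)

end LongHorizon

lemma IsRun.feasible (hC₃ : 1 ≤ P.C₃) (hNT : P.Nz 1 ≤ 8 * P.T) {L : List (Step d)}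
    (h : P.IsRun L) :
    (∀ s ∈ L, 0 < s.n ∧ s.x ∈ P.feas ∧ s.x' ∈ P.feas) ∧ P.T ≤ time L ∧ time L ≤ 25 * P.T := by
  obtain ⟨A, -, hrun⟩ := h
  simpa using hrun.feasible hC₃ (by simp) fun _ => hNT

end Params

/-! ### Local behaviour of a smooth function on the grid cells. -/

lemma Holder.of_le {d : ℕ} {X : Set (Pt d)} {k l : ℕ} {M : ℝ} {f : Pt d → ℝ}
    (hf : Holder X k M f) (hl : l ≤ k) : Holder X l M f :=
  ⟨hf.1.of_le (by exact_mod_cast hl), fun m hm => hf.2 m (hm.trans hl)⟩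

lemma Holder.abs_le {d : ℕ} {X : Set (Pt d)} {k : ℕ} {M : ℝ} {f : Pt d → ℝ}
    (hf : Holder X k M f) {x : Pt d} (hx : x ∈ X) : |f x| ≤ M := by
  simpa using hf.2 0 (Nat.zero_le _) Fin.elim0 x hx

/-- The mean value inequality for the sup norm. -/
lemma Holder.abs_sub_le {d : ℕ} {X : Set (Pt d)} {k : ℕ} {M : ℝ} {f : Pt d → ℝ}
    (hk : 1 ≤ k) (hX : Convex ℝ X) (hU : UniqueDiffOn ℝ X) (hM : 0 ≤ M) (hf : Holder X k M f)
    {x z : Pt d} (hx : x ∈ X) (hz : z ∈ X) {r : ℝ} (hr0 : 0 ≤ r) (hr : ∀ a, |z a - x a| ≤ r) :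
    |f z - f x| ≤ d * (r * M) := by
  -- At order `1` the polynomial is constant, and evaluation at `x` with `r = 0` identifies it as `f
  -- x`.
  obtain ⟨θ, -, hθ⟩ := exists_taylor_coeff le_rfl hX hU hM (hf.of_le hk) hx
  have h1 := hθ z hz r hr0 hr
  have h2 := hθ x hx 0 le_rfl (by simp)
  have hα : ∀ (α : MIdx 1 d) (u : Pt d), ∏ a, (u a - x a) ^ (α.1 a : ℕ) = 1 := fun α u =>
    Finset.prod_eq_one fun a _ => by rw [Fin.val_eq_zero (α.1 a), pow_zero]
  simp only [hα, pow_one, mul_one, zero_mul, mul_zero] at h1 h2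
  have h3 : f x = ∑ α, θ α := by
    have := abs_nonpos_iff.1 h2
    linarith
  rw [h3]
  exact h1

section Cells

variable {d : ℕ} {X : Set (Pt d)} {f : Pt d → ℝ}

lemma abs_sub_le_of_mem_cell {P : Params d} {j : P.Cell} {x z : Pt d} (hx : x ∈ P.cell j)
    (hz : z ∈ P.cell j) (a : Fin d) : |x a - z a| ≤ 1 / P.J := by
  have h1 := hx.1 a
  have h2 := hz.1 a
  rw [add_div] at h1 h2
  rw [abs_le]
  constructor <;> linarith

lemma abs_feature_le {P : Params d} {j : P.Cell} (hJ : 2 ≤ P.J) {x : Pt d}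
    (hx : x ∈ P.cell j) (hc : P.center j ∈ P.cell j) (α : MIdx P.k d)
    (hα : ∑ a, (α.1 a : ℕ) ≠ 0) : |P.feature j x α| ≤ 1 / 2 := by
  have hJ' : (2 : ℝ) ≤ P.J := by exact_mod_cast hJ
  have h0 : (0 : ℝ) ≤ 1 / P.J := by positivity
  have h2 : (1 : ℝ) / P.J ≤ 1 / 2 := one_div_le_one_div_of_le (by norm_num) hJ'
  unfold Params.feature
  rw [Finset.abs_prod]
  calc ∏ a, |(x a - P.center j a) ^ (α.1 a : ℕ)| ≤ ∏ a, (1 / (P.J : ℝ)) ^ (α.1 a : ℕ) := by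
        refine Finset.prod_le_prod (fun _ _ => abs_nonneg _) fun a _ => ?_
        rw [abs_pow]
        exact pow_le_pow_left₀ (abs_nonneg _) (abs_sub_le_of_mem_cell hx hc a) _
    _ = (1 / (P.J : ℝ)) ^ ∑ a, (α.1 a : ℕ) := Finset.prod_pow_eq_pow_sum _ _ _
    _ ≤ 1 / (P.J : ℝ) := pow_le_of_le_one h0 (by linarith) hα
    _ ≤ 1 / 2 := h2

/-- The constant monomial cancels in the difference; every other monomial is at most `1 / J ≤ 1 /
2`. -/
lemma abs_featDiff_le {P : Params d} {j : P.Cell} (hJ : 2 ≤ P.J) {x z : Pt d}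
    (hx : x ∈ P.cell j) (hz : z ∈ P.cell j) (hc : P.center j ∈ P.cell j) (α : MIdx P.k d) :
    |P.featDiff j x z α| ≤ 1 := by
  unfold Params.featDiff
  rw [Pi.sub_apply]
  by_cases hα : ∑ a, (α.1 a : ℕ) = 0
  · have h0 : ∀ a, (α.1 a : ℕ) = 0 := fun a =>
      (Finset.sum_eq_zero_iff.1 hα) a (Finset.mem_univ a)
    simp [Params.feature, h0]
  · have h1 := abs_feature_le hJ hx hc α hα
    have h2 := abs_feature_le hJ hz hc α hα
    refine (abs_sub _ _).trans ?_
    linarith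

/-- Taylor expansion at the center of the cell. The condition `d ≤ J` is what brings the oscillation
`d M / J` below `M`. -/
lemma isLinearizable_of_holder {P : Params d} (hk : 1 ≤ P.k) (hM : 0 ≤ P.M) (hX : Convex ℝ X)
    (hU : UniqueDiffOn ℝ X) (hf : Holder X P.k P.M f) (hfeas : P.feas ⊆ X) (hJ : 2 ≤ P.J)
    (hJd : d ≤ P.J) (hC₂ : P.C₂ = ((d : ℝ) + P.k) ^ P.k * P.M / (P.J : ℝ) ^ P.k)
    (hcenter : ∀ j, (P.cell j).Nonempty → P.center j ∈ P.cell j) (j : P.Cell) :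
    P.IsLinearizable f j := by
  have hJ0 : (0 : ℝ) < P.J := by exact_mod_cast (by omega : 0 < P.J)
  have hmem : ∀ x ∈ P.cell j, x ∈ X := fun x hx => hfeas hx.2
  rcases (P.cell j).eq_empty_or_nonempty with hemp | hne
  · exact ⟨⟨0, fun α => by simpa using hM, fun x hx => by simp [hemp] at hx⟩,
      fun x hx => by simp [hemp] at hx, fun x hx => by simp [hemp] at hx⟩
  have hc : P.center j ∈ P.cell j := hcenter j hne
  refine ⟨?_, ?_, ?_⟩
  · obtain ⟨θ, hθM, hθ⟩ := exists_taylor_coeff hk hX hU hM hf (hmem _ hc)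
    refine ⟨θ, hθM, fun x hx => ?_⟩
    refine (hθ x (hmem x hx) (1 / P.J) (by positivity)
      fun a => abs_sub_le_of_mem_cell hx hc a).trans ?_
    have : (d : ℝ) ^ P.k * ((1 / (P.J : ℝ)) ^ P.k * P.M)
      = (d : ℝ) ^ P.k * P.M / (P.J : ℝ) ^ P.k := by
      rw [one_div, inv_pow]; ring
    rw [hC₂, this]
    gcongr
    simp
  · intro x hx z hz
    refine (le_abs_self _).trans ((hf.abs_sub_le hk hX hU hM (hmem x hx) (hmem z hz)
      (r := 1 / P.J) (by positivity) fun a => abs_sub_le_of_mem_cell hz hx a).trans ?_)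
    have hd : (d : ℝ) ≤ P.J := by exact_mod_cast hJd
    have h1 : (d : ℝ) * (1 / P.J) ≤ 1 := by
      rw [mul_one_div, div_le_one hJ0]; exact hd
    rw [← mul_assoc]
    nlinarith
  · intro x hx z hz α
    exact abs_featDiff_le hJ hx hz hc α

lemma exists_mem_cell {P : Params d} (hJ : 1 ≤ P.J) {x : Pt d} (hx : x ∈ Set.Icc (0 : Pt d) 1)
    (hfeas : x ∈ P.feas) : ∃ j, x ∈ P.cell j := by
  have hJ0 : (0 : ℝ) < P.J := by exact_mod_cast hJ
  -- The minimum with `J - 1` puts the coordinate `1` into the last cube.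
  refine ⟨fun i => ⟨min ⌊x i * P.J⌋₊ (P.J - 1), by omega⟩, fun i => ?_, hfeas⟩
  have h0 : 0 ≤ x i := hx.1 i
  have h1 : x i ≤ 1 := hx.2 i
  have h2 : 0 ≤ x i * P.J := by positivity
  rw [div_le_iff₀ hJ0, le_div_iff₀ hJ0]
  constructor
  · refine le_trans ?_ (Nat.floor_le h2)
    exact_mod_cast min_le_left _ _
  · show x i * P.J ≤ ((min ⌊x i * P.J⌋₊ (P.J - 1) : ℕ) : ℝ) + 1
    rcases min_cases ⌊x i * (P.J : ℝ)⌋₊ (P.J - 1) with ⟨h, -⟩ | ⟨h, -⟩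
    · rw [h]
      exact (Nat.lt_floor_add_one _).le
    · rw [h, Nat.cast_sub hJ]
      push_cast
      nlinarith

end Cells


variable {d : ℕ}

/-! ### Regret and loss -/

lemma loss_transcript (f : Pt d → ℝ) (v : ℝ) (q : ℕ → Query d) (y : ℕ → ℝ) (m : ℕ) :
    loss f v (transcript q y m)
      = ∑ i ∈ Finset.range m, ((q i).1 : ℝ) * (2 * v - f (q i).2.1 - f (q i).2.2) := by
  induction m with
  | zero => simp [transcript, loss]
  | succ m ih =>
    rw [Finset.sum_range_succ, ← ih, transcript, List.range_succ, List.map_append, loss_append]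
    simp [loss, transcript]

lemma time_transcript (q : ℕ → Query d) (y : ℕ → ℝ) (m : ℕ) :
    time (transcript q y m) = ∑ i ∈ Finset.range m, (q i).1 := by
  induction m with
  | zero => simp [transcript, time]
  | succ m ih =>
    rw [Finset.sum_range_succ, ← ih, transcript, List.range_succ, List.map_append,
      Params.time_append]
    simp [time, transcript]

lemma sum_periods (T : ℕ) (q : ℕ → Query d) (t : ℕ) :
    ∑ τ ∈ Finset.range t, periods T q τ = min T (∑ i ∈ Finset.range t, (q i).1) := by
  induction t with
  | zero => simp
  | succ t ih =>
    rw [Finset.sum_range_succ, ih, Finset.sum_range_succ, periods]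
    omega

/-- If the queries before `m` are feasible and cover the horizon, the regret is at most the sum of
their losses. -/
lemma regret_le_sum {f ψ : Pt d → ℝ} {v : ℝ} {T m : ℕ} (hT : 0 < T) {q : ℕ → Query d}
    {Z : Set (Pt d)} (hZ : Convex ℝ Z) (hne : Z.Nonempty) (hψ : ∀ x ∈ Z, ψ x = 0)
    (hq : ∀ i < m, 0 < (q i).1 ∧ (q i).2.1 ∈ Z ∧ (q i).2.2 ∈ Z)
    (hv : ∀ x ∈ Z, f x ≤ v) (hm : T ≤ ∑ i ∈ Finset.range m, (q i).1) :
    regret f v ψ T q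
      ≤ ∑ i ∈ Finset.range m, ((q i).1 : ℝ) * (2 * v - f (q i).2.1 - f (q i).2.2) := by
  have hT' : (0 : ℝ) < T := by exact_mod_cast hT
  have hzero : ∀ τ, m ≤ τ → periods T q τ = 0 := by
    intro τ hτ
    have : ∑ i ∈ Finset.range m, (q i).1 ≤ ∑ i ∈ Finset.range τ, (q i).1 :=
      Finset.sum_le_sum_of_subset (Finset.range_mono hτ)
    rw [periods]
    omega
  have hcover : T ≤ ∑ i ∈ Finset.range T, (q i).1 := by
    rcases le_total m T with h | h
    · exact hm.trans (Finset.sum_le_sum_of_subset (Finset.range_mono h))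
    · calc T = ∑ _i ∈ Finset.range T, 1 := by simp
        _ ≤ _ := Finset.sum_le_sum fun i hi =>
          (hq i ((Finset.mem_range.1 hi).trans_le h)).1
  have hsum : ∑ τ ∈ Finset.range T, (periods T q τ : ℝ) = T := by
    have := sum_periods T q T
    rw [min_eq_left hcover] at this
    exact_mod_cast this
  obtain ⟨z₀, hz₀⟩ := hne
  have hpen : ψ ((1 / (2 * (T : ℝ))) •
      ∑ τ ∈ Finset.range T, (periods T q τ : ℝ) • ((q τ).2.1 + (q τ).2.2)) = 0 := by
    refine hψ _ ?_
    -- The averaged solution is a convex combination of points of `Z`. Queries from `m` on could lie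
    -- outside, but have weight `0` and are replaced by `z₀`.
    have hmem := hZ.sum_mem (t := Finset.range T) (w := fun τ => (periods T q τ : ℝ) / T)
      (z := fun τ => if τ < m then (1 / 2 : ℝ) • (q τ).2.1 + (1 / 2 : ℝ) • (q τ).2.2 else z₀)
      (fun τ _ => by positivity) (by rw [← Finset.sum_div, hsum, div_self hT'.ne'])
      (fun τ _ => by
        split_ifs with h
        · exact hZ (hq τ h).2.1 (hq τ h).2.2 (by norm_num) (by norm_num) (by norm_num)
        · exact hz₀)
    convert hmem using 1
    rw [Finset.smul_sum]
    refine Finset.sum_congr rfl fun τ _ => ?_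
    split_ifs with h
    · rw [smul_smul, ← smul_add, smul_smul]
      congr 1
      field_simp
    · rw [hzero τ (not_lt.1 h)]
      simp
  have hnn : ∀ i < m, 0 ≤ 2 * v - f (q i).2.1 - f (q i).2.2 := fun i hi => by
    have h1 := hv _ (hq i hi).2.1
    have h2 := hv _ (hq i hi).2.2
    linarith
  rw [regret, hpen, mul_zero, add_zero]
  calc ∑ τ ∈ Finset.range T, (periods T q τ : ℝ) * (2 * v - f (q τ).2.1 - f (q τ).2.2)
      = ∑ τ ∈ (Finset.range T).filter (· < m),
          (periods T q τ : ℝ) * (2 * v - f (q τ).2.1 - f (q τ).2.2) := by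
        refine (Finset.sum_filter_of_ne fun τ _ h => ?_).symm
        by_contra hlt
        rw [hzero τ (not_lt.1 hlt)] at h
        simp at h
    _ ≤ ∑ τ ∈ (Finset.range T).filter (· < m),
          ((q τ).1 : ℝ) * (2 * v - f (q τ).2.1 - f (q τ).2.2) := by
        refine Finset.sum_le_sum fun τ hτ => ?_
        refine mul_le_mul_of_nonneg_right ?_ (hnn τ (Finset.mem_filter.1 hτ).2)
        exact_mod_cast min_le_left _ _
    _ ≤ _ := by
        refine Finset.sum_le_sum_of_subset_of_nonneg
          (fun τ hτ => Finset.mem_range.2 (Finset.mem_filter.1 hτ).2) fun τ hτ _ => ?_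
        exact mul_nonneg (Nat.cast_nonneg _) (hnn τ (Finset.mem_range.1 hτ))

/-! ### Inaccurate answers are rare -/

/-- Consistency is applied conditionally on the history, which contains the query, and integrated.
The event is restricted to queries in `X`, where alone consistency says something. -/
lemma measure_inaccurate_le {Ω : Type*} [MeasurableSpace Ω] {μ : Measure Ω}
    [IsProbabilityMeasure μ] {O : Kernel (Query d) ℝ} [IsMarkovKernel O] {X : Set (Pt d)}
    {f : Pt d → ℝ} {γ₁ γ₂ : ℝ} (hX : MeasurableSet X) (hf : ContinuousOn f X)
    (hO : Consistent X f γ₁ γ₂ O) {q : ℕ → Ω → Query d} {y : ℕ → Ω → ℝ}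
    (hqy : IsInteraction μ O q y) {δ : ℝ} (hδ : 0 < δ) (hδ1 : δ < 1) (τ : ℕ) :
    μ {ω | (1 ≤ (q τ ω).1 ∧ (q τ ω).2.1 ∈ X ∧ (q τ ω).2.2 ∈ X) ∧
      √((γ₁ + γ₂ * Real.log (1 / δ)) / (q τ ω).1)
        < |y τ ω - (f (q τ ω).2.2 - f (q τ ω).2.1)|} ≤ ENNReal.ofReal δ := by
  classical
  -- Outside `X` the function `f` need not be measurable, so it is cut off there.
  let g : Pt d → ℝ := X.piecewise f 0
  have hg : Measurable g := hf.measurable_piecewise continuousOn_const hX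
  have hgf : ∀ x ∈ X, g x = f x := fun x hx => Set.piecewise_eq_of_mem _ _ _ hx
  let V : Set (Query d) := {a | 1 ≤ a.1 ∧ a.2.1 ∈ X ∧ a.2.2 ∈ X}
  have hV : MeasurableSet V :=
    ((measurable_fst (measurableSet_Ici (a := (1 : ℕ))))).inter
      (((measurable_fst.comp measurable_snd) hX).inter ((measurable_snd.comp measurable_snd) hX))
  let S : Set (((Fin τ → Query d × ℝ) × Query d) × ℝ) :=
    {p | p.1.2 ∈ V ∧ √((γ₁ + γ₂ * Real.log (1 / δ)) / p.1.2.1)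
      < |p.2 - (g p.1.2.2.2 - g p.1.2.2.1)|}
  have hS : MeasurableSet S := by
    refine MeasurableSet.inter ((measurable_snd.comp measurable_fst) hV) ?_
    have h0 : Measurable fun n : ℕ => √((γ₁ + γ₂ * Real.log (1 / δ)) / (n : ℝ)) :=
      measurable_from_top
    have h1 : Measurable fun p : ((Fin τ → Query d × ℝ) × Query d) × ℝ => g p.1.2.2.1 :=
      hg.comp (by fun_prop)
    have h2 : Measurable fun p : ((Fin τ → Query d × ℝ) × Query d) × ℝ => g p.1.2.2.2 :=
      hg.comp (by fun_prop)
    have h3 : Measurable fun p : ((Fin τ → Query d × ℝ) × Query d) × ℝ =>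
        √((γ₁ + γ₂ * Real.log (1 / δ)) / (p.1.2.1 : ℝ)) := h0.comp (by fun_prop)
    exact measurableSet_lt h3 (measurable_snd.sub (h2.sub h1)).abs
  have hlaw := hqy.law_answer τ
  have hmeas : AEMeasurable (fun ω => (history q y τ ω, y τ ω)) μ := hlaw.aemeasurable
  have hhist : AEMeasurable (history q y τ) μ := hmeas.fst
  have := Measure.isProbabilityMeasure_map (μ := μ) hhist
  have hsub : {ω | (1 ≤ (q τ ω).1 ∧ (q τ ω).2.1 ∈ X ∧ (q τ ω).2.2 ∈ X) ∧
      √((γ₁ + γ₂ * Real.log (1 / δ)) / (q τ ω).1)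
        < |y τ ω - (f (q τ ω).2.2 - f (q τ ω).2.1)|}
      ⊆ (fun ω => (history q y τ ω, y τ ω)) ⁻¹' S := by
    rintro ω ⟨hω, hlt⟩
    refine ⟨hω, ?_⟩
    show _ < |y τ ω - (g (q τ ω).2.2 - g (q τ ω).2.1)|
    rw [hgf _ hω.2.1, hgf _ hω.2.2]
    exact hlt
  refine (measure_mono hsub).trans ?_
  rw [← Measure.map_apply_of_aemeasurable hmeas hS, hlaw.map_eq, Measure.compProd_apply hS]
  calc _ ≤ ∫⁻ _, ENNReal.ofReal δ ∂(μ.map (history q y τ)) := by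
        refine lintegral_mono fun h => ?_
        rw [Kernel.comap_apply]
        by_cases hh : h.2 ∈ V
        · refine (measure_mono ?_).trans
            (hO δ hδ hδ1 h.2.1 hh.1 h.2.2.1 hh.2.1 h.2.2.2 hh.2.2)
          rintro z ⟨-, hz⟩
          rw [← hgf _ hh.2.1, ← hgf _ hh.2.2]
          exact hz
        · have : Prod.mk h ⁻¹' S = ∅ := by
            ext z
            simp only [Set.mem_preimage, Set.mem_empty_iff_false, iff_false]
            exact fun hz => hh hz.1
          rw [this]
          simp
    _ = ENNReal.ofReal δ := by simp


/-! ### Long horizons -/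

section Tuned

variable {d T k : ℕ}

lemma rpow_le_gridSize : (T : ℝ) ^ (1 / (2 * (k : ℝ) + d)) ≤ gridSize T k d := Nat.le_ceil _

lemma one_le_rpow (hT : 1 ≤ T) {s : ℝ} (hs : 0 ≤ s) : 1 ≤ (T : ℝ) ^ s :=
  Real.one_le_rpow (by exact_mod_cast hT) hs

lemma gridSize_le (hT : 1 ≤ T) :
    (gridSize T k d : ℝ) ≤ 2 * (T : ℝ) ^ (1 / (2 * (k : ℝ) + d)) := by
  have h1 := one_le_rpow hT (s := 1 / (2 * (k : ℝ) + d)) (by positivity)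
  have h2 : (gridSize T k d : ℝ) < (T : ℝ) ^ (1 / (2 * (k : ℝ) + d)) + 1 :=
    Nat.ceil_lt_add_one (by positivity)
  linarith

lemma two_le_gridSize (hT : 2 ≤ T) (hk : 1 ≤ k) : 2 ≤ gridSize T k d := by
  have hk' : (1 : ℝ) ≤ k := by exact_mod_cast hk
  have h1 : 1 < (T : ℝ) ^ (1 / (2 * (k : ℝ) + d)) :=
    Real.one_lt_rpow (by exact_mod_cast hT) (by positivity)
  have h2 := h1.trans_le (rpow_le_gridSize (T := T) (k := k) (d := d))
  have h3 : 1 < gridSize T k d := by exact_mod_cast h2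
  omega

lemma le_gridSize (hk : 1 ≤ k) (hT : d ^ (2 * k + d) ≤ T) : d ≤ gridSize T k d := by
  have h1 : (d : ℝ) ≤ (T : ℝ) ^ (1 / (2 * (k : ℝ) + d)) := by
    have h2 : ((d ^ (2 * k + d) : ℕ) : ℝ) ≤ T := by exact_mod_cast hT
    calc (d : ℝ) = ((d ^ (2 * k + d) : ℕ) : ℝ) ^ (1 / (2 * (k : ℝ) + d)) := by
          have := Real.pow_rpow_inv_natCast (x := (d : ℝ)) (n := 2 * k + d) (by positivity)
            (by omega)
          push_cast at this ⊢
          rw [one_div, this]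
      _ ≤ _ := Real.rpow_le_rpow (by positivity) h2 (by positivity)
  exact_mod_cast h1.trans (rpow_le_gridSize (T := T) (k := k) (d := d))

lemma gridSize_pow_le (hT : 1 ≤ T) : (gridSize T k d : ℝ) ^ d ≤ 2 ^ d * T := by
  have hT' : (1 : ℝ) ≤ T := by exact_mod_cast hT
  calc (gridSize T k d : ℝ) ^ d ≤ (2 * (T : ℝ) ^ (1 / (2 * (k : ℝ) + d))) ^ d := by
        gcongr; exact gridSize_le hT
    _ = 2 ^ d * (T : ℝ) ^ ((1 / (2 * (k : ℝ) + d)) * d) := by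
        rw [mul_pow, Real.rpow_mul_natCast (by positivity)]
    _ ≤ 2 ^ d * (T : ℝ) ^ (1 : ℝ) := by
        gcongr
        rw [one_div_mul_eq_div]
        exact div_le_one_of_le₀ (by linarith [Nat.cast_nonneg (α := ℝ) k]) (by positivity)
    _ = _ := by rw [Real.rpow_one]

/-- The cumulative bias of the local polynomials; `J` is chosen so that it has the same order as the
exploration cost in `sqrt_gridSize_le`. -/
lemma div_gridSize_pow_le (hT : 1 ≤ T) (hk : 1 ≤ k) :
    (T : ℝ) / (gridSize T k d : ℝ) ^ k ≤ (T : ℝ) ^ (((k : ℝ) + d) / (2 * k + d)) := by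
  have hT' : (0 : ℝ) < T := by exact_mod_cast hT
  have hk' : (1 : ℝ) ≤ k := by exact_mod_cast hk
  have h1 : (T : ℝ) ^ ((1 / (2 * (k : ℝ) + d)) * k) ≤ (gridSize T k d : ℝ) ^ k := by
    rw [Real.rpow_mul_natCast (by positivity)]
    gcongr
    exact rpow_le_gridSize
  rw [div_le_iff₀ ((Real.rpow_pos_of_pos hT' _).trans_le h1)]
  calc (T : ℝ) = (T : ℝ) ^ (((k : ℝ) + d) / (2 * k + d))
        * (T : ℝ) ^ ((1 / (2 * (k : ℝ) + d)) * k) := by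
        rw [← Real.rpow_add hT', ← Real.rpow_one (T : ℝ), ← Real.rpow_mul hT'.le]
        congr 1
        field_simp
        ring
    _ ≤ _ := by gcongr

lemma sqrt_gridSize_le (hT : 1 ≤ T) (hk : 1 ≤ k) :
    √(8 * (gridSize T k d : ℝ) ^ d * T)
      ≤ √(8 * 2 ^ d) * (T : ℝ) ^ (((k : ℝ) + d) / (2 * k + d)) := by
  have hT' : (0 : ℝ) < T := by exact_mod_cast hT
  have hk' : (1 : ℝ) ≤ k := by exact_mod_cast hk
  rw [Real.sqrt_le_left (by positivity), mul_pow, Real.sq_sqrt (by positivity)]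
  calc 8 * (gridSize T k d : ℝ) ^ d * T
      ≤ 8 * (2 * (T : ℝ) ^ (1 / (2 * (k : ℝ) + d))) ^ d * T := by
        gcongr; exact gridSize_le hT
    _ = 8 * 2 ^ d * ((T : ℝ) ^ ((1 / (2 * (k : ℝ) + d)) * d) * (T : ℝ) ^ (1 : ℝ)) := by
        rw [mul_pow, Real.rpow_mul_natCast (by positivity), Real.rpow_one]; ring
    _ = _ := by
        rw [← Real.rpow_add hT', ← Real.rpow_mul_natCast hT'.le]
        congr 2
        push_cast
        field_simp
        ring

variable (P : Params d)

/-- The square root of the logarithm in the constants of the algorithm. -/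
noncomputable def Params.sqrtLog : ℝ := √(Real.log (5 * P.ν * P.T))

variable {P}

lemma Params.one_le_sqrtLog (hk : 1 ≤ P.k) (hT : 2 ≤ P.T) : 1 ≤ P.sqrtLog :=
  Real.one_le_sqrt.2 (Params.one_le_log hk hT)

lemma Params.sqrtLog_sq (hk : 1 ≤ P.k) (hT : 2 ≤ P.T) :
    P.sqrtLog ^ 2 = Real.log (5 * P.ν * P.T) :=
  Real.sq_sqrt (by linarith [Params.one_le_log hk hT])

lemma Params.C₂'_eq (hk : 1 ≤ P.k) (hT : 2 ≤ P.T) :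
    P.C₂' = (12 * P.ν + 116 * P.M) * P.C₂ * P.ν ^ 2 * P.sqrtLog ^ 3 := by
  rw [Params.C₂', Params.sqrtLog, Real.sqrt_eq_rpow, ← Real.rpow_mul_natCast
    (by linarith [Params.one_le_log hk hT])]
  norm_num

lemma Params.C₃_eq (hk : 1 ≤ P.k) (hT : 2 ≤ P.T) :
    P.C₃ = ((68 * P.M + 85 * √P.C₁) * P.M * P.ν ^ 2 * P.sqrtLog ^ 3) ^ 2 := by
  rw [Params.C₃, ← Params.sqrtLog_sq hk hT]
  ring

lemma Params.errConst_eq (hk : 1 ≤ P.k) (hT : 2 ≤ P.T) :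
    P.errConst = 36 * P.ν ^ 2 * P.sqrtLog ^ 2 * P.C₂ := by
  rw [Params.errConst, Params.sqrtLog_sq hk hT]

lemma Params.errSlope_eq (hk : 1 ≤ P.k) (hT : 2 ≤ P.T) :
    P.errSlope = 32 * P.ν ^ 2 * P.sqrtLog ^ 2 * (P.M + √P.C₁) := by
  rw [Params.errSlope, Params.sqrtLog_sq hk hT]

lemma Params.sqrt_C₃_eq (hM : 0 ≤ P.M) (hk : 1 ≤ P.k) (hT : 2 ≤ P.T) :
    √P.C₃ = (68 * P.M + 85 * √P.C₁) * P.M * P.ν ^ 2 * P.sqrtLog ^ 3 := by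
  have h1 := Params.one_le_sqrtLog hk hT
  rw [Params.C₃_eq hk hT, Real.sqrt_sq (by positivity)]

lemma Params.one_div_sqrt_Nz_le (hC₃ : 1 ≤ P.C₃) (ζ : ℕ) :
    1 / √(P.Nz ζ) ≤ Params.eps ζ / √P.C₃ := by
  have hN : (0 : ℝ) < P.Nz ζ := by exact_mod_cast Params.one_le_Nz hC₃ ζ
  have hε := Params.eps_pos ζ
  have h := Params.C₃_le_Nz_mul (P := P) ζ
  rw [div_le_div_iff₀ (by positivity) (Real.sqrt_pos.2 (by linarith)), one_mul,
    Real.sqrt_le_left (by positivity), mul_pow, Real.sq_sqrt hN.le]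
  linarith

/-- `C₂'` has one more power of `σ` than `errConst`, and `√C₃` one more than `errSlope`; a large `σ`
outweighs the numerical constants. -/
lemma Params.error_le_of_sqrtLog (hM : 0 < P.M) (hk : 1 ≤ P.k) (hT : 2 ≤ P.T)
    (hC₂ : 0 ≤ P.C₂) (hC₃ : 1 ≤ P.C₃) (h12 : 12 ≤ P.sqrtLog) (h4M : 4 ≤ P.M * P.sqrtLog) (ζ : ℕ) :
    P.errConst + 2 * P.errSlope / √(P.Nz ζ) ≤ (Params.eps ζ + P.C₂') / 4 := by
  have hν := Params.one_le_nu_real hk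
  have hε := Params.eps_pos ζ
  have hsC₃ := Params.sqrt_C₃_eq hM.le hk hT
  have hs3 : 0 < √P.C₃ := Real.sqrt_pos.2 (by linarith)
  have h1 : P.errConst ≤ P.C₂' / 4 := by
    rw [Params.errConst_eq hk hT, Params.C₂'_eq hk hT]
    have e1 : 36 * P.ν ^ 2 * P.sqrtLog ^ 2 * P.C₂ ≤ 3 * P.ν ^ 2 * P.sqrtLog ^ 3 * P.C₂ := by
      have : 36 * P.ν ^ 2 * P.sqrtLog ^ 2 * P.C₂ = 3 * P.ν ^ 2 * (12 * P.sqrtLog ^ 2) * P.C₂ := by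
        ring
      rw [this]
      gcongr
      nlinarith [sq_nonneg P.sqrtLog]
    have e2 : 12 * (P.C₂ * P.ν ^ 2 * P.sqrtLog ^ 3)
        ≤ (12 * P.ν + 116 * P.M) * (P.C₂ * P.ν ^ 2 * P.sqrtLog ^ 3) := by
      gcongr
      nlinarith
    linarith
  have h2 : 2 * P.errSlope / √(P.Nz ζ) ≤ Params.eps ζ / 4 := by
    have e1 : 8 * P.errSlope ≤ √P.C₃ := by
      rw [Params.errSlope_eq hk hT, hsC₃]
      have e2 : 256 * (P.M + √P.C₁) ≤ (68 * P.M + 85 * √P.C₁) * (P.M * P.sqrtLog) := by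
        nlinarith [Real.sqrt_nonneg P.C₁]
      have e3 := mul_le_mul_of_nonneg_left e2 (show 0 ≤ P.ν ^ 2 * P.sqrtLog ^ 2 by positivity)
      linarith
    have e4 : 0 ≤ P.errSlope := by rw [Params.errSlope_eq hk hT]; positivity
    calc 2 * P.errSlope / √(P.Nz ζ) = 2 * P.errSlope * (1 / √(P.Nz ζ)) := by ring
      _ ≤ 2 * P.errSlope * (Params.eps ζ / √P.C₃) := by
          exact mul_le_mul_of_nonneg_left (Params.one_div_sqrt_Nz_le hC₃ ζ) (by positivity)
      _ ≤ Params.eps ζ / 4 := by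
          rw [mul_div_assoc', div_le_iff₀ hs3]
          nlinarith
  linarith

/-- `√C₃` contains `85 M √C₁ σ³`, while the number of rounds is only of order `σ²`. -/
lemma Params.noise_le_of_sqrtLog (hM : 0 < P.M) (hk : 1 ≤ P.k) (hT : 2 ≤ P.T)
    (hC₃ : 1 ≤ P.C₃) {n : ℕ}
    (hn : 6 * ((Nat.clog 2 n : ℝ) + 1) ≤ 85 * P.M * P.sqrtLog ^ 3) (ζ : ℕ) :
    ((Nat.clog 2 n : ℝ) + 1) * √(2 * P.C₁ / P.Nz ζ) ≤ Params.eps ζ / 4 := by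
  have hν := Params.one_le_nu_real hk
  have hε := Params.eps_pos ζ
  have hσ := Params.one_le_sqrtLog hk hT
  have hsC₃ := Params.sqrt_C₃_eq hM.le hk hT
  have hs3 : 0 < √P.C₃ := Real.sqrt_pos.2 (by linarith)
  have h2 : √2 ≤ 3 / 2 := by
    rw [Real.sqrt_le_left (by norm_num)]; norm_num
  have h3 : 6 * ((Nat.clog 2 n : ℝ) + 1) * √P.C₁ ≤ √P.C₃ := by
    have e1 : 85 * P.M * P.sqrtLog ^ 3 * √P.C₁ * 1 ≤ 85 * P.M * P.sqrtLog ^ 3 * √P.C₁ * P.ν ^ 2 := by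
      gcongr
      exact one_le_pow₀ hν
    have e2 := mul_le_mul_of_nonneg_right hn (Real.sqrt_nonneg P.C₁)
    have e3 : 0 ≤ 68 * P.M * P.M * P.ν ^ 2 * P.sqrtLog ^ 3 := by positivity
    rw [hsC₃]
    linarith
  calc ((Nat.clog 2 n : ℝ) + 1) * √(2 * P.C₁ / P.Nz ζ)
      = ((Nat.clog 2 n : ℝ) + 1) * (√2 * √P.C₁ * (1 / √(P.Nz ζ))) := by
        rw [Real.sqrt_div' _ (by positivity), Real.sqrt_mul (by norm_num)]; ring
    _ ≤ ((Nat.clog 2 n : ℝ) + 1) * (3 / 2 * √P.C₁ * (Params.eps ζ / √P.C₃)) := by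
        have := Params.one_div_sqrt_Nz_le hC₃ ζ
        gcongr ?_ * (?_ * _ * ?_)
    _ = (6 * ((Nat.clog 2 n : ℝ) + 1) * √P.C₁) * (Params.eps ζ / √P.C₃) / 4 := by ring
    _ ≤ √P.C₃ * (Params.eps ζ / √P.C₃) / 4 := by gcongr
    _ = Params.eps ζ / 4 := by rw [mul_div_cancel₀ _ hs3.ne']

lemma natLog_le {n : ℕ} (hk : 1 ≤ P.k) (hT : 2 ≤ P.T) (hn : 1 ≤ n) (hnT : n ≤ 8 * P.T + 1) :
    (Nat.log 2 n : ℝ) ≤ 3 * P.sqrtLog ^ 2 := by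
  have hν := Params.one_le_nu_real hk
  have hT' : (2 : ℝ) ≤ P.T := by exact_mod_cast hT
  have hnT' : (n : ℝ) ≤ 8 * P.T + 1 := by exact_mod_cast hnT
  have hn' : (0 : ℝ) < n := by exact_mod_cast hn
  have h10 : 5 * (P.T : ℝ) ≤ 5 * P.ν * P.T := by nlinarith
  have h1 : (n : ℝ) ≤ (5 * P.ν * P.T) ^ 2 := by nlinarith
  rw [Params.sqrtLog_sq hk hT]
  refine (Real.natLog_le_logb n 2).trans ?_
  push_cast
  rw [Real.logb, div_le_iff₀ (Real.log_pos (by norm_num))]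
  have h3 := Real.log_le_log hn' h1
  rw [Real.log_pow] at h3
  have h4 := Real.log_two_gt_d9
  have h5 := Params.one_le_log hk hT
  push_cast at h3
  nlinarith

lemma clog_le (hk : 1 ≤ P.k) (hT : 2 ≤ P.T) {n : ℕ} (hn : n ≤ 2 ^ d * P.T) :
    (Nat.clog 2 n : ℝ) + 1 ≤ (d + 5) * P.sqrtLog ^ 2 := by
  have h1 : Nat.clog 2 n ≤ d + (Nat.log 2 P.T + 1) := by
    refine Nat.clog_le_of_le_pow (hn.trans ?_)
    rw [pow_add]
    exact Nat.mul_le_mul_left _ (Nat.lt_pow_succ_log_self (by norm_num) _).le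
  have h2 : (Nat.clog 2 n : ℝ) ≤ d + (Nat.log 2 P.T + 1) := by exact_mod_cast h1
  have h3 := natLog_le (n := P.T) hk hT (by omega) (by omega)
  have h4 : 1 ≤ P.sqrtLog ^ 2 := one_le_pow₀ (Params.one_le_sqrtLog hk hT)
  nlinarith [Nat.cast_nonneg (α := ℝ) d]

end Tuned


/-! ### Absorption of all constants for long horizons. -/

section Horizon

open Filter

variable {d k : ℕ} {M γ₁ γ₂ : ℝ}

/-- The factor in the bound of the loss of an outer iteration. -/
noncomputable def phaseConst (d k : ℕ) (M γ₁ γ₂ : ℝ) : ℝ :=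
  48 * ((4 + 4 * M) * ((12 * nu k d + 116 * M) * (nu k d : ℝ) ^ 2) + 36 * (nu k d : ℝ) ^ 2)
      * (((d : ℝ) + k) ^ k * M)
    + √(8 * 2 ^ d) * (6 * (4 + 4 * M) * (2 * ((68 * M + 85 * √(γ₁ + 2 * γ₂)) * M
        * (nu k d : ℝ) ^ 2)) + 12 * (32 * (nu k d : ℝ) ^ 2 * (M + √(γ₁ + 2 * γ₂))) * 4)

section

variable {T : ℕ} {feas : Set (Pt d)} {center : (Fin d → Fin (gridSize T k d)) → Pt d}

lemma log_le_sqrtLog_sq (hk : 1 ≤ k) (hT : 2 ≤ T) :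
    Real.log T ≤ (tunedParams T k M γ₁ γ₂ feas center).sqrtLog ^ 2 := by
  have hν : 1 ≤ (tunedParams T k M γ₁ γ₂ feas center).ν := Params.one_le_nu_real hk
  have hT' : (2 : ℝ) ≤ T := by exact_mod_cast hT
  rw [Params.sqrtLog_sq hk hT]
  refine Real.log_le_log (by linarith) ?_
  show (T : ℝ) ≤ 5 * (tunedParams T k M γ₁ γ₂ feas center).ν * T
  nlinarith

lemma sqrt_C₁_le (hk : 1 ≤ k) (hT : 2 ≤ T) (hγ₁ : 0 ≤ γ₁) (hγ₂ : 0 ≤ γ₂) :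
    √(tunedParams T k M γ₁ γ₂ feas center).C₁
      ≤ √(γ₁ + 2 * γ₂) * (tunedParams T k M γ₁ γ₂ feas center).sqrtLog := by
  have h1 := log_le_sqrtLog_sq (M := M) (γ₁ := γ₁) (γ₂ := γ₂) (feas := feas) (center := center)
    hk hT
  have h2 := Params.one_le_sqrtLog (P := tunedParams T k M γ₁ γ₂ feas center) hk hT
  set σ := (tunedParams T k M γ₁ γ₂ feas center).sqrtLog
  rw [Real.sqrt_le_left (by positivity), mul_pow, Real.sq_sqrt (by positivity)]
  show γ₁ + 2 * γ₂ * Real.log T ≤ _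
  have h3 : 1 ≤ σ ^ 2 := one_le_pow₀ h2
  nlinarith [mul_le_mul_of_nonneg_left h1 hγ₂, mul_le_mul_of_nonneg_left h3 hγ₁]

lemma sqrt_C₃_le (hk : 1 ≤ k) (hT : 2 ≤ T) (hM : 0 ≤ M) (hγ₁ : 0 ≤ γ₁) (hγ₂ : 0 ≤ γ₂) :
    √(tunedParams T k M γ₁ γ₂ feas center).C₃
      ≤ (68 * M + 85 * √(γ₁ + 2 * γ₂)) * M * (nu k d : ℝ) ^ 2
        * (tunedParams T k M γ₁ γ₂ feas center).sqrtLog ^ 4 := by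
  have h1 := sqrt_C₁_le (M := M) (feas := feas) (center := center) hk hT hγ₁ hγ₂
  have h2 := Params.one_le_sqrtLog (P := tunedParams T k M γ₁ γ₂ feas center) hk hT
  rw [Params.sqrt_C₃_eq (P := tunedParams T k M γ₁ γ₂ feas center) hM hk hT]
  set σ := (tunedParams T k M γ₁ γ₂ feas center).sqrtLog
  show (68 * M + 85 * √(tunedParams T k M γ₁ γ₂ feas center).C₁) * M * (nu k d : ℝ) ^ 2 * σ ^ 3 ≤ _
  calc (68 * M + 85 * √(tunedParams T k M γ₁ γ₂ feas center).C₁) * M * (nu k d : ℝ) ^ 2 * σ ^ 3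
      ≤ ((68 * M + 85 * √(γ₁ + 2 * γ₂)) * σ) * M * (nu k d : ℝ) ^ 2 * σ ^ 3 := by
        gcongr
        nlinarith
    _ = _ := by ring

/-- Powers of `σ`: `C₂'` gives `3`, `√C₃` gives `4` because `√C₁` hides one, and `errSlope` with its
logarithm gives `3 + 2`. -/
lemma phaseBound_le (hk : 1 ≤ k) (hT : 2 ≤ T) (hM : 0 ≤ M) (hγ₁ : 0 ≤ γ₁) (hγ₂ : 0 ≤ γ₂) :
    (tunedParams T k M γ₁ γ₂ feas center).phaseBound
      ≤ phaseConst d k M γ₁ γ₂ * (T : ℝ) ^ (((k : ℝ) + d) / (2 * k + d))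
        * (tunedParams T k M γ₁ γ₂ feas center).sqrtLog ^ 5 := by
  have hC₁ := sqrt_C₁_le (M := M) (feas := feas) (center := center) hk hT hγ₁ hγ₂
  have hC₃ := sqrt_C₃_le (M := M) (feas := feas) (center := center) hk hT hM hγ₁ hγ₂
  have hσ := Params.one_le_sqrtLog (P := tunedParams T k M γ₁ γ₂ feas center) hk hT
  have hlog := natLog_le (P := tunedParams T k M γ₁ γ₂ feas center) (n := 8 * T + 1) hk hT
    (by omega) le_rfl
  have hgrid := sqrt_gridSize_le (d := d) (by omega : 1 ≤ T) hk
  have hdiv := div_gridSize_pow_le (d := d) (by omega : 1 ≤ T) hk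
  unfold Params.phaseBound
  rw [Params.C₂'_eq (P := tunedParams T k M γ₁ γ₂ feas center) hk hT,
    Params.errConst_eq (P := tunedParams T k M γ₁ γ₂ feas center) hk hT,
    Params.errSlope_eq (P := tunedParams T k M γ₁ γ₂ feas center) hk hT,
    Real.sqrt_mul (by norm_num : (0 : ℝ) ≤ 2)]
  set σ := (tunedParams T k M γ₁ γ₂ feas center).sqrtLog with hσdef
  set s₁ := √(tunedParams T k M γ₁ γ₂ feas center).C₁ with hs₁
  set s₃ := √(tunedParams T k M γ₁ γ₂ feas center).C₃ with hs₃
  set E := (T : ℝ) ^ (((k : ℝ) + d) / (2 * k + d)) with hE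
  have hE0 : 0 ≤ E := by positivity
  have hs₁0 : 0 ≤ s₁ := Real.sqrt_nonneg _
  have hs₃0 : 0 ≤ s₃ := Real.sqrt_nonneg _
  set c := √(γ₁ + 2 * γ₂) with hc
  have hc0 : 0 ≤ c := Real.sqrt_nonneg _
  set n : ℝ := (nu k d : ℝ) with hn
  have hn0 : 0 ≤ n := Nat.cast_nonneg _
  have h2 : √2 ≤ 2 := by rw [Real.sqrt_le_left (by norm_num)]; norm_num
  show 48 * (T : ℝ) * ((4 + 4 * M) * ((12 * n + 116 * M)
      * (((d : ℝ) + k) ^ k * M / (gridSize T k d : ℝ) ^ k) * n ^ 2 * σ ^ 3)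
      + 36 * n ^ 2 * σ ^ 2 * (((d : ℝ) + k) ^ k * M / (gridSize T k d : ℝ) ^ k))
    + √(8 * (gridSize T k d : ℝ) ^ d * T) * (6 * (4 + 4 * M) * (√2 * s₃)
      + 12 * (32 * n ^ 2 * σ ^ 2 * (M + s₁)) * (1 + Nat.log 2 (8 * T + 1))) ≤ _
  have hσ23 : σ ^ 2 ≤ σ ^ 5 := pow_le_pow_right₀ hσ (by norm_num)
  have hσ35 : σ ^ 3 ≤ σ ^ 5 := pow_le_pow_right₀ hσ (by norm_num)
  have hσ45 : σ ^ 4 ≤ σ ^ 5 := pow_le_pow_right₀ hσ (by norm_num)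
  have hσ0 : 0 ≤ σ := by linarith
  have hone : (1 : ℝ) + Nat.log 2 (8 * T + 1) ≤ 4 * σ ^ 2 := by
    have : 1 ≤ σ ^ 2 := one_le_pow₀ hσ
    linarith
  have hpart₁ : 48 * (T : ℝ) * ((4 + 4 * M) * ((12 * n + 116 * M)
      * (((d : ℝ) + k) ^ k * M / (gridSize T k d : ℝ) ^ k) * n ^ 2 * σ ^ 3)
      + 36 * n ^ 2 * σ ^ 2 * (((d : ℝ) + k) ^ k * M / (gridSize T k d : ℝ) ^ k))
      ≤ 48 * ((4 + 4 * M) * ((12 * n + 116 * M) * n ^ 2) + 36 * n ^ 2)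
        * (((d : ℝ) + k) ^ k * M) * E * σ ^ 5 := by
    calc _ = 48 * ((4 + 4 * M) * ((12 * n + 116 * M) * n ^ 2) * σ ^ 3 + 36 * n ^ 2 * σ ^ 2)
          * (((d : ℝ) + k) ^ k * M) * (T / (gridSize T k d : ℝ) ^ k) := by ring
      _ ≤ 48 * ((4 + 4 * M) * ((12 * n + 116 * M) * n ^ 2) * σ ^ 5 + 36 * n ^ 2 * σ ^ 5)
          * (((d : ℝ) + k) ^ k * M) * E := by gcongr
      _ = _ := by ring
  have hpart₂ : 6 * (4 + 4 * M) * (√2 * s₃)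
      + 12 * (32 * n ^ 2 * σ ^ 2 * (M + s₁)) * (1 + Nat.log 2 (8 * T + 1))
      ≤ (6 * (4 + 4 * M) * (2 * ((68 * M + 85 * c) * M * n ^ 2))
        + 12 * (32 * n ^ 2 * (M + c)) * 4) * σ ^ 5 := by
    have hMs : M + s₁ ≤ (M + c) * σ := by nlinarith
    calc _ ≤ 6 * (4 + 4 * M) * (2 * ((68 * M + 85 * c) * M * n ^ 2 * σ ^ 4))
        + 12 * (32 * n ^ 2 * σ ^ 2 * ((M + c) * σ)) * (4 * σ ^ 2) := by gcongr
      _ ≤ 6 * (4 + 4 * M) * (2 * ((68 * M + 85 * c) * M * n ^ 2 * σ ^ 5))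
        + 12 * (32 * n ^ 2 * σ ^ 2 * ((M + c) * σ)) * (4 * σ ^ 2) := by gcongr
      _ = _ := by ring
  have hnn : 0 ≤ 6 * (4 + 4 * M) * (√2 * s₃)
      + 12 * (32 * n ^ 2 * σ ^ 2 * (M + s₁)) * (1 + Nat.log 2 (8 * T + 1)) := by positivity
  calc _ ≤ 48 * ((4 + 4 * M) * ((12 * n + 116 * M) * n ^ 2) + 36 * n ^ 2)
        * (((d : ℝ) + k) ^ k * M) * E * σ ^ 5
      + (√(8 * 2 ^ d) * E) * ((6 * (4 + 4 * M) * (2 * ((68 * M + 85 * c) * M * n ^ 2))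
        + 12 * (32 * n ^ 2 * (M + c)) * 4) * σ ^ 5) :=
        add_le_add hpart₁ (mul_le_mul hgrid hpart₂ hnn (by positivity))
    _ = _ := by unfold phaseConst; ring

end

/-- For long horizons the number of outer iterations and the constants in the bound of their losses
are absorbed by `ln ^ 4 T`. -/
lemma eventually_longHorizon (hk : 1 ≤ k) (hM : 0 < M) (hγ₁ : 0 ≤ γ₁) (hγ₂ : 0 ≤ γ₂) :
    ∃ T₀ : ℕ, ∀ T ≥ T₀, 2 ≤ T ∧ 2 ≤ gridSize T k d ∧ d ≤ gridSize T k d ∧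
      ∀ (feas : Set (Pt d)) (center : (Fin d → Fin (gridSize T k d)) → Pt d),
        (∀ f : Pt d → ℝ, (tunedParams T k M γ₁ γ₂ feas center).Regular f →
          (tunedParams T k M γ₁ γ₂ feas center).LongHorizon f) ∧
        1 ≤ (tunedParams T k M γ₁ γ₂ feas center).C₃ ∧
        (tunedParams T k M γ₁ γ₂ feas center).Nz 1 ≤ 8 * T ∧
        (Nat.log 4 (8 * T) : ℝ) * (tunedParams T k M γ₁ γ₂ feas center).phaseBound
          ≤ (T : ℝ) ^ (((k : ℝ) + d) / (2 * k + d)) * Real.log T ^ 4 := by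
  set K := phaseConst d k M γ₁ γ₂ with hK
  set a := (68 * M + 85 * √(γ₁ + 2 * γ₂)) * M * (nu k d : ℝ) ^ 2 with ha
  -- In order: `12` and `4 / M` for `error_le`, `(d + 5) / M` for `noise_le`, and `48 K` for the
  -- spare factor `σ` in the final bound.
  set κ := max (max 12 (4 / M)) (max ((d + 5) / M) (48 * K)) with hκ
  have h1 : ∀ᶠ T : ℕ in atTop, κ ^ 2 ≤ Real.log T :=
    (Real.tendsto_log_atTop.comp tendsto_natCast_atTop_atTop).eventually_ge_atTop _
  have h2 : ∀ᶠ T : ℕ in atTop, 16 * a ^ 2 * Real.log T ^ 4 ≤ T := by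
    have hlo := (Real.isLittleO_pow_log_id_atTop (n := 4)).comp_tendsto
      (tendsto_natCast_atTop_atTop (R := ℝ))
    have hpos : (0 : ℝ) < 1 / (16 * a ^ 2 + 1) := by positivity
    filter_upwards [hlo.bound hpos] with T hT
    simp only [Function.comp_apply, id_eq, Real.norm_eq_abs, Nat.abs_cast] at hT
    have h3 : Real.log T ^ 4 * (16 * a ^ 2 + 1) ≤ T := by
      have := (le_abs_self _).trans hT
      rwa [one_div, inv_mul_eq_div, le_div_iff₀ (by positivity)] at this
    have h4 : 0 ≤ Real.log T ^ 4 := by positivity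
    linarith
  -- `d ^ (2 * k + d) ≤ T` gives `d ≤ J`, `5 ν ≤ T` gives `σ² ≤ 2 ln T`, and the bound on `ln ^ 4 T`
  -- gives `C₃ ≤ T`, hence `N₁ ≤ 8 T`.
  obtain ⟨T₀, hT₀⟩ := eventually_atTop.1 ((h1.and h2).and ((eventually_ge_atTop 2).and
    ((eventually_ge_atTop (d ^ (2 * k + d))).and (eventually_ge_atTop (5 * nu k d)))))
  refine ⟨T₀, fun T hT => ?_⟩
  obtain ⟨⟨hlog, hC⟩, hT2, hTd, hTν⟩ := hT₀ T hT
  refine ⟨hT2, two_le_gridSize hT2 hk, le_gridSize hk hTd, fun feas center => ?_⟩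
  have hT1 : (2 : ℝ) ≤ T := by exact_mod_cast hT2
  have hsC₃ := sqrt_C₃_le (M := M) (feas := feas) (center := center) hk hT2 hM.le hγ₁ hγ₂
  have hB := phaseBound_le (M := M) (feas := feas) (center := center) hk hT2 hM.le hγ₁ hγ₂
  have hlogσ := log_le_sqrtLog_sq (M := M) (γ₁ := γ₁) (γ₂ := γ₂) (feas := feas) (center := center)
    hk hT2
  have hgrid := gridSize_pow_le (d := d) (k := k) (by omega : 1 ≤ T)
  set P := tunedParams T k M γ₁ γ₂ feas center with hP
  have hPk : 1 ≤ P.k := hk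
  have hPT : 2 ≤ P.T := hT2
  have hPM : 0 < P.M := hM
  have hν := Params.one_le_nu_real hPk
  have hσ1 := Params.one_le_sqrtLog hPk hPT
  have hsq := Params.sqrtLog_sq hPk hPT
  set σ := P.sqrtLog with hσ
  have hκσ : κ ≤ σ := by
    refine le_of_sq_le_sq ?_ (by linarith)
    linarith
  have h12 : 12 ≤ σ := (le_max_left _ _).trans ((le_max_left _ _).trans hκσ)
  have h4M : 4 ≤ P.M * σ := by
    have : 4 / M ≤ σ := (le_max_right _ _).trans ((le_max_left _ _).trans hκσ)
    rw [div_le_iff₀ hM] at this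
    rw [mul_comm]
    exact this
  have hd5 : (d : ℝ) + 5 ≤ P.M * σ := by
    have : ((d : ℝ) + 5) / M ≤ σ := (le_max_left _ _).trans ((le_max_right _ _).trans hκσ)
    rw [div_le_iff₀ hM] at this
    rw [mul_comm]
    exact this
  have h48 : 48 * K ≤ σ := (le_max_right _ _).trans ((le_max_right _ _).trans hκσ)
  have hσlog : σ ^ 2 ≤ 2 * Real.log T := by
    rw [hsq]
    have h5 : Real.log (5 * P.ν * P.T) = Real.log (5 * P.ν) + Real.log T :=
      Real.log_mul (by positivity) (by positivity)
    have h6 : Real.log (5 * P.ν) ≤ Real.log T := by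
      refine Real.log_le_log (by positivity) ?_
      show 5 * (nu k d : ℝ) ≤ T
      exact_mod_cast hTν
    linarith
  have hσ8 : σ ^ 8 ≤ 16 * Real.log T ^ 4 := by
    calc σ ^ 8 = (σ ^ 2) ^ 4 := by ring
      _ ≤ (2 * Real.log T) ^ 4 := by gcongr
      _ = _ := by ring
  have hC₂ : 0 ≤ P.C₂ := by
    show 0 ≤ ((d : ℝ) + k) ^ k * M / (gridSize T k d : ℝ) ^ k
    positivity
  have hC₃1 : 1 ≤ P.C₃ := by
    rw [Params.C₃_eq hPk hPT]
    refine one_le_pow₀ ?_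
    have e1 : 1 ≤ P.ν ^ 2 := one_le_pow₀ hν
    have e2 : 1 ≤ 68 * P.M * P.M * σ ^ 2 := by nlinarith
    have e3 : 68 * P.M * P.M * σ ^ 2 ≤ (68 * P.M + 85 * √P.C₁) * P.M * σ ^ 3 := by
      have : σ ^ 2 ≤ σ ^ 3 := pow_le_pow_right₀ hσ1 (by norm_num)
      gcongr
      linarith [Real.sqrt_nonneg P.C₁]
    have e4 : (68 * P.M + 85 * √P.C₁) * P.M * σ ^ 3 * 1
        ≤ (68 * P.M + 85 * √P.C₁) * P.M * σ ^ 3 * P.ν ^ 2 := by gcongr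
    linarith
  have hC₃T : P.C₃ ≤ T := by
    have e1 : P.C₃ = √P.C₃ ^ 2 := (Real.sq_sqrt (by linarith)).symm
    rw [e1]
    calc √P.C₃ ^ 2 ≤ (a * σ ^ 4) ^ 2 := by gcongr
      _ = a ^ 2 * σ ^ 8 := by ring
      _ ≤ a ^ 2 * (16 * Real.log T ^ 4) := by gcongr
      _ ≤ T := by linarith
  refine ⟨fun f hreg => ⟨hreg, hC₃1, ?_, ?_, ?_⟩, hC₃1, ?_, ?_⟩
  · rw [Params.C₂'_eq hPk hPT]
    positivity
  · exact Params.error_le_of_sqrtLog hPM hPk hPT hC₂ hC₃1 h12 h4M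
  · intro ζ n hn
    refine Params.noise_le_of_sqrtLog hPM hPk hPT hC₃1 ?_ ζ
    have e1 : n ≤ 2 ^ d * P.T := by
      have : (n : ℝ) ≤ 2 ^ d * T := le_trans (by exact_mod_cast hn) hgrid
      exact_mod_cast this
    have e2 := clog_le hPk hPT e1
    have e3 := mul_le_mul_of_nonneg_right hd5 (sq_nonneg σ)
    have e4 : 0 ≤ P.M * σ ^ 3 := by positivity
    have e5 : P.M * σ * σ ^ 2 = P.M * σ ^ 3 := by ring
    linarith
  · have e1 := Params.Nz_mul_le hC₃1 1
    have e2 : (P.Nz 1 : ℝ) ≤ 8 * T := by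
      unfold Params.eps at e1
      linarith
    exact_mod_cast e2
  · have e1 : (Nat.log 4 (8 * T) : ℝ) ≤ 3 * σ ^ 2 := by
      have e2 : Nat.log 4 (8 * T) ≤ Nat.log 2 (8 * T) :=
        Nat.log_anti_left (by norm_num) (by norm_num)
      have e3 := natLog_le (n := 8 * T) hPk hPT (by omega) (Nat.le_succ _)
      have e4 : (Nat.log 4 (8 * T) : ℝ) ≤ Nat.log 2 (8 * T) := by exact_mod_cast e2
      linarith
    set E := (T : ℝ) ^ (((k : ℝ) + d) / (2 * k + d)) with hE
    have hE0 : 0 ≤ E := by positivity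
    have hK0 : 0 ≤ K := by rw [hK, phaseConst]; positivity
    -- The count is `3 σ² · K σ⁵`; the eighth factor `σ` replaces `48 K`, and `σ⁸ ≤ 16 ln ^ 4 T`.
    calc (Nat.log 4 (8 * T) : ℝ) * P.phaseBound
        ≤ (Nat.log 4 (8 * T) : ℝ) * (K * E * σ ^ 5) := by gcongr
      _ ≤ 3 * σ ^ 2 * (K * E * σ ^ 5) := by gcongr
      _ = E * σ ^ 7 * (48 * K) / 16 := by ring
      _ ≤ E * σ ^ 7 * σ / 16 := by gcongr
      _ = E * (σ ^ 8 / 16) := by ring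
      _ ≤ E * Real.log T ^ 4 := by
          gcongr
          linarith

end Horizon

end PairwiseBandit

/-! ### The regret bound with high probability. -/

open PairwiseBandit in
theorem theorem1 :
    ∃ Cbar : MvPolynomial (Fin 2) ℝ,
    ∀ (d k : ℕ), 1 ≤ d → 1 ≤ k →
    ∀ (M γ₁ γ₂ : ℝ), 0 < M → 0 ≤ γ₁ → 0 ≤ γ₂ →
    ∃ (A : ℝ) (p : ℕ),
    ∀ (T : ℕ), 2 ≤ T →
    ∀ (X Z : Set (Pt d)) (f ψ : Pt d → ℝ) (xstar : Pt d) (δ₀ Lψ : ℝ),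
      -- the domain
      X ⊆ Set.Icc 0 1 → Convex ℝ X → IsCompact X →
      -- the objective, with an interior maximizer
      Holder X k M f →
      xstar ∈ X → IsMaxOn f X xstar → 0 < δ₀ → Metric.closedBall xstar δ₀ ⊆ X →
      -- the feasible region and the penalty
      Z ⊆ X → Convex ℝ Z → IsCompact Z → xstar ∈ Z →
      ConvexOn ℝ X ψ → (∀ x ∈ X, 0 ≤ ψ x) → (∀ x ∈ Z, ψ x = 0) →
      (∀ x ∈ X, ∀ x' ∈ X, |ψ x - ψ x'| ≤ Lψ * ‖x - x'‖) →
    ∀ (O : ProbabilityTheory.Kernel (Query d) ℝ) [ProbabilityTheory.IsMarkovKernel O],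
      Consistent X f γ₁ γ₂ O →
    ∀ (center : (Fin d → Fin (gridSize T k d)) → Pt d),
      (∀ j, ((tunedParams T k M γ₁ γ₂ (X ∩ Z) center).cell j).Nonempty →
        center j ∈ (tunedParams T k M γ₁ γ₂ (X ∩ Z) center).cell j) →
    ∀ {Ω : Type*} [MeasurableSpace Ω] (μ : MeasureTheory.Measure Ω)
      [MeasureTheory.IsProbabilityMeasure μ] (q : ℕ → Ω → Query d) (y : ℕ → Ω → ℝ),
      IsInteraction μ O q y →
      (∀ᵐ ω ∂μ, ∃ m : ℕ, (tunedParams T k M γ₁ γ₂ (X ∩ Z) center).IsRun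
        (transcript (fun τ => q τ ω) (fun τ => y τ ω) m)) →
      μ {ω | MvPolynomial.eval ![(k : ℝ), (d : ℝ)] Cbar
            * (M ^ 2 * (nu k d : ℝ) ^ 2 + (nu k d : ℝ) ^ 3
                + M * (nu k d : ℝ) ^ 2 * √(γ₁ + γ₂ * Real.log T))
            * (T : ℝ) ^ (((k : ℝ) + d) / (2 * k + d)) * Real.log T ^ 4
          < regret f (f xstar) ψ T (fun τ => q τ ω)}
        ≤ ENNReal.ofReal (A * Real.log T ^ p / (T : ℝ) ^ 2) := by
  refine ⟨1, fun d k _ hk M γ₁ γ₂ hM hγ₁ hγ₂ => ?_⟩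
  obtain ⟨T₀, hT₀⟩ := eventually_longHorizon (d := d) hk hM hγ₁ hγ₂
  -- `25` bounds the number of queries per period of the horizon; `T₀ ^ 2` makes the probability
  -- bound trivial for `T < T₀`. No logarithm is needed.
  refine ⟨max 25 ((T₀ : ℝ) ^ 2), 0, ?_⟩
  intro T hT X Z f ψ xstar δ₀ Lψ hX01 hX hXc hf hxX hmax hδ₀ hball hZX hZ _ hxZ _ _ hψ _ O _ hO
    center hcenter Ω _ μ _ q y hqy hrun
  have hT' : (2 : ℝ) ≤ T := by exact_mod_cast hT
  rcases lt_or_ge T T₀ with hlt | hge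
  · refine MeasureTheory.prob_le_one.trans ?_
    rw [← ENNReal.ofReal_one]
    refine ENNReal.ofReal_le_ofReal ?_
    rw [pow_zero, mul_one, one_le_div (by positivity)]
    have : (T : ℝ) ≤ T₀ := by exact_mod_cast hlt.le
    exact (pow_le_pow_left₀ (by positivity) this 2).trans (le_max_right _ _)
  obtain ⟨-, hJ2, hJd, hpar⟩ := hT₀ T hge
  obtain ⟨hlong, hC₃, hNz, hbound⟩ := hpar (X ∩ Z) center
  have hlogT : 0 ≤ Real.log T := Real.log_nonneg (by linarith)
  have hU : UniqueDiffOn ℝ X := uniqueDiffOn_convex hX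
    ⟨xstar, interior_mono hball (mem_interior_iff_mem_nhds.2 (Metric.closedBall_mem_nhds _ hδ₀))⟩
  set P := tunedParams T k M γ₁ γ₂ (X ∩ Z) center with hP
  have hC₁ : 0 ≤ P.C₁ := by
    show 0 ≤ γ₁ + 2 * γ₂ * Real.log T
    positivity
  have hC₂ : 0 ≤ P.C₂ := by
    show 0 ≤ ((d : ℝ) + k) ^ k * M / (gridSize T k d : ℝ) ^ k
    positivity
  have hLH : P.LongHorizon f := hlong f ⟨hM.le, hC₁, hC₂, hk, hT,
    fun j => isLinearizable_of_holder (P := P) hk hM.le hX hU hf Set.inter_subset_left hJ2 hJd rfl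
      hcenter j⟩
  obtain ⟨jstar, hjstar⟩ := exists_mem_cell (P := P) (show 1 ≤ gridSize T k d by omega)
    (hX01 hxX) (show xstar ∈ X ∩ Z from ⟨hxX, hxZ⟩)
  have hT3 : (1 : ℝ) / T ^ 3 < 1 := by
    rw [div_lt_one (by positivity)]
    exact one_lt_pow₀ (by linarith) (by norm_num)
  -- The level `δ = T ^ (-3)` survives a union over `25 T` queries. It is compatible with `C₁`, as
  -- `γ₁ + 3 γ₂ ln T ≤ 2 C₁`.
  let bad : ℕ → Set Ω := fun τ =>
    {ω | (1 ≤ (q τ ω).1 ∧ (q τ ω).2.1 ∈ X ∧ (q τ ω).2.2 ∈ X) ∧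
      √((γ₁ + γ₂ * Real.log (1 / (1 / (T : ℝ) ^ 3))) / (q τ ω).1)
        < |y τ ω - (f (q τ ω).2.2 - f (q τ ω).2.1)|}
  have hbad : ∀ τ, μ (bad τ) ≤ ENNReal.ofReal (1 / (T : ℝ) ^ 3) := fun τ =>
    measure_inaccurate_le hXc.measurableSet hf.1.continuousOn hO hqy (by positivity) hT3 τ
  have hcover : ∀ᵐ ω ∂μ, MvPolynomial.eval ![(k : ℝ), (d : ℝ)] 1
            * (M ^ 2 * (nu k d : ℝ) ^ 2 + (nu k d : ℝ) ^ 3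
                + M * (nu k d : ℝ) ^ 2 * √(γ₁ + γ₂ * Real.log T))
            * (T : ℝ) ^ (((k : ℝ) + d) / (2 * k + d)) * Real.log T ^ 4
          < regret f (f xstar) ψ T (fun τ => q τ ω) →
        ω ∈ ⋃ τ ∈ Finset.range (25 * T), bad τ := by
    filter_upwards [hrun] with ω ⟨m, hm⟩ hlt
    by_contra hnot
    simp only [Set.mem_iUnion, Finset.mem_range, exists_prop, not_exists, not_and] at hnot
    obtain ⟨hfeas, htime, htime'⟩ := hm.feasible hC₃ hNz
    have hstep : ∀ i < m, (⟨(q i ω).1, (q i ω).2.1, (q i ω).2.2, y i ω⟩ : Step d)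
        ∈ transcript (fun τ => q τ ω) (fun τ => y τ ω) m := fun i hi =>
      List.mem_map.2 ⟨i, List.mem_range.2 hi, rfl⟩
    have hm25 : m ≤ 25 * T := by
      have := length_le_time _ fun s hs => (hfeas s hs).1
      rw [transcript, List.length_map, List.length_range] at this
      exact this.trans htime'
    have hacc : ∀ s ∈ transcript (fun τ => q τ ω) (fun τ => y τ ω) m, P.Accurate f s := by
      intro s hs
      obtain ⟨h0, hx, hx'⟩ := hfeas s hs
      obtain ⟨i, hi, rfl⟩ := List.mem_map.1 hs
      have hi' := List.mem_range.1 hi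
      have h1 := hnot i (by omega)
      have h2 : |y i ω - (f (q i ω).2.2 - f (q i ω).2.1)|
          ≤ √((γ₁ + γ₂ * Real.log (1 / (1 / (T : ℝ) ^ 3))) / (q i ω).1) := by
        by_contra hcon
        exact h1 ⟨⟨h0, hx.1, hx'.1⟩, not_le.1 hcon⟩
      refine h2.trans (Real.sqrt_le_sqrt ?_)
      show _ ≤ 2 * (γ₁ + 2 * γ₂ * Real.log T) / ((q i ω).1 : ℝ)
      gcongr
      rw [one_div_one_div, Real.log_pow]
      push_cast
      nlinarith [mul_nonneg hγ₂ hlogT]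
    have hloss := hLH.loss_isRun_le hm hacc hNz (fun x hx => hmax hx.1) (fun x hx => by
      have h1 := abs_le.1 (hf.abs_le hx.1)
      have h2 := abs_le.1 (hf.abs_le hxX)
      show _ ≤ 2 * M
      linarith) hjstar
    rw [loss_transcript] at hloss
    have hreg := regret_le_sum (f := f) (v := f xstar) (T := T) (m := m)
      (q := fun τ => q τ ω) (by omega) hZ ⟨xstar, hxZ⟩ hψ
      (fun i hi => ⟨(hfeas _ (hstep i hi)).1, (hfeas _ (hstep i hi)).2.1.2,
        (hfeas _ (hstep i hi)).2.2.2⟩) (fun x hx => hmax (hZX hx))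
      (by rw [time_transcript] at htime; exact htime)
    have hν : (1 : ℝ) ≤ nu k d := Params.one_le_nu_real (P := P) hk
    -- Of the prefactor in the claim only `ν ^ 3 ≥ 1` is needed, the constants having been absorbed
    -- into the logarithms.
    have hcoef : 1 ≤ M ^ 2 * (nu k d : ℝ) ^ 2 + (nu k d : ℝ) ^ 3
        + M * (nu k d : ℝ) ^ 2 * √(γ₁ + γ₂ * Real.log T) := by
      have h1 : (1 : ℝ) ≤ (nu k d : ℝ) ^ 3 := one_le_pow₀ hν
      have h2 : 0 ≤ M ^ 2 * (nu k d : ℝ) ^ 2 := by positivity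
      have h3 : 0 ≤ M * (nu k d : ℝ) ^ 2 * √(γ₁ + γ₂ * Real.log T) := by positivity
      linarith
    rw [map_one, one_mul, mul_assoc] at hlt
    have hE : 0 ≤ (T : ℝ) ^ (((k : ℝ) + d) / (2 * k + d)) * Real.log T ^ 4 := by positivity
    have h1 := le_mul_of_one_le_left hE hcoef
    have h2 : (Nat.log 4 (8 * P.T) : ℝ) * P.phaseBound
      ≤ (T : ℝ) ^ (((k : ℝ) + d) / (2 * k + d)) * Real.log T ^ 4 := hbound
    linarith
  calc _ ≤ μ (⋃ τ ∈ Finset.range (25 * T), bad τ) := MeasureTheory.measure_mono_ae hcover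
    _ ≤ ∑ τ ∈ Finset.range (25 * T), μ (bad τ) := MeasureTheory.measure_biUnion_finset_le _ _
    _ ≤ ∑ _τ ∈ Finset.range (25 * T), ENNReal.ofReal (1 / (T : ℝ) ^ 3) :=
        Finset.sum_le_sum fun τ _ => hbad τ
    _ = ENNReal.ofReal (25 / (T : ℝ) ^ 2) := by
        rw [← ENNReal.ofReal_sum_of_nonneg fun _ _ => by positivity]
        congr 1
        rw [Finset.sum_const, Finset.card_range, nsmul_eq_mul]
        push_cast
        field_simp
    _ ≤ _ := by
        refine ENNReal.ofReal_le_ofReal ?_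
        rw [pow_zero, mul_one]
        gcongr
        exact le_max_left _ _
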